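/- A hypergraph $G$ consists of finite sets $V(G)$ and $E(G)$ and a vertex set $V(e)\subseteq V(G)$ for each (labelled) hyperedge $e\in E(G)$; distinct hyperedges may have the same vertex set, and the rank of $e$ is $|V(e)|$. For $A\subseteq E(G)$ let $V(A)=\bigcup_{e\in A}V(e)$, $\mathsf{bd}(A)=V(A)\cap V(E(G)\setminus A)$ and $\lambda(A)=|\mathsf{bd}(A)|$. A non-empty $A\subseteq E(G)$ is internally connected if it has no partition into two non-empty sets $B_1,B_2$ with $\mathsf{bd}(B_1),\mathsf{bd}(B_2)\subseteq\mathsf{bd}(A)$; an internal component of $C$ is an inclusion-maximal internally connected subset of $C$. $\mathcal O_{p}(\cdot)$ hides a factor that is a computable function of the parameters $p$, and $\log m$ in a time bound is read as $\log_2(m+2)$. Running times are numbers of steps of a pure LISP machine, whose unit-cost steps (allocating an immutable pair, following a pointer, comparing two numbers, adding or subtracting one, branching, calling a function) take constant time on a pointer machine and on a RAM. Let $r,s_1,s_2,k\ge 0$ be integers with $s_1\le s_2$. Let $\mathsf O$ be an $s_2$-bounded oracle for a dynamic hypergraph $G$ of rank at most $r$: given a set $S\subseteq E(G)$ of labelled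 hyperedges with $|S|\le s_2$, it returns $\top$ or $\bot$ in time $\mathcal O_{r,s_2}(\log|E(G)|)$, and its answer $\mathsf O(S)$ depends only on $S$ and $\mathsf{bd}(S)$. There is a data structure that maintains $G$ and supports the following operations. - $\mathsf{Init}$: initialize with the empty hypergraph (given $r,s_1,s_2,k$), in time $\mathcal O(1)$. - $\mathsf{AddVertex}(v)$: given $v\notin V(G)$, add $v$ to $G$, in time $\mathcal O(1)$. - $\mathsf{DeleteVertex}(v)$: given $v\in V(G)$ that lies in no hyperedge, remove $v$ from $G$, in time $\mathcal O(1)$. - $\mathsf{AddHyperedge}(e)$: given a hyperedge $e$ of rank at most $r$ with $V(e)\subseteq V(G)$ whose label is not in use in $E(G)$, add $e$ to $G$, in time $\mathcal O_{r,s_2,k}(\log|E(G)|)$. - $\mathsf{DeleteHyperedge}(e)$: given $e\in E(G)$, remove $e$ from $G$, in time $\mathcal O_{r,s_2,k}(\log|E(G)|)$. - $\mathsf{Query}$: in time $\mathcal O_{r,s_2,k}(1)$, either return a set $C\subseteq E(G)$ such that $s_1/2\le|C|\le s_2$, $\lambda(C)\le k$, and every internal component $C'$ of $C$ satisfies $\mathsf{bd}(C')=\mathsf{bd}(C)$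 and $\mathsf O(C')=\top$; or report that no set $C$ with these last three properties and $s_1\le|C|\le s_2$ exists, which is then the case. The hidden constants of $\mathsf{Init}$, $\mathsf{AddVertex}$ and $\mathsf{DeleteVertex}$ are absolute, and the code of the data structure depends neither on the parameters nor on the oracle. -/

import Mathlib

namespace DynLocalSearch

/-! ### Labelled hypergraphs -/

/-- A finite hypergraph with labelled hyperedges.  Vertices and hyperedge labels are natural
numbers; `inc e` is the vertex set `V(e)` of the hyperedge `e` (irrelevant for `e ∉ edges`).
Distinct hyperedges may have the same vertex set. -/
structure Hypergraph where
  verts : Finset ℕ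
  edges : Finset ℕ
  inc : ℕ → Finset ℕ
  inc_subset : ∀ e ∈ edges, inc e ⊆ verts

namespace Hypergraph

/-- The hypergraph without vertices and hyperedges. -/
def empty : Hypergraph where
  verts := ∅
  edges := ∅
  inc := fun _ => ∅
  inc_subset := by simp

/-- `V(A)`, the union of the vertex sets of the hyperedges in `A`. -/
def vertsOf (G : Hypergraph) (A : Finset ℕ) : Finset ℕ := A.biUnion G.inc

/-- The boundary `bd(A) = V(A) ∩ V(E(G) \ A)`. -/
def bd (G : Hypergraph) (A : Finset ℕ) : Finset ℕ := G.vertsOf A ∩ G.vertsOf (G.edges \ A)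

/-- `λ(A) = |bd(A)|`. -/
def lam (G : Hypergraph) (A : Finset ℕ) : ℕ := (G.bd A).card

/-- A non-empty `A ⊆ E(G)` is internally connected if it has no bipartition into two non-empty
sets whose boundaries are both contained in the boundary of `A`. -/
def InternallyConnected (G : Hypergraph) (A : Finset ℕ) : Prop :=
  A ⊆ G.edges ∧ A.Nonempty ∧
    ¬ ∃ B₁ B₂ : Finset ℕ, B₁.Nonempty ∧ B₂.Nonempty ∧ B₁ ∪ B₂ = A ∧ Disjoint B₁ B₂ ∧
      G.bd B₁ ⊆ G.bd A ∧ G.bd B₂ ⊆ G.bd A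

/-- `C'` is an inclusion-maximal internally connected subset of `C`. -/
def IsInternalComponent (G : Hypergraph) (C C' : Finset ℕ) : Prop :=
  Maximal (fun A => A ⊆ C ∧ G.InternallyConnected A) C'

/-- The set `A` of labels as a set of labelled hyperedges, i.e. of labels with vertex sets. -/
def labelled (G : Hypergraph) (A : Finset ℕ) : Finset (ℕ × Finset ℕ) :=
  A.image fun e => (e, G.inc e)

/-- Insert the vertex `v`. -/
def addVertex (G : Hypergraph) (v : ℕ) : Hypergraph where
  verts := insert v G.verts
  edges := G.edges
  inc := G.inc
  inc_subset := fun e he => (G.inc_subset e he).trans (Finset.subset_insert _ _)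

/-- Delete a vertex `v` that lies in no hyperedge. -/
def deleteVertex (G : Hypergraph) (v : ℕ) (hv : ∀ e ∈ G.edges, v ∉ G.inc e) : Hypergraph where
  verts := G.verts.erase v
  edges := G.edges
  inc := G.inc
  inc_subset := fun e he _ hx =>
    Finset.mem_erase.2 ⟨fun h => hv e he (h ▸ hx), G.inc_subset e he hx⟩

/-- Insert a hyperedge with label `e` and vertex set `X`. -/
def addHyperedge (G : Hypergraph) (e : ℕ) (X : Finset ℕ) (hX : X ⊆ G.verts) : Hypergraph where
  verts := G.verts
  edges := insert e G.edges
  inc := Function.update G.inc e X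
  inc_subset := by
    intro e' he'
    by_cases h : e' = e
    · subst h
      simpa using hX
    · rw [Function.update_of_ne h]
      exact G.inc_subset e' ((Finset.mem_insert.1 he').resolve_left h)

/-- Delete the hyperedge `e`. -/
def deleteHyperedge (G : Hypergraph) (e : ℕ) : Hypergraph where
  verts := G.verts
  edges := G.edges.erase e
  inc := G.inc
  inc_subset := fun e' he' => G.inc_subset e' (Finset.mem_of_mem_erase he')

end Hypergraph

/-! ### The machine model

First-order pure LISP with unit-cost steps.  A value is a number or a pointer to an immutable
pair of values.  The primitive steps are: copying a value, allocating a pair, following one of its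
two pointers, testing for a pair, comparing two numbers, adding or subtracting one, branching and
calling a (possibly recursive) function of the program.  Each of them takes constant time on a
pointer machine and on a word RAM, so that time bounds for this model carry over to these up to a
constant factor.  There is no other arithmetic, so numbers cannot grow by more than one per step.
-/

/-- Values: numbers and pairs. -/
inductive Val where
  | num (n : ℕ)
  | pair (a b : Val)

namespace Val

/-- Truth values are the numbers `1` and `0`. -/
def ofBool (b : Bool) : Val := num (cond b 1 0)

/-- A list of numbers, as a linked list that ends in the number `0`. -/
def ofList : List ℕ → Val
  | [] => num 0
  | n :: l => pair (num n) (ofList l)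

/-- The first component of a pair. -/
def fst : Val → Val
  | num _ => num 0
  | pair a _ => a

/-- The second component of a pair. -/
def snd : Val → Val
  | num _ => num 0
  | pair _ b => b

/-- Is the value a pair? -/
def isPair : Val → Bool
  | num _ => false
  | pair _ _ => true

/-- Add one to a number. -/
def succ : Val → Val
  | num n => num (n + 1)
  | pair _ _ => num 0

/-- Subtract one from a number (`0` stays `0`). -/
def pred : Val → Val
  | num n => num (n - 1)
  | pair _ _ => num 0

/-- Comparison of two numbers. -/
def lt : Val → Val → Bool
  | num m, num n => decide (m < n)
  | _, _ => false

end Val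

/-- Program expressions.  Variables are de Bruijn indices into the environment; functions have one
argument (several arguments are passed as nested pairs), and their names are indices into the
function table of the program. -/
inductive Code where
  | var (i : ℕ)
  | const (n : ℕ)
  | succ (a : Code)
  | pred (a : Code)
  | lt (a b : Code)
  | pair (a b : Code)
  | fst (a : Code)
  | snd (a : Code)
  | isPair (a : Code)
  | ite (c a b : Code)
  | bind (a b : Code)
  | call (f : ℕ) (a : Code)
  | oracle (a : Code)

/-- `Runs fns ω env p v t`: with function table `fns`, the expression `p` evaluates in the
environment `env` to the value `v` in exactly `t` steps.  Here `ω x` is the answer of the oracle to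
a call with argument `x`, together with the time that the call takes. -/
inductive Runs (fns : List Code) (ω : Val → Bool × ℕ) : List Val → Code → Val → ℕ → Prop
  | var {env : List Val} {i : ℕ} {v : Val} (h : env[i]? = some v) :
      Runs fns ω env (.var i) v 1
  | const {env : List Val} (n : ℕ) : Runs fns ω env (.const n) (.num n) 1
  | succ {env : List Val} {a : Code} {x : Val} {t : ℕ} (ha : Runs fns ω env a x t) :
      Runs fns ω env (.succ a) x.succ (t + 1)
  | pred {env : List Val} {a : Code} {x : Val} {t : ℕ} (ha : Runs fns ω env a x t) :
      Runs fns ω env (.pred a) x.pred (t + 1)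
  | lt {env : List Val} {a b : Code} {x y : Val} {t u : ℕ} (ha : Runs fns ω env a x t)
      (hb : Runs fns ω env b y u) : Runs fns ω env (.lt a b) (.ofBool (x.lt y)) (t + u + 1)
  | pair {env : List Val} {a b : Code} {x y : Val} {t u : ℕ} (ha : Runs fns ω env a x t)
      (hb : Runs fns ω env b y u) : Runs fns ω env (.pair a b) (.pair x y) (t + u + 1)
  | fst {env : List Val} {a : Code} {x : Val} {t : ℕ} (ha : Runs fns ω env a x t) :
      Runs fns ω env (.fst a) x.fst (t + 1)
  | snd {env : List Val} {a : Code} {x : Val} {t : ℕ} (ha : Runs fns ω env a x t) :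
      Runs fns ω env (.snd a) x.snd (t + 1)
  | isPair {env : List Val} {a : Code} {x : Val} {t : ℕ} (ha : Runs fns ω env a x t) :
      Runs fns ω env (.isPair a) (.ofBool x.isPair) (t + 1)
  | iteTrue {env : List Val} {c a b : Code} {x y : Val} {t u : ℕ} (hc : Runs fns ω env c x t)
      (hx : x ≠ .num 0) (ha : Runs fns ω env a y u) : Runs fns ω env (.ite c a b) y (t + u + 1)
  | iteFalse {env : List Val} {c a b : Code} {y : Val} {t u : ℕ}
      (hc : Runs fns ω env c (.num 0) t) (hb : Runs fns ω env b y u) :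
      Runs fns ω env (.ite c a b) y (t + u + 1)
  | bind {env : List Val} {a b : Code} {x y : Val} {t u : ℕ} (ha : Runs fns ω env a x t)
      (hb : Runs fns ω (x :: env) b y u) : Runs fns ω env (.bind a b) y (t + u + 1)
  | call {env : List Val} {f : ℕ} {a body : Code} {x y : Val} {t u : ℕ}
      (hf : fns[f]? = some body) (ha : Runs fns ω env a x t) (hb : Runs fns ω [x] body y u) :
      Runs fns ω env (.call f a) y (t + u + 1)
  | oracle {env : List Val} {a : Code} {x : Val} {t : ℕ} (ha : Runs fns ω env a x t) :
      Runs fns ω env (.oracle a) (.ofBool (ω x).1) (t + (ω x).2 + 1)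

/-- Evaluation is deterministic in value and in time. -/
theorem Runs.det {fns : List Code} {ω : Val → Bool × ℕ} {env : List Val} {p : Code}
    {v w : Val} {t u : ℕ} (h : Runs fns ω env p v t) (h' : Runs fns ω env p w u) :
    v = w ∧ t = u := by
  induction h generalizing w u <;> cases h' <;> grind

/-! ### Oracles -/

/-- An oracle: its answer depends on the set `S` of labelled hyperedges and on `bd(S)`. -/
abbrev Oracle := Finset (ℕ × Finset ℕ) → Finset ℕ → Bool

/-- The answer `O(S)` of the oracle in the hypergraph `G`. -/
def oracleHolds (O : Oracle) (G : Hypergraph) (S : Finset ℕ) : Prop :=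
  O (G.labelled S) (G.bd S) = true

/-- The logarithm in the time bounds, `⌊log₂ (m + 2)⌋ ≥ 1`, positive also for `m = 0, 1`. -/
def logTime (m : ℕ) : ℕ := Nat.log 2 (m + 2)

/-- `ω` is a possible behaviour of the `s₂`-bounded oracle `O` while the current hypergraph is `G`:
called on a list of the labels of a set `S ⊆ E(G)` with `|S| ≤ s₂`, it answers `O(S)` in time at
most `K · log |E(G)|`.  Nothing is known about any other call. -/
def OracleBehaviour (O : Oracle) (s₂ K : ℕ) (G : Hypergraph) (ω : Val → Bool × ℕ) : Prop :=
  ∀ l : List ℕ, l.Nodup → l.toFinset ⊆ G.edges → l.length ≤ s₂ →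
    ((ω (.ofList l)).1 = true ↔ oracleHolds O G l.toFinset) ∧
      (ω (.ofList l)).2 ≤ K * logTime G.edges.card

/-! ### Data structures for dynamic hypergraphs -/

/-- Update operations, with the data that the data structure is given. A hyperedge is given by its
label and a list of its vertices. -/
inductive Update where
  | addVertex (v : ℕ)
  | deleteVertex (v : ℕ)
  | addHyperedge (e : ℕ) (l : List ℕ)
  | deleteHyperedge (e : ℕ)

/-- `UpdateStep r G o G'`: the update `o` is admissible for `G` and turns it into `G'`, where all
inserted hyperedges have rank at most `r`. -/
inductive UpdateStep (r : ℕ) : Hypergraph → Update → Hypergraph → Prop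
  | addVertex (G : Hypergraph) (v : ℕ) (hv : v ∉ G.verts) :
      UpdateStep r G (.addVertex v) (G.addVertex v)
  | deleteVertex (G : Hypergraph) (v : ℕ) (hv : v ∈ G.verts)
      (hi : ∀ e ∈ G.edges, v ∉ G.inc e) :
      UpdateStep r G (.deleteVertex v) (G.deleteVertex v hi)
  | addHyperedge (G : Hypergraph) (e : ℕ) (l : List ℕ) (he : e ∉ G.edges) (hl : l.Nodup)
      (hr : l.length ≤ r) (hV : l.toFinset ⊆ G.verts) :
      UpdateStep r G (.addHyperedge e l) (G.addHyperedge e l.toFinset hV)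
  | deleteHyperedge (G : Hypergraph) (e : ℕ) (he : e ∈ G.edges) :
      UpdateStep r G (.deleteHyperedge e) (G.deleteHyperedge e)

/-- The code of a data structure: a function table and one expression for each operation.
`start` receives the parameters, an update receives the pair of the stored value and its input
and computes the new stored value, and `query` receives the stored value. -/
structure DataStructure where
  fns : List Code
  start : Code
  addVertex : Code
  deleteVertex : Code
  addHyperedge : Code
  deleteHyperedge : Code
  query : Code

namespace DataStructure

/-- The code that performs an update. -/
def updateCode (D : DataStructure) : Update → Code
  | .addVertex _ => D.addVertex
  | .deleteVertex _ => D.deleteVertex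
  | .addHyperedge _ _ => D.addHyperedge
  | .deleteHyperedge _ => D.deleteHyperedge

end DataStructure

/-- The input of an update, as a value. -/
def Update.input : Update → Val
  | .addVertex v => .num v
  | .deleteVertex v => .num v
  | .addHyperedge e l => .pair (.num e) (.ofList l)
  | .deleteHyperedge e => .num e

namespace DataStructure

/-- The initialization with parameters `r, s₁, s₂, k` stores `σ` after `t` steps.  There are no
hyperedges yet and no oracle to call. -/
def RunsStart (D : DataStructure) (r s₁ s₂ k : ℕ) (σ : Val) (t : ℕ) : Prop :=
  Runs D.fns (fun _ => (false, 0)) [.ofList [r, s₁, s₂, k]] D.start σ t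

/-- The update `o` replaces the stored value `σ` by `σ'` in `t` steps. -/
def RunsUpdate (D : DataStructure) (ω : Val → Bool × ℕ) (σ : Val) (o : Update) (σ' : Val)
    (t : ℕ) : Prop :=
  Runs D.fns ω [.pair σ o.input] (D.updateCode o) σ' t

/-- The query returns `out` in `t` steps. -/
def RunsQuery (D : DataStructure) (ω : Val → Bool × ℕ) (σ : Val) (out : Val) (t : ℕ) : Prop :=
  Runs D.fns ω [σ] D.query out t

/-- `D.Reachable r s₁ s₂ k O K G σ`: some sequence of admissible updates, starting from the
initialization with the empty hypergraph, leads to the hypergraph `G` and the stored value `σ`.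
During an update the oracle refers to the updated hypergraph. -/
inductive Reachable (D : DataStructure) (r s₁ s₂ k : ℕ) (O : Oracle) (K : ℕ) :
    Hypergraph → Val → Prop
  | start {σ : Val} {t : ℕ} (h : D.RunsStart r s₁ s₂ k σ t) :
      Reachable D r s₁ s₂ k O K Hypergraph.empty σ
  | update {G G' : Hypergraph} {σ σ' : Val} {o : Update} {ω : Val → Bool × ℕ} {t : ℕ}
      (hG : Reachable D r s₁ s₂ k O K G σ) (ho : UpdateStep r G o G')
      (hω : OracleBehaviour O s₂ K G' ω) (h : D.RunsUpdate ω σ o σ' t) :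
      Reachable D r s₁ s₂ k O K G' σ'

end DataStructure

/-- Time allowed for an update of `G`: `c` for vertices, `q · log |E(G)|` for hyperedges. -/
def updateTime (c q : ℕ) (G : Hypergraph) : Update → ℕ
  | .addVertex _ => c
  | .deleteVertex _ => c
  | .addHyperedge _ _ => q * logTime G.edges.card
  | .deleteHyperedge _ => q * logTime G.edges.card

/-- The properties of the sets that are searched for, apart from their size. -/
def Eligible (G : Hypergraph) (O : Oracle) (k : ℕ) (C : Finset ℕ) : Prop :=
  C ⊆ G.edges ∧ G.lam C ≤ k ∧
    (∀ C', G.IsInternalComponent C C' → G.bd C' = G.bd C) ∧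
    (∀ C', G.IsInternalComponent C C' → oracleHolds O G C')

/-- Correct outputs of a query: a set `C` with `s₁ / 2 ≤ |C| ≤ s₂`, given as `(1, list of labels)`,
or the number `0`, reporting that there is no such set with `s₁ ≤ |C| ≤ s₂`. -/
def QueryCorrect (G : Hypergraph) (O : Oracle) (s₁ s₂ k : ℕ) (out : Val) : Prop :=
  (∃ l : List ℕ, out = .pair (.num 1) (.ofList l) ∧ l.Nodup ∧
      (s₁ : ℚ) / 2 ≤ (l.toFinset.card : ℚ) ∧ l.toFinset.card ≤ s₂ ∧ Eligible G O k l.toFinset) ∨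
    (out = .num 0 ∧ ¬ ∃ C : Finset ℕ, s₁ ≤ C.card ∧ C.card ≤ s₂ ∧ Eligible G O k C)

end DynLocalSearch

/-! Call a set of hyperedges relevant if it is internally connected, has at most `s₂` elements and a
boundary of size at most `k`, and is accepted by the oracle (`Qualifies`). The structure stores all
relevant sets in a search tree, grouped by boundary, and for each boundary `B` a witness, i.e. a set
that a query may return, whenever the group of `B` provides one. A query reads the root of the tree
of witnesses.

Why groups suffice. Internally connected sets with the same boundary are equal or disjoint
(`eq_of_inter`). The union of some sets of the group of `B`, either a single one or not all of them,
again has boundary `B`, and its internal components are among these sets (`components_biUnion`): a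
set that is left out supplies the hyperedges outside of the union that keep `B` in the boundary.
Conversely, the internal components of an eligible set `C` with at most `s₂` elements all belong to
the group of `bd C` and cover `C`, so `C` is at most as large as this group in total
(`Eligible.card_lt`). Now suppose that a group has at least `s₁` elements in total. Either one of
its sets has at least `s₁ / 2` elements, or all are smaller; then a union that grows set by set
first reaches `s₁ / 2` with fewer than `s₁` elements, hence before the group is exhausted
(`witL_spec`). This is the origin of the factor two. It suffices to inspect `s₂ + 1` sets of a
group, as they are non-empty (`witnessFor_refreshT`).

Why updates are local. Let `H` be the larger of the hypergraphs before and after the update and `e`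
the hyperedge in which they differ. If `A` is internally connected, a proper non-empty part of `A`
has a boundary vertex outside of `bd A`; all hyperedges at this vertex, except possibly `e`, lie in
`A`, so its degree is at most `|A| + 1`. Hence a set of at most `s₂` elements that meets the first
neighbourhood of `e` lies in the `s₂`-th one, even if neighbours are only taken through vertices of
degree at most `s₂ + 1` (`IsBall.subset`). A set not contained in that ball keeps its boundary, its
connectedness and its oracle answer (`IsDeletion.local`, `IsDeletion.qualifies_iff`). At most `s₂ +
1` incidences of a vertex are ever read, so the ball has bounded size, and it is enough to remove
and re-examine its small subsets (`SetsInv.upd`). Truncated incidence lists also suffice for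
boundaries: more than `|A|` incidences cannot all lie in `A` (`subL_nb`).

Why it is fast. All trees are AVL trees whose number of entries is polynomial in the number of
hyperedges, with a degree depending only on `r` and `s₂`; so their heights are logarithmic
(`ht_lt`), and the numbers of tree operations and oracle calls per update are bounded by the
parameters (`computes_upd`). Each function of the program is first shown to compute a mathematical
model on lists and trees within a time bound; correctness is then proved for the models. -/

set_option linter.unusedSimpArgs false
set_option linter.flexible false

namespace DynLocalSearch

/-! ### Weakest preconditions for the machine -/

namespace Val

/-- The condition under which a branch is taken. -/
def truthy : Val → Bool
  | num n => decide (n ≠ 0)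
  | pair _ _ => true

@[simp] theorem truthy_ofBool (b : Bool) : (ofBool b).truthy = b := by cases b <;> rfl
@[simp] theorem truthy_num (n : ℕ) : (num n).truthy = decide (n ≠ 0) := rfl
@[simp] theorem truthy_pair (a b : Val) : (pair a b).truthy = true := rfl

@[simp] theorem fst_num (n : ℕ) : (num n).fst = num 0 := rfl
@[simp] theorem fst_pair (a b : Val) : (pair a b).fst = a := rfl
@[simp] theorem snd_num (n : ℕ) : (num n).snd = num 0 := rfl
@[simp] theorem snd_pair (a b : Val) : (pair a b).snd = b := rfl
@[simp] theorem isPair_num (n : ℕ) : (num n).isPair = false := rfl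
@[simp] theorem isPair_pair (a b : Val) : (pair a b).isPair = true := rfl
@[simp] theorem succ_num (n : ℕ) : (num n).succ = num (n + 1) := rfl
@[simp] theorem pred_num (n : ℕ) : (num n).pred = num (n - 1) := rfl
@[simp] theorem lt_num (m n : ℕ) : (num m).lt (num n) = decide (m < n) := rfl

theorem truthy_eq_false {x : Val} : x.truthy = false ↔ x = num 0 := by
  cases x <;> simp [truthy]

end Val

section Machine

variable (fns : List Code) (ω : Val → Bool × ℕ)

/-- The function `f` of the table maps `x` to `y` in at most `T` steps. -/
def Computes (f : ℕ) (x y : Val) (T : ℕ) : Prop :=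
  ∃ body t, fns[f]? = some body ∧ Runs fns ω [x] body y t ∧ t ≤ T

/-- `wp p env Q`: the expression `p` evaluates in `env` to a value `v` within `T` steps such that
`Q v T`. -/
def wp : Code → List Val → (Val → ℕ → Prop) → Prop
  | .var i, env, Q => ∃ v, env[i]? = some v ∧ Q v 1
  | .const n, _, Q => Q (.num n) 1
  | .succ a, env, Q => wp a env fun x t => Q x.succ (t + 1)
  | .pred a, env, Q => wp a env fun x t => Q x.pred (t + 1)
  | .lt a b, env, Q => wp a env fun x t => wp b env fun y u => Q (.ofBool (x.lt y)) (t + u + 1)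
  | .pair a b, env, Q => wp a env fun x t => wp b env fun y u => Q (.pair x y) (t + u + 1)
  | .fst a, env, Q => wp a env fun x t => Q x.fst (t + 1)
  | .snd a, env, Q => wp a env fun x t => Q x.snd (t + 1)
  | .isPair a, env, Q => wp a env fun x t => Q (.ofBool x.isPair) (t + 1)
  | .ite c a b, env, Q => wp c env fun x t =>
      (x.truthy = true → wp a env fun y u => Q y (t + u + 1)) ∧
      (x.truthy = false → wp b env fun y u => Q y (t + u + 1))
  | .bind a b, env, Q => wp a env fun x t => wp b (x :: env) fun y u => Q y (t + u + 1)
  | .call f a, env, Q => wp a env fun x t => ∃ y T, Computes fns ω f x y T ∧ Q y (t + T + 1)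
  | .oracle a, env, Q => wp a env fun x t => Q (.ofBool (ω x).1) (t + (ω x).2 + 1)

-- Simplification now executes code symbolically. What remains are the function calls, answered by
-- `Computes` facts, and arithmetic on time bounds.
attribute [simp] wp

/-- Function calls are specified with upper bounds on time, whereas `Runs` counts exactly; hence the
two times, of which only the larger one is seen by `Q`. -/
theorem wp_sound {p : Code} {env : List Val} {Q : Val → ℕ → Prop} (h : wp fns ω p env Q) :
    ∃ v t T, Runs fns ω env p v t ∧ t ≤ T ∧ Q v T := by
  induction p generalizing env Q with
  | var i =>
    obtain ⟨v, hv, hQ⟩ := h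
    exact ⟨v, 1, 1, .var hv, le_rfl, hQ⟩
  | const n => exact ⟨_, 1, 1, .const n, le_rfl, h⟩
  | succ a iha =>
    obtain ⟨x, t, T, hr, ht, hQ⟩ := iha h
    exact ⟨_, _, _, .succ hr, by omega, hQ⟩
  | pred a iha =>
    obtain ⟨x, t, T, hr, ht, hQ⟩ := iha h
    exact ⟨_, _, _, .pred hr, by omega, hQ⟩
  | fst a iha =>
    obtain ⟨x, t, T, hr, ht, hQ⟩ := iha h
    exact ⟨_, _, _, .fst hr, by omega, hQ⟩
  | snd a iha =>
    obtain ⟨x, t, T, hr, ht, hQ⟩ := iha h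
    exact ⟨_, _, _, .snd hr, by omega, hQ⟩
  | isPair a iha =>
    obtain ⟨x, t, T, hr, ht, hQ⟩ := iha h
    exact ⟨_, _, _, .isPair hr, by omega, hQ⟩
  | oracle a iha =>
    obtain ⟨x, t, T, hr, ht, hQ⟩ := iha h
    exact ⟨_, _, _, .oracle hr, by omega, hQ⟩
  | lt a b iha ihb =>
    obtain ⟨x, t, T, hr, ht, hQ⟩ := iha h
    obtain ⟨y, u, U, hr', hu, hQ⟩ := ihb hQ
    exact ⟨_, _, _, .lt hr hr', by omega, hQ⟩
  | pair a b iha ihb =>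
    obtain ⟨x, t, T, hr, ht, hQ⟩ := iha h
    obtain ⟨y, u, U, hr', hu, hQ⟩ := ihb hQ
    exact ⟨_, _, _, .pair hr hr', by omega, hQ⟩
  | bind a b iha ihb =>
    obtain ⟨x, t, T, hr, ht, hQ⟩ := iha h
    obtain ⟨y, u, U, hr', hu, hQ⟩ := ihb hQ
    exact ⟨_, _, _, .bind hr hr', by omega, hQ⟩
  | ite c a b ihc iha ihb =>
    obtain ⟨x, t, T, hr, ht, hQ⟩ := ihc h
    cases hx : x.truthy with
    | true =>
      obtain ⟨y, u, U, hr', hu, hQ⟩ := iha (hQ.1 hx)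
      exact ⟨_, _, _, .iteTrue hr (by rintro rfl; simp at hx) hr', by omega, hQ⟩
    | false =>
      obtain ⟨y, u, U, hr', hu, hQ'⟩ := ihb (hQ.2 hx)
      rw [Val.truthy_eq_false] at hx
      subst hx
      exact ⟨_, _, _, .iteFalse hr hr', by omega, hQ'⟩
  | call f a iha =>
    obtain ⟨x, t, T, hr, ht, y, U, ⟨body, u, hf, hb, hu⟩, hQ⟩ := iha h
    exact ⟨_, _, _, .call hf hr hb, by omega, hQ⟩

variable {fns ω}

/-- The postcondition: the value is `y` and the time is at most `T`. -/
def Returns (y : Val) (T : ℕ) (v : Val) (t : ℕ) : Prop := v = y ∧ t ≤ T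

theorem Computes.of_wp {f : ℕ} {x y : Val} {T : ℕ} {body : Code} (hf : fns[f]? = some body)
    (h : wp fns ω body [x] (Returns y T)) : Computes fns ω f x y T := by
  obtain ⟨v, t, T', hr, ht, rfl, hT⟩ := wp_sound fns ω h
  exact ⟨body, t, hf, hr, ht.trans hT⟩

theorem Computes.mono {f : ℕ} {x y : Val} {T T' : ℕ} (h : Computes fns ω f x y T) (hT : T ≤ T') :
    Computes fns ω f x y T' := by
  obtain ⟨body, t, hf, hr, ht⟩ := h
  exact ⟨body, t, hf, hr, ht.trans hT⟩

theorem runs_of_wp {p : Code} {env : List Val} {y : Val} {T : ℕ}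
    (h : wp fns ω p env (Returns y T)) : ∃ t, Runs fns ω env p y t ∧ t ≤ T := by
  obtain ⟨v, t, T', hr, ht, rfl, hT⟩ := wp_sound fns ω h
  exact ⟨t, hr, ht.trans hT⟩

end Machine
end DynLocalSearch

namespace DynLocalSearch

/-! ### The program

Search trees are AVL trees, stored as `(height, (entry, (left, right)))` with entries
`(key, value)`, the empty tree being `0`.  The function table is `program`; each function is
introduced by the shape of its argument. -/

namespace Prog

abbrev x0 : Code := .var 0
abbrev x1 : Code := .var 1
abbrev x2 : Code := .var 2

/-- Call of a function with two arguments. -/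
abbrev call2 (f : ℕ) (a b : Code) : Code := .call f (.pair a b)
/-- Call of a function with three arguments. -/
abbrev call3 (f : ℕ) (a b c : Code) : Code := .call f (.pair a (.pair b c))
/-- Call of a function with four arguments. -/
abbrev call4 (f : ℕ) (a b c d : Code) : Code := .call f (.pair a (.pair b (.pair c d)))

abbrev zero : Code := .const 0

/-- The entry at the root of a search tree. -/
abbrev entry (t : Code) : Code := t.snd.fst
abbrev left (t : Code) : Code := t.snd.snd.fst
abbrev right (t : Code) : Code := t.snd.snd.snd

abbrev iCmp : ℕ := 0
abbrev iMk : ℕ := 1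
abbrev iBal : ℕ := 2
abbrev iIns : ℕ := 3
abbrev iDelMin : ℕ := 4
abbrev iDel : ℕ := 5
abbrev iFind : ℕ := 6
abbrev iMem : ℕ := 7
abbrev iSub : ℕ := 8
abbrev iSIns : ℕ := 9
abbrev iBdV : ℕ := 10
abbrev iBdE : ℕ := 11
abbrev iUnion : ℕ := 12
abbrev iStepV : ℕ := 13
abbrev iStepE : ℕ := 14
abbrev iIter : ℕ := 15
abbrev iSubl : ℕ := 16
abbrev iNoSplit : ℕ := 17
abbrev iLenLe : ℕ := 18
abbrev iApp : ℕ := 19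
abbrev iWit : ℕ := 20
abbrev iRefresh : ℕ := 21
abbrev iRemAll : ℕ := 22
abbrev iAllIn : ℕ := 23
abbrev iQual : ℕ := 24
abbrev iInsAll : ℕ := 25
abbrev iAddInc : ℕ := 26
abbrev iDelInc : ℕ := 27
abbrev iUpd : ℕ := 28

/-- `(a, b)`: compare two values, with result `0`, `1`, `2` for equal, smaller, larger. -/
def cmpC : Code :=
  .ite x0.fst.isPair
    (.ite x0.snd.isPair
      (.bind (call2 iCmp x0.fst.fst x0.snd.fst)
        (.ite x0 x0 (call2 iCmp x1.fst.snd x1.snd.snd)))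
      (.const 2))
    (.ite x0.snd.isPair (.const 1)
      (.ite (.lt x0.fst x0.snd) (.const 1) (.ite (.lt x0.snd x0.fst) (.const 2) zero)))

/-- `(entry, (left, right))`: the tree with this root. -/
def mkC : Code :=
  .pair (.succ (.ite (.lt x0.snd.fst.fst x0.snd.snd.fst) x0.snd.snd.fst x0.snd.fst.fst)) x0

/-- `(entry, (left, right))`: the same, rebalanced if the heights differ by two. -/
def balC : Code :=
  let kv := x0.fst
  let l := x0.snd.fst
  let r := x0.snd.snd
  .ite (.lt r.fst.succ l.fst)
    (.ite (.lt (left l).fst (right l).fst)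
      (call3 iMk (entry (right l)) (call3 iMk (entry l) (left l) (left (right l)))
        (call3 iMk kv (right (right l)) r))
      (call3 iMk (entry l) (left l) (call3 iMk kv (right l) r)))
    (.ite (.lt l.fst.succ r.fst)
      (.ite (.lt (right r).fst (left r).fst)
        (call3 iMk (entry (left r)) (call3 iMk kv l (left (left r)))
          (call3 iMk (entry r) (right (left r)) (right r)))
        (call3 iMk (entry r) (call3 iMk kv l (left r)) (right r)))
      (call3 iMk kv l r))

/-- `(entry, tree)`: insert an entry, replacing the one with the same key. -/
def insC : Code :=
  .ite x0.snd.isPair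
    (.bind (call2 iCmp x0.fst.fst (entry x0.snd).fst)
      (.ite x0
        (.ite x0.pred
          (call3 iBal (entry x1.snd) (left x1.snd) (call2 iIns x1.fst (right x1.snd)))
          (call3 iBal (entry x1.snd) (call2 iIns x1.fst (left x1.snd)) (right x1.snd)))
        (call3 iMk x1.fst (left x1.snd) (right x1.snd))))
    (call3 iMk x0.fst zero zero)

/-- `tree`: the smallest entry and the tree without it. -/
def delMinC : Code :=
  .ite (left x0).isPair
    (.bind (.call iDelMin (left x0))
      (.pair x0.fst (call3 iBal (entry x1) x0.snd (right x1))))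
    (.pair (entry x0) (right x0))

/-- `(key, tree)`: delete the entry with this key, if any. -/
def delC : Code :=
  .ite x0.snd.isPair
    (.bind (call2 iCmp x0.fst (entry x0.snd).fst)
      (.ite x0
        (.ite x0.pred
          (call3 iBal (entry x1.snd) (left x1.snd) (call2 iDel x1.fst (right x1.snd)))
          (call3 iBal (entry x1.snd) (call2 iDel x1.fst (left x1.snd)) (right x1.snd)))
        (.ite (right x1.snd).isPair
          (.bind (.call iDelMin (right x1.snd)) (call3 iBal x0.fst (left x2.snd) x0.snd))
          (left x1.snd))))
    zero

/-- `(g, (tree, (n, list)))`: prepend at most `n` values whose keys have first component `g`,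
decreasing `n` accordingly. -/
def findC : Code :=
  let t := x1.snd.fst
  .ite x0.snd.snd.fst
    (.ite x0.snd.fst.isPair
      (.bind (call2 iCmp x0.fst (entry x0.snd.fst).fst.fst)
        (.ite x0
          (.ite x0.pred
            (call3 iFind x1.fst (right t) x1.snd.snd)
            (call3 iFind x1.fst (left t) x1.snd.snd))
          (.bind (call3 iFind x1.fst (right t) x1.snd.snd)
            (.ite x0.fst
              (call4 iFind x2.fst (left x2.snd.fst) x0.fst.pred
                (.pair (entry x2.snd.fst).snd x0.snd))
              x0))))
      x0.snd.snd)
    x0.snd.snd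

/-- `(x, list)`: is the number in the list? -/
def memC : Code :=
  .ite x0.snd.isPair
    (.ite (.lt x0.fst x0.snd.fst) (call2 iMem x0.fst x0.snd.snd)
      (.ite (.lt x0.snd.fst x0.fst) (call2 iMem x0.fst x0.snd.snd) (.const 1)))
    zero

/-- `(list, list)`: are all elements of the first list in the second? -/
def subC : Code :=
  .ite x0.fst.isPair
    (.ite (call2 iMem x0.fst.fst x0.snd) (call2 iSub x0.fst.snd x0.snd) zero)
    (.const 1)

/-- `(x, list)`: insert a number into a strictly decreasing list. -/
def sinsC : Code :=
  .ite x0.snd.isPair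
    (.ite (.lt x0.snd.fst x0.fst) x0
      (.ite (.lt x0.fst x0.snd.fst) (.pair x0.snd.fst (call2 iSIns x0.fst x0.snd.snd)) x0.snd))
    (.pair x0.fst zero)

/-- The stored incidences of the vertex `v`, as far as they are needed; `tb` is a triple
`(bound, (edge tree, incidence tree))`. -/
abbrev nbC (v tb : Code) : Code := (call4 iFind v tb.snd.snd tb.fst zero).snd

/-- The stored vertex lists of the hyperedge `e` (at most one). -/
abbrev rawC (e tb : Code) : Code := (call4 iFind e tb.snd.fst (.const 1) zero).snd

/-- `(vertices, (A, (tb, list)))`: insert the vertices with an incidence outside of `A`. -/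
def bdVC : Code :=
  let X := x0.fst
  let A := x0.snd.fst
  let tb := x0.snd.snd.fst
  let acc := x0.snd.snd.snd
  .ite X.isPair
    (call4 iBdV X.snd A tb (.ite (call2 iSub (nbC X.fst tb) A) acc (call2 iSIns X.fst acc)))
    acc

/-- `(hyperedges, (A, (tb, list)))`: the same for the vertices of several hyperedges. -/
def bdEC : Code :=
  let A' := x0.fst
  let A := x0.snd.fst
  let tb := x0.snd.snd.fst
  let acc := x0.snd.snd.snd
  .ite A'.isPair
    (call4 iBdE A'.snd A tb (call4 iBdV (rawC A'.fst tb).fst A tb acc))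
    acc

/-- The boundary of `A`. -/
abbrev bdC (A tb : Code) : Code := call4 iBdE A A tb zero

/-- `(list, sorted list)`: insert all elements. -/
def unionC : Code :=
  .ite x0.fst.isPair (call2 iUnion x0.fst.snd (call2 iSIns x0.fst.fst x0.snd)) x0.snd

/-- `(vertices, (tb, list))`: insert all stored incidences. -/
def stepVC : Code :=
  let X := x0.fst
  let tb := x0.snd.fst
  let acc := x0.snd.snd
  .ite X.isPair (call3 iStepV X.snd tb (call2 iUnion (nbC X.fst tb) acc)) acc

/-- `(hyperedges, (tb, list))`: insert all stored incidences of the vertices. -/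
def stepEC : Code :=
  let L := x0.fst
  let tb := x0.snd.fst
  let acc := x0.snd.snd
  .ite L.isPair (call3 iStepE L.snd tb (call3 iStepV (rawC L.fst tb).fst tb acc)) acc

/-- `(n, (tb, L))`: iterate the previous step on a set of hyperedges. -/
def iterC : Code :=
  .ite x0.fst
    (call3 iIter x0.fst.pred x0.snd.fst (call3 iStepE x0.snd.snd x0.snd.fst x0.snd.snd))
    x0.snd.snd

/-- `(L, (n, (list, lists)))`: prepend the list, extended by each subset of `L` with at most `n`
elements. -/
def sublC : Code :=
  .ite x0.fst.isPair
    (.bind (.call iSubl (.pair x0.fst.snd x0.snd))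
      (.ite x1.snd.fst
        (call4 iSubl x1.fst.snd x1.snd.fst.pred (.pair x1.fst.fst x1.snd.snd.fst) x0)
        x0))
    x0.snd.snd

/-- `(lists, (B, tb))`: has no non-empty list its boundary in `B`? -/
def noSplitC : Code :=
  let B := x0.fst.fst
  let rest := call2 iNoSplit x0.fst.snd x0.snd
  .ite x0.fst.isPair
    (.ite B.isPair
      (.ite (call2 iSub (bdC B x0.snd.snd) x0.snd.fst) zero rest)
      rest)
    (.const 1)

/-- `(list, n)`: has the list at most `n` elements? -/
def lenLeC : Code :=
  .ite x0.fst.isPair (.ite x0.snd (call2 iLenLe x0.fst.snd x0.snd.pred) zero) (.const 1)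

/-- `(A, (list, n))`: prepend the elements of `A` and subtract `2` for each of them. -/
def appC : Code :=
  .ite x0.fst.isPair
    (call3 iApp x0.fst.snd (.pair x0.fst.fst x0.snd.fst) x0.snd.snd.pred.pred)
    x0.snd

/-- `(items, (s, (list, n)))`: an item with at least `s / 2` elements, or the union of the list
and a proper prefix of the items, with at least `n / 2` new elements; `0` if there is none. -/
def witC : Code :=
  .ite x0.fst.isPair
    (.bind (call3 iApp x0.fst.fst zero x0.snd.fst)
      (.ite x0.snd
        (.bind (.call iApp (.pair x1.fst.fst x1.snd.snd))
          (.ite x0.snd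
            (call3 iWit x2.fst.snd x2.snd.fst x0)
            (.ite x2.fst.snd.isPair x0.fst zero)))
        x0.fst))
    zero

/-- `(B, (sets, (witnesses, (s₁, (k, bound)))))`: update the witness for the boundary `B`. -/
def refreshC : Code :=
  let prm := x0.snd.snd.snd
  .bind
    (call4 iWit (call4 iFind x0.fst x0.snd.fst prm.snd.snd zero).snd prm.fst zero prm.fst)
    (.ite x0.isPair (call2 iIns (.pair x1.fst x0) x1.snd.snd.fst)
      (call2 iDel x1.fst x1.snd.snd.fst))

/-- `(candidates, (tb, (parameters, (sets, witnesses))))`: remove the candidates. -/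
def remAllC : Code :=
  .ite x0.fst.isPair
    (.bind (bdC x0.fst.fst x0.snd.fst)
      (.bind (call2 iDel (.pair x0 x1.fst.fst) x1.snd.snd.snd.fst)
        (.call iRemAll (.pair x2.fst.snd (.pair x2.snd.fst (.pair x2.snd.snd.fst (.pair x0
          (call4 iRefresh x1 x0 x2.snd.snd.snd.snd x2.snd.snd.fst))))))))
    x0.snd.snd.snd

/-- `(A, tb)`: are all elements of `A` stored hyperedges? -/
def allInC : Code :=
  .ite x0.fst.isPair
    (.ite (rawC x0.fst.fst x0.snd).isPair (call2 iAllIn x0.fst.snd x0.snd) zero)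
    (.const 1)

/-- `(A, (B, (tb, k)))`: is `A`, with boundary `B`, one of the sets to be stored? -/
def qualC : Code :=
  let A := x0.fst
  let B := x0.snd.fst
  let tb := x0.snd.snd.fst
  .ite A.isPair
    (.ite (call2 iAllIn A tb)
      (.ite (call2 iLenLe B x0.snd.snd.snd)
        (.ite (call3 iNoSplit (call4 iSubl A.snd tb.fst zero zero) B tb) (.oracle A) zero)
        zero)
      zero)
    zero

/-- `(candidates, (tb, (parameters, (sets, witnesses))))`: insert the candidates that qualify. -/
def insAllC : Code :=
  .ite x0.fst.isPair
    (.bind (bdC x0.fst.fst x0.snd.fst)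
      (.ite (call4 iQual x1.fst.fst x0 x1.snd.fst x1.snd.snd.fst.snd.fst)
        (.bind (call2 iIns (.pair (.pair x0 x1.fst.fst) x1.fst.fst) x1.snd.snd.snd.fst)
          (.call iInsAll (.pair x2.fst.snd (.pair x2.snd.fst (.pair x2.snd.snd.fst (.pair x0
            (call4 iRefresh x1 x0 x2.snd.snd.snd.snd x2.snd.snd.fst)))))))
        (call2 iInsAll x1.fst.snd x1.snd)))
    x0.snd.snd.snd

/-- `(vertices, (e, incidence tree))`: add the incidences of `e`. -/
def addIncC : Code :=
  .ite x0.fst.isPair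
    (call3 iAddInc x0.fst.snd x0.snd.fst
      (call2 iIns (.pair (.pair x0.fst.fst x0.snd.fst) x0.snd.fst) x0.snd.snd))
    x0.snd.snd

/-- `(vertices, (e, incidence tree))`: delete the incidences of `e`. -/
def delIncC : Code :=
  .ite x0.fst.isPair
    (call3 iDelInc x0.fst.snd x0.snd.fst
      (call2 iDel (.pair x0.fst.fst x0.snd.fst) x0.snd.snd))
    x0.snd.snd

/-- `(e, (tb₁, (tb₂, (tb₃, (parameters, (sets, witnesses))))))`: update sets and witnesses in the
neighbourhood of `e` with respect to `tb₁`, when `tb₂` changes to `tb₃`. -/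
def updC : Code :=
  let tb := x0.snd.fst
  .bind (call4 iSubl (call4 iIter tb.fst.pred tb x0.fst zero) tb.fst.pred zero zero)
    (call4 iInsAll x0 x1.snd.snd.snd.fst x1.snd.snd.snd.snd.fst
      (.call iRemAll (.pair x0 (.pair x1.snd.snd.fst x1.snd.snd.snd.snd))))

/-- The function table. -/
def program : List Code :=
  [cmpC, mkC, balC, insC, delMinC, delC, findC, memC, subC, sinsC, bdVC, bdEC, unionC, stepVC,
    stepEC, iterC, sublC, noSplitC, lenLeC, appC, witC, refreshC, remAllC, allInC, qualC, insAllC,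
    addIncC, delIncC, updC]

/-- `(r, (s₁, (s₂, (k, 0))))`: the state is
`(vertex log, ((s₁, (k, s₂ + 1)), ((edge tree, incidence tree), (sets, witnesses))))`. -/
def startC : Code :=
  .pair zero (.pair (.pair x0.snd.fst (.pair x0.snd.snd.snd.fst x0.snd.snd.fst.succ))
    (.pair (.pair zero zero) (.pair zero zero)))

/-- No other operation ever looks up the vertex set, so a log is enough. It makes the stored value
determine `G` and takes constant time. -/
def addVertexC : Code := .pair (.pair (.pair (.const 1) x0.snd) x0.fst.fst) x0.fst.snd

def deleteVertexC : Code := .pair (.pair (.pair zero x0.snd) x0.fst.fst) x0.fst.snd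

/-- Keys of the edge tree are padded to `(e, 0)`, so that the search by first component serves both
trees. The three tables handed to `iUpd` define the ball, the removal and the insertion; the ball
always refers to the larger hypergraph, which here is the new one. -/
def addHyperedgeC : Code :=
  let σ := x1.fst
  let e := x1.snd.fst
  let prm := σ.snd.fst
  .bind (.pair (call2 iIns (.pair (.pair x0.snd.fst zero) x0.snd.snd) x0.fst.snd.snd.fst.fst)
      (call3 iAddInc x0.snd.snd x0.snd.fst x0.fst.snd.snd.fst.snd))
    (.pair σ.fst (.pair prm (.pair x0
      (.call iUpd (.pair e (.pair (.pair prm.snd.snd x0) (.pair (.pair prm.snd.snd σ.snd.snd.fst)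
        (.pair (.pair prm.snd.snd x0) (.pair prm σ.snd.snd.snd)))))))))

/-- Here the old hypergraph is the larger one, so it defines the ball as well as the removal. -/
def deleteHyperedgeC : Code :=
  let σ := x1.fst
  let e := x1.snd
  let prm := σ.snd.fst
  let old := Code.pair prm.snd.snd σ.snd.snd.fst
  .bind (.pair (call2 iDel (.pair x0.snd zero) x0.fst.snd.snd.fst.fst)
      (call3 iDelInc (call4 iFind x0.snd x0.fst.snd.snd.fst.fst (.const 1) zero).snd.fst x0.snd
        x0.fst.snd.snd.fst.snd))
    (.pair σ.fst (.pair prm (.pair x0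
      (.call iUpd (.pair e (.pair old (.pair old
        (.pair (.pair prm.snd.snd x0) (.pair prm σ.snd.snd.snd)))))))))

/-- Every stored witness is a correct answer, so the root is taken. For `s₁ = 0` the empty set is
always eligible. -/
def queryC : Code :=
  let wits := x0.snd.snd.snd.snd
  .ite x0.snd.fst.fst
    (.ite wits.isPair (.pair (.const 1) (entry wits).snd) zero)
    (.pair (.const 1) zero)

end Prog

open Prog in
/-- The data structure. -/
def searchStructure : DataStructure where
  fns := program
  start := startC
  addVertex := addVertexC
  deleteVertex := deleteVertexC
  addHyperedge := addHyperedgeC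
  deleteHyperedge := deleteHyperedgeC
  query := queryC

end DynLocalSearch

namespace DynLocalSearch
open Prog

/-! ### Comparison of values and search trees -/

namespace Val

/-- Number of nodes of a value. -/
def size : Val → ℕ
  | num _ => 1
  | pair a b => a.size + b.size + 1

/-- Comparison: `0`, `1`, `2` for equal, smaller, larger. -/
def cmp : Val → Val → ℕ
  | num a, num b => if a < b then 1 else if b < a then 2 else 0
  | num _, pair _ _ => 1
  | pair _ _, num _ => 2
  | pair a b, pair c d => if cmp a c = 0 then cmp b d else cmp a c

end Val

/-- AVL trees with entries `(key, value)`; the number is the stored height. -/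
inductive Tree where
  | leaf
  | node (h : ℕ) (kv : Val) (l r : Tree)

namespace Tree

def enc : Tree → Val
  | leaf => .num 0
  | node h kv l r => .pair (.num h) (.pair kv (.pair l.enc r.enc))

def ht : Tree → ℕ
  | leaf => 0
  | node h _ _ _ => h

def entry : Tree → Val
  | leaf => .num 0
  | node _ kv _ _ => kv

def left : Tree → Tree
  | leaf => leaf
  | node _ _ l _ => l

def right : Tree → Tree
  | leaf => leaf
  | node _ _ _ r => r

@[simp] theorem ht_leaf : leaf.ht = 0 := rfl
@[simp] theorem ht_node (h : ℕ) (kv : Val) (l r : Tree) : (node h kv l r).ht = h := rfl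
@[simp] theorem fst_enc (t : Tree) : t.enc.fst = .num t.ht := by cases t <;> rfl
@[simp] theorem entry_enc (t : Tree) : t.enc.snd.fst = t.entry := by cases t <;> rfl
@[simp] theorem left_enc (t : Tree) : t.enc.snd.snd.fst = t.left.enc := by cases t <;> rfl
@[simp] theorem right_enc (t : Tree) : t.enc.snd.snd.snd = t.right.enc := by cases t <;> rfl

def mk (kv : Val) (l r : Tree) : Tree :=
  node ((if l.ht < r.ht then r.ht else l.ht) + 1) kv l r

/-- A higher side gives up its root (single rotation), or the root of its inner subtree if that
subtree is the higher one (double rotation). -/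
def bal (kv : Val) (l r : Tree) : Tree :=
  if r.ht + 1 < l.ht then
    if l.left.ht < l.right.ht then
      mk l.right.entry (mk l.entry l.left l.right.left) (mk kv l.right.right r)
    else mk l.entry l.left (mk kv l.right r)
  else if l.ht + 1 < r.ht then
    if r.right.ht < r.left.ht then
      mk r.left.entry (mk kv l r.left.left) (mk r.entry r.left.right r.right)
    else mk r.entry (mk kv l r.left) r.right
  else mk kv l r

def ins (kv : Val) : Tree → Tree
  | leaf => mk kv leaf leaf
  | node _ kv' l r =>
    if kv.fst.cmp kv'.fst = 0 then mk kv l r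
    else if kv.fst.cmp kv'.fst = 1 then bal kv' (l.ins kv) r
    else bal kv' l (r.ins kv)

def delMin : Tree → Val × Tree
  | leaf => (.num 0, leaf)
  | node _ kv leaf r => (kv, r)
  | node _ kv (node h kv' l' r') r =>
    ((node h kv' l' r').delMin.1, bal kv (node h kv' l' r').delMin.2 r)

def del (k : Val) : Tree → Tree
  | leaf => leaf
  | node _ kv l r =>
    if k.cmp kv.fst = 0 then
      match r with
      | leaf => l
      | node h' kv' l' r' =>
        bal (node h' kv' l' r').delMin.1 l (node h' kv' l' r').delMin.2
    else if k.cmp kv.fst = 1 then bal kv (l.del k) r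
    else bal kv l (r.del k)

/-- The counter is the number of values still wanted. The traversal runs from right to left and
prepends, so the values appear in the order of the tree. -/
def find (g : Val) : Tree → ℕ × List Val → ℕ × List Val
  | leaf, acc => acc
  | node _ kv l r, acc =>
    if acc.1 = 0 then acc
    else if g.cmp kv.fst.fst = 0 then
      if (r.find g acc).1 = 0 then r.find g acc
      else l.find g ((r.find g acc).1 - 1, kv.snd :: (r.find g acc).2)
    else if g.cmp kv.fst.fst = 1 then l.find g acc
    else r.find g acc

/-- The stored heights are correct and siblings differ in height by at most one. -/
def Balanced : Tree → Prop
  | leaf => True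
  | node h _ l r => h = max l.ht r.ht + 1 ∧ l.ht ≤ r.ht + 1 ∧ r.ht ≤ l.ht + 1 ∧
      l.Balanced ∧ r.Balanced

end Tree

namespace Val

/-- Linked list of values. -/
def ofVals : List Val → Val
  | [] => num 0
  | a :: l => pair a (ofVals l)

end Val

section Simulation

open Val

variable {ω : Val → Bool × ℕ}

/-- Both values are descended in parallel, so the first one alone bounds the time, however large the
stored key is. -/
theorem computes_cmp (a b : Val) :
    Computes program ω iCmp (pair a b) (num (a.cmp b)) (40 * a.size) := by
  induction a generalizing b with
  | num m =>
    cases b with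
    | num n =>
      refine .of_wp rfl ?_
      by_cases h : m < n
      · simp [cmpC, Returns, Val.cmp, Val.size, h]
      · by_cases h' : n < m <;> simp [cmpC, Returns, Val.cmp, Val.size, h, h']
    | pair c d =>
      refine .of_wp rfl ?_
      simp [cmpC, Returns, Val.cmp, Val.size]
  | pair a a' iha ihb =>
    cases b with
    | num n =>
      refine .of_wp rfl ?_
      simp [cmpC, Returns, Val.cmp, Val.size]
      omega
    | pair c d =>
      refine .of_wp rfl ?_
      simp [cmpC]
      refine ⟨_, _, iha c, ?_⟩
      by_cases h : a.cmp c = 0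
      · simp [h]
        refine ⟨_, _, ihb d, ?_⟩
        simp [Returns, Val.cmp, h, Val.size]
        omega
      · simp [Returns, Val.cmp, h, Val.size]
        omega

theorem computes_mk (kv : Val) (l r : Tree) :
    Computes program ω iMk (pair kv (pair l.enc r.enc)) (Tree.mk kv l r).enc 20 := by
  refine .of_wp rfl ?_
  by_cases h : l.ht < r.ht
  · simp [mkC, Returns, Tree.mk, Tree.enc, h]
  · simp [mkC, Returns, Tree.mk, Tree.enc, h]

theorem computes_bal (kv : Val) (l r : Tree) :
    Computes program ω iBal (pair kv (pair l.enc r.enc)) (Tree.bal kv l r).enc 200 := by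
  refine .of_wp rfl ?_
  simp [balC, -not_lt]
  refine ⟨fun h1 => ⟨fun h2 => ?_, fun h2 => ?_⟩, fun h1 => ⟨fun h2 => ⟨fun h3 => ?_, fun h3 => ?_⟩,
    fun h2 => ?_⟩⟩
  · refine ⟨_, _, computes_mk _ _ _, _, _, computes_mk _ _ _, _, _, computes_mk _ _ _, ?_⟩
    simp [Returns, Tree.bal, h1, h2]
  · refine ⟨_, _, computes_mk _ _ _, _, _, computes_mk _ _ _, ?_⟩
    simp [Returns, Tree.bal, h1, Nat.not_lt.2 h2]
  · refine ⟨_, _, computes_mk _ _ _, _, _, computes_mk _ _ _, _, _, computes_mk _ _ _, ?_⟩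
    simp [Returns, Tree.bal, Nat.not_lt.2 h1, h2, h3]
  · refine ⟨_, _, computes_mk _ _ _, _, _, computes_mk _ _ _, ?_⟩
    simp [Returns, Tree.bal, Nat.not_lt.2 h1, h2, Nat.not_lt.2 h3]
  · refine ⟨_, _, computes_mk _ _ _, ?_⟩
    simp [Returns, Tree.bal, Nat.not_lt.2 h1, Nat.not_lt.2 h2]

theorem computes_ins (kv : Val) (t : Tree) (ht : t.Balanced) :
    Computes program ω iIns (pair kv t.enc) (t.ins kv).enc
      ((300 + 40 * kv.fst.size) * (t.ht + 1)) := by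
  induction t with
  | leaf =>
    refine .of_wp rfl ?_
    simp [insC, Tree.enc]
    refine ⟨_, _, computes_mk _ .leaf .leaf, ?_⟩
    simp [Returns, Tree.ins]
    omega
  | node h kv' l r ihl ihr =>
    obtain ⟨hh, -, -, hl, hr⟩ := ht
    have hc := computes_cmp (ω := ω) kv.fst kv'.fst
    refine .of_wp rfl ?_
    simp [insC, Tree.enc]
    refine ⟨_, _, hc, ?_⟩
    have b1 : (300 + 40 * kv.fst.size) * (l.ht + 1) ≤ (300 + 40 * kv.fst.size) * h :=
      Nat.mul_le_mul_left _ (by omega)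
    have b2 : (300 + 40 * kv.fst.size) * (r.ht + 1) ≤ (300 + 40 * kv.fst.size) * h :=
      Nat.mul_le_mul_left _ (by omega)
    by_cases h0 : kv.fst.cmp kv'.fst = 0
    · simp [h0]
      refine ⟨_, _, computes_mk _ _ _, ?_⟩
      simp [Returns, Tree.ins, h0]
      rw [Nat.mul_succ _ h]
      omega
    · simp [h0]
      refine ⟨fun h1 => ⟨_, _, ihr hr, _, _, computes_bal _ _ _, ?_⟩,
        fun h1 => ⟨_, _, ihl hl, _, _, computes_bal _ _ _, ?_⟩⟩
      · simp [Returns, Tree.ins, h0, show kv.fst.cmp kv'.fst ≠ 1 by omega]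
        rw [Nat.mul_succ _ h]
        omega
      · simp [Returns, Tree.ins, h0, show kv.fst.cmp kv'.fst = 1 by omega]
        rw [Nat.mul_succ _ h]
        omega

theorem computes_delMin (t : Tree) (ht : t.Balanced) :
    Computes program ω iDelMin t.enc (pair t.delMin.1 t.delMin.2.enc) (260 * (t.ht + 1)) := by
  induction t with
  | leaf =>
    refine .of_wp rfl ?_
    simp [Returns, delMinC, Tree.enc, Tree.delMin]
  | node h kv l r ihl ihr =>
    obtain ⟨hh, -, -, hl, hr⟩ := ht
    refine .of_wp rfl ?_
    cases l with
    | leaf =>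
      simp [Returns, delMinC, Tree.enc, Tree.delMin]
      omega
    | node h' kv' l' r' =>
      simp [delMinC, Tree.enc]
      refine ⟨_, _, ihl hl, ?_⟩
      simp
      refine ⟨_, _, computes_bal _ _ _, ?_⟩
      simp [Returns, Tree.delMin] at hh ⊢
      omega

theorem computes_del (k : Val) (t : Tree) (ht : t.Balanced) :
    Computes program ω iDel (pair k t.enc) (t.del k).enc
      ((600 + 40 * k.size) * (t.ht + 1)) := by
  induction t with
  | leaf =>
    refine .of_wp rfl ?_
    simp [Returns, delC, Tree.enc, Tree.del]
    omega
  | node h kv' l r ihl ihr =>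
    obtain ⟨hh, -, -, hl, hr⟩ := ht
    have hc := computes_cmp (ω := ω) k kv'.fst
    refine .of_wp rfl ?_
    simp [delC, Tree.enc]
    refine ⟨_, _, hc, ?_⟩
    have b1 : (600 + 40 * k.size) * (l.ht + 1) ≤ (600 + 40 * k.size) * h :=
      Nat.mul_le_mul_left _ (by omega)
    have b2 : (600 + 40 * k.size) * (r.ht + 1) ≤ (600 + 40 * k.size) * h :=
      Nat.mul_le_mul_left _ (by omega)
    have b3 : 600 * h ≤ (600 + 40 * k.size) * h := Nat.mul_le_mul_right _ (by omega)
    by_cases h0 : k.cmp kv'.fst = 0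
    · simp [h0]
      cases r with
      | leaf =>
        simp [Returns, Tree.del, h0, Tree.enc]
        rw [Nat.mul_succ _ h]
        omega
      | node h' kv'' l' r' =>
        simp [Tree.enc]
        refine ⟨_, _, computes_delMin _ hr, ?_⟩
        simp
        refine ⟨_, _, computes_bal _ _ _, ?_⟩
        simp [Returns, Tree.del, h0] at hh ⊢
        rw [Nat.mul_succ _ h]
        omega
    · simp [h0]
      refine ⟨fun h1 => ⟨_, _, ihr hr, _, _, computes_bal _ _ _, ?_⟩,
        fun h1 => ⟨_, _, ihl hl, _, _, computes_bal _ _ _, ?_⟩⟩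
      · simp [Returns, Tree.del, h0, show k.cmp kv'.fst ≠ 1 by omega]
        rw [Nat.mul_succ _ h]
        omega
      · simp [Returns, Tree.del, h0, show k.cmp kv'.fst = 1 by omega]
        rw [Nat.mul_succ _ h]
        omega

theorem Tree.find_fst_le (g : Val) (t : Tree) (acc : ℕ × List Val) : (t.find g acc).1 ≤ acc.1 := by
  induction t generalizing acc with
  | leaf => simp [Tree.find]
  | node h kv l r ihl ihr =>
    simp only [Tree.find]
    split_ifs
    · exact le_rfl
    · exact ihr _
    · exact (ihl _).trans ((Nat.sub_le _ _).trans (ihr _))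
    · exact ihl _
    · exact ihr _

/-- Encoding of the state of a search for values. -/
abbrev encAcc (a : ℕ × List Val) : Val := pair (num a.1) (ofVals a.2)

/-- A search branches only at a matching root, and the value found there pays for the second branch.
Hence the number of descents is at most one more than the number of values found. -/
theorem computes_find_aux (g : Val) (t : Tree) (ht : t.Balanced) (acc : ℕ × List Val) :
    Computes program ω iFind (pair g (pair t.enc (encAcc acc))) (encAcc (t.find g acc))
      ((100 + 40 * g.size) * ((acc.1 - (t.find g acc).1 + 1) * (2 * t.ht + 1))) := by
  induction t generalizing acc with
  | leaf =>
    refine .of_wp rfl ?_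
    by_cases h0 : acc.1 = 0
    · simp [Returns, findC, Tree.enc, h0, Tree.find]
      omega
    · simp [Returns, findC, Tree.enc, h0, Tree.find]
      omega
  | node h kv l r ihl ihr =>
    obtain ⟨hh, -, -, hl, hr⟩ := ht
    refine .of_wp rfl ?_
    by_cases h0 : acc.1 = 0
    · simp [Returns, findC, Tree.enc, h0, Tree.find]
      nlinarith [Nat.zero_le (g.size * (2 * h + 1))]
    have hc := computes_cmp (ω := ω) g kv.fst.fst
    simp [findC, Tree.enc, h0]
    refine ⟨_, _, hc, ?_⟩
    obtain ⟨a, ha⟩ : ∃ a, h = a + 1 := ⟨_, hh⟩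
    -- Going down one level saves at least one unit `100 + 40 * g.size`, which covers the work at
    -- the root including its comparison.
    have key : ∀ m x, x ≤ a →
        80 + 40 * g.size + (100 + 40 * g.size) * ((m + 1) * (2 * x + 1)) ≤
          (100 + 40 * g.size) * ((m + 1) * (2 * h + 1)) := by
      intro m x hx
      have : (m + 1) * (2 * x + 1) + 1 ≤ (m + 1) * (2 * h + 1) := by subst ha; nlinarith
      calc _ ≤ (100 + 40 * g.size) * ((m + 1) * (2 * x + 1) + 1) := by rw [Nat.mul_succ _ ((m + 1) * (2 * x + 1))]; omega
        _ ≤ _ := Nat.mul_le_mul_left _ this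
    by_cases h1 : g.cmp kv.fst.fst = 0
    · simp [h1]
      refine ⟨_, _, ihr hr acc, ?_⟩
      by_cases h2 : (r.find g acc).1 = 0
      · have := key (acc.1 - (r.find g acc).1) r.ht (by omega)
        simp only [Tree.find, h0, h1, h2] at this ⊢
        simp [Returns, h2]
        simp at this
        omega
      · simp [h2]
        refine ⟨_, _, ihl hl ((r.find g acc).1 - 1, kv.snd :: (r.find g acc).2), ?_⟩
        simp only [Tree.find, h0, h1, h2]
        simp [Returns]
        have e1 := Tree.find_fst_le g r acc
        have e2 := Tree.find_fst_le g l ((r.find g acc).1 - 1, kv.snd :: (r.find g acc).2)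
        simp only at e2
        generalize (l.find g ((r.find g acc).1 - 1, kv.snd :: (r.find g acc).2)).1 = p at *
        generalize (r.find g acc).1 = q at *
        have c1 := key (acc.1 - p) a le_rfl
        -- The right subtree yields `acc.1 - q` values, the root one, the left subtree `q - 1 - p`:
        -- the two numbers of descents add up to exactly `acc.1 - p + 1`.
        have c2 : (acc.1 - q + 1) * (2 * r.ht + 1) + (q - 1 - p + 1) * (2 * l.ht + 1) ≤
            (acc.1 - p + 1) * (2 * a + 1) := by
          calc _ ≤ (acc.1 - q + 1) * (2 * a + 1) + (q - 1 - p + 1) * (2 * a + 1) :=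
                Nat.add_le_add (Nat.mul_le_mul_left _ (by omega)) (Nat.mul_le_mul_left _ (by omega))
            _ = (acc.1 - p + 1) * (2 * a + 1) := by rw [← Nat.add_mul]; congr 1; omega
        have c3 := Nat.mul_le_mul_left (100 + 40 * g.size) c2
        rw [Nat.mul_add] at c3
        omega
    · simp [h1]
      refine ⟨fun h2 => ⟨_, _, ihr hr acc, ?_⟩, fun h2 => ⟨_, _, ihl hl acc, ?_⟩⟩
      · have := key (acc.1 - (r.find g acc).1) r.ht (by omega)
        simp [Returns, Tree.find, h0, h1, show g.cmp kv.fst.fst ≠ 1 by omega]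
        omega
      · have := key (acc.1 - (l.find g acc).1) l.ht (by omega)
        simp [Returns, Tree.find, h0, h1, show g.cmp kv.fst.fst = 1 by omega]
        omega

theorem computes_find (g : Val) (t : Tree) (ht : t.Balanced) (n : ℕ) :
    Computes program ω iFind (pair g (pair t.enc (pair (num n) (num 0))))
      (encAcc (t.find g (n, []))) ((100 + 40 * g.size) * ((n + 1) * (2 * t.ht + 1))) :=
  (computes_find_aux g t ht (n, [])).mono
    (Nat.mul_le_mul_left _ (Nat.mul_le_mul_right _ (by simp)))

end Simulation
end DynLocalSearch

namespace DynLocalSearch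

/-! ### Correctness of the search trees -/

namespace Val

theorem cmp_le_two (a b : Val) : a.cmp b ≤ 2 := by
  induction a generalizing b with
  | num m => cases b <;> simp [cmp]; split_ifs <;> omega
  | pair a a' iha ihb =>
    cases b with
    | num n => simp [cmp]
    | pair c d => simp only [cmp]; split_ifs; exacts [ihb d, iha c]

theorem cmp_eq_zero {a b : Val} : a.cmp b = 0 ↔ a = b := by
  induction a generalizing b with
  | num m =>
    cases b with
    | num n => simp only [cmp]; split_ifs <;> simp <;> omega
    | pair c d => simp [cmp]
  | pair a a' iha ihb =>
    cases b with
    | num n => simp [cmp]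
    | pair c d =>
      simp only [cmp, pair.injEq, ← iha, ← ihb]
      split_ifs with h <;> simp [h]

@[simp] theorem cmp_self (a : Val) : a.cmp a = 0 := cmp_eq_zero.2 rfl

theorem cmp_eq_two {a b : Val} : a.cmp b = 2 ↔ b.cmp a = 1 := by
  induction a generalizing b with
  | num m =>
    cases b with
    | num n =>
      simp only [cmp]
      split_ifs <;> first | omega | simp
    | pair c d => simp [cmp]
  | pair a a' iha ihb =>
    cases b with
    | num n => simp [cmp]
    | pair c d =>
      simp only [cmp]
      by_cases h : a = c
      · subst h
        simp [ihb]
      · have h1 : a.cmp c ≠ 0 := fun h' => h (cmp_eq_zero.1 h')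
        have h2 : c.cmp a ≠ 0 := fun h' => h (cmp_eq_zero.1 h').symm
        simp [h1, h2, iha]

theorem cmp_trans {a b c : Val} (h : a.cmp b = 1) (h' : b.cmp c = 1) : a.cmp c = 1 := by
  induction a generalizing b c with
  | num m =>
    cases b with
    | num n =>
      cases c with
      | num p =>
        simp only [cmp] at *
        split_ifs at * <;> omega
      | pair c d => simp [cmp]
    | pair b b' =>
      cases c with
      | num p => simp [cmp] at h'
      | pair c d => simp [cmp]
  | pair a a' iha ihb =>
    cases b with
    | num n => simp [cmp] at h
    | pair b b' =>
      cases c with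
      | num p => simp [cmp] at h'
      | pair c c' =>
        simp only [cmp] at *
        by_cases h1 : a.cmp b = 0
        · rw [if_pos h1] at h
          obtain rfl := cmp_eq_zero.1 h1
          by_cases h2 : a.cmp c = 0
          · rw [if_pos h2] at h' ⊢
            exact ihb h h'
          · rw [if_neg h2] at h' ⊢
            exact h'
        · rw [if_neg h1] at h
          by_cases h2 : b.cmp c = 0
          · obtain rfl := cmp_eq_zero.1 h2
            rw [if_neg h1]
            exact h
          · rw [if_neg h2] at h'
            rw [iha h h']
            simp

theorem cmp_irrefl {a : Val} : a.cmp a ≠ 1 := by simp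

theorem cmp_ne {a b : Val} (h : a.cmp b = 1) : a ≠ b := by
  rintro rfl
  exact cmp_irrefl h

/-- The order is lexicographic, so keys with a common first component are consecutive in a sorted
tree. This allows `find` to skip a side. -/
theorem cmp_fst {a b : Val} (h : a.cmp b = 1) : a.fst.cmp b.fst ≠ 2 := by
  cases a with
  | num m =>
    cases b with
    | num n => simp
    | pair c d =>
      cases c with
      | num n => simp [cmp]; split_ifs <;> simp
      | pair c c' => simp [cmp]
  | pair a a' =>
    cases b with
    | num n => simp [cmp] at h
    | pair c d =>
      simp only [cmp] at h
      split_ifs at h with h1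
      · simp [h1]
      · simp [h]

end Val

/-! ### AVL trees as sorted sequences of entries -/

namespace Tree

def toList : Tree → List Val
  | leaf => []
  | node _ kv l r => l.toList ++ kv :: r.toList

@[simp] theorem toList_leaf : leaf.toList = [] := rfl
@[simp] theorem toList_node (h : ℕ) (kv : Val) (l r : Tree) :
    (node h kv l r).toList = l.toList ++ kv :: r.toList := rfl
@[simp] theorem toList_mk (kv : Val) (l r : Tree) :
    (mk kv l r).toList = l.toList ++ kv :: r.toList := rfl
@[simp] theorem ht_mk (kv : Val) (l r : Tree) : (mk kv l r).ht = max l.ht r.ht + 1 := by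
  simp only [mk, ht_node]; split_ifs <;> omega

theorem toList_eq {t : Tree} (h : 0 < t.ht) :
    t.toList = t.left.toList ++ t.entry :: t.right.toList := by
  cases t with
  | leaf => simp at h
  | node h kv l r => rfl

@[simp] theorem toList_bal (kv : Val) (l r : Tree) :
    (bal kv l r).toList = l.toList ++ kv :: r.toList := by
  unfold bal
  split_ifs with h1 h2 h3 h4
  · simp [toList_eq (show 0 < l.ht by omega), toList_eq (show 0 < l.right.ht by omega)]
  · simp [toList_eq (show 0 < l.ht by omega)]
  · simp [toList_eq (show 0 < r.ht by omega), toList_eq (show 0 < r.left.ht by omega)]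
  · simp [toList_eq (show 0 < r.ht by omega)]
  · simp

theorem Balanced.left {t : Tree} (h : t.Balanced) : t.left.Balanced := by
  cases t with
  | leaf => exact h
  | node n kv l r => exact h.2.2.2.1

theorem Balanced.right {t : Tree} (h : t.Balanced) : t.right.Balanced := by
  cases t with
  | leaf => exact h
  | node n kv l r => exact h.2.2.2.2

theorem Balanced.ht {t : Tree} (h : t.Balanced) (h0 : 0 < t.ht) :
    t.ht = max t.left.ht t.right.ht + 1 ∧ t.left.ht ≤ t.right.ht + 1 ∧
      t.right.ht ≤ t.left.ht + 1 := by
  cases t with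
  | leaf => simp at h0
  | node n kv l r => exact ⟨h.1, h.2.1, h.2.2.1⟩

theorem balanced_mk {kv : Val} {l r : Tree} (hl : l.Balanced) (hr : r.Balanced)
    (h1 : l.ht ≤ r.ht + 1) (h2 : r.ht ≤ l.ht + 1) : (mk kv l r).Balanced := by
  refine ⟨?_, h1, h2, hl, hr⟩
  split_ifs <;> omega

/-- A change below moves the height of one side by at most one, so a difference of two is the worst
case. The last clause gives the exact height when no rotation is needed; with it the callers see
that their own height changes by at most one. -/
theorem balanced_bal {kv : Val} {l r : Tree} (hl : l.Balanced) (hr : r.Balanced)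
    (h1 : l.ht ≤ r.ht + 2) (h2 : r.ht ≤ l.ht + 2) :
    (bal kv l r).Balanced ∧ max l.ht r.ht ≤ (bal kv l r).ht ∧
      (bal kv l r).ht ≤ max l.ht r.ht + 1 ∧
      (l.ht ≤ r.ht + 1 → r.ht ≤ l.ht + 1 → (bal kv l r).ht = max l.ht r.ht + 1) := by
  unfold bal
  split_ifs with h3 h4 h4 h5
  · have a := hl.ht (by omega)
    have b := hl.right.ht (by omega)
    refine ⟨balanced_mk (balanced_mk hl.left hl.right.left ?_ ?_)
      (balanced_mk hl.right.right hr ?_ ?_) ?_ ?_, ?_, ?_, ?_⟩ <;>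
      (try simp only [ht_mk]) <;> omega
  · have a := hl.ht (by omega)
    refine ⟨balanced_mk hl.left (balanced_mk hl.right hr ?_ ?_) ?_ ?_, ?_, ?_, ?_⟩ <;>
      (try simp only [ht_mk]) <;> omega
  · have a := hr.ht (by omega)
    have b := hr.left.ht (by omega)
    refine ⟨balanced_mk (balanced_mk hl hr.left.left ?_ ?_)
      (balanced_mk hr.left.right hr.right ?_ ?_) ?_ ?_, ?_, ?_, ?_⟩ <;>
      (try simp only [ht_mk]) <;> omega
  · have a := hr.ht (by omega)
    refine ⟨balanced_mk (balanced_mk hl hr.left ?_ ?_) hr.right ?_ ?_, ?_, ?_, ?_⟩ <;>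
      (try simp only [ht_mk]) <;> omega
  · exact ⟨balanced_mk hl hr (by omega) (by omega), by rw [ht_mk]; omega, by rw [ht_mk],
      fun _ _ => ht_mk _ _ _⟩

theorem balanced_ins_aux (kv : Val) {t : Tree} (ht : t.Balanced) :
    (t.ins kv).Balanced ∧ t.ht ≤ (t.ins kv).ht ∧ (t.ins kv).ht ≤ t.ht + 1 := by
  induction t with
  | leaf => simp [ins, mk, Balanced]
  | node h kv' l r ihl ihr =>
    obtain ⟨hh, h1, h2, hl, hr⟩ := ht
    obtain ⟨al, bl, cl⟩ := ihl hl
    obtain ⟨ar, br, cr⟩ := ihr hr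
    simp only [ins, ht_node]
    split_ifs
    · exact ⟨balanced_mk hl hr h1 h2, by simp; omega, by simp; omega⟩
    · obtain ⟨x, y, z, w⟩ := balanced_bal (kv := kv') al hr (by omega) (by omega)
      exact ⟨x, by omega, by omega⟩
    · obtain ⟨x, y, z, w⟩ := balanced_bal (kv := kv') hl ar (by omega) (by omega)
      exact ⟨x, by omega, by omega⟩

theorem Balanced.ins {t : Tree} (ht : t.Balanced) (kv : Val) : (t.ins kv).Balanced :=
  (balanced_ins_aux kv ht).1

theorem balanced_delMin {t : Tree} (ht : t.Balanced) :
    t.delMin.2.Balanced ∧ t.ht ≤ t.delMin.2.ht + 1 ∧ t.delMin.2.ht ≤ t.ht := by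
  induction t with
  | leaf => simp [delMin, Balanced]
  | node h kv l r ihl ihr =>
    obtain ⟨hh, h1, h2, hl, hr⟩ := ht
    cases l with
    | leaf =>
      simp [delMin] at *
      exact ⟨hr, by omega, by omega⟩
    | node h' kv' l' r' =>
      obtain ⟨al, bl, cl⟩ := ihl hl
      simp only [delMin, ht_node] at *
      obtain ⟨x, y, z, w⟩ := balanced_bal (kv := kv) al hr (by omega) (by omega)
      exact ⟨x, by omega, by omega⟩

theorem balanced_del_aux (k : Val) {t : Tree} (ht : t.Balanced) :
    (t.del k).Balanced ∧ t.ht ≤ (t.del k).ht + 1 ∧ (t.del k).ht ≤ t.ht := by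
  induction t with
  | leaf => simp [del, Balanced]
  | node h kv l r ihl ihr =>
    obtain ⟨hh, h1, h2, hl, hr⟩ := ht
    obtain ⟨al, bl, cl⟩ := ihl hl
    obtain ⟨ar, br, cr⟩ := ihr hr
    simp only [del, ht_node]
    split_ifs
    · cases r with
      | leaf =>
        simp at *
        exact ⟨hl, by omega, by omega⟩
      | node h' kv' l' r' =>
        obtain ⟨ad, bd, cd⟩ := balanced_delMin hr
        obtain ⟨x, y, z, w⟩ := balanced_bal (kv := (node h' kv' l' r').delMin.1) hl ad
          (by omega) (by omega)
        exact ⟨x, by simp only; omega, by simp only; omega⟩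
    · obtain ⟨x, y, z, w⟩ := balanced_bal (kv := kv) al hr (by omega) (by omega)
      exact ⟨x, by omega, by omega⟩
    · obtain ⟨x, y, z, w⟩ := balanced_bal (kv := kv) hl ar (by omega) (by omega)
      exact ⟨x, by omega, by omega⟩

theorem Balanced.del {t : Tree} (ht : t.Balanced) (k : Val) : (t.del k).Balanced :=
  (balanced_del_aux k ht).1

/-- Both subtrees of a root of height `h` have height at least `h - 2`, so the number of entries
doubles with every two levels. -/
theorem two_pow_le {t : Tree} (ht : t.Balanced) : 2 ^ (t.ht / 2) ≤ t.toList.length + 1 := by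
  induction t with
  | leaf => simp
  | node h kv l r ihl ihr =>
    obtain ⟨hh, h1, h2, hl, hr⟩ := ht
    have a := ihl hl
    have b := ihr hr
    simp only [ht_node, toList_node, List.length_append, List.length_cons]
    rcases Nat.lt_or_ge h 2 with h' | h'
    · have : h / 2 = 0 := by omega
      simp [this]
    · have e : h / 2 = (h - 2) / 2 + 1 := by omega
      have c : 2 ^ ((h - 2) / 2) ≤ 2 ^ (l.ht / 2) :=
        Nat.pow_le_pow_right (by norm_num) (Nat.div_le_div_right (by omega))
      have d : 2 ^ ((h - 2) / 2) ≤ 2 ^ (r.ht / 2) :=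
        Nat.pow_le_pow_right (by norm_num) (Nat.div_le_div_right (by omega))
      rw [e, pow_succ]
      omega

/-- The keys are strictly increasing. -/
def Sorted (t : Tree) : Prop := t.toList.Pairwise fun x y => x.fst.cmp y.fst = 1

theorem sorted_leaf : leaf.Sorted := List.Pairwise.nil

theorem sorted_node {h : ℕ} {kv : Val} {l r : Tree} : (node h kv l r).Sorted ↔
    l.Sorted ∧ r.Sorted ∧ (∀ x ∈ l.toList, x.fst.cmp kv.fst = 1) ∧
      (∀ x ∈ r.toList, kv.fst.cmp x.fst = 1) ∧
      ∀ x ∈ l.toList, ∀ y ∈ r.toList, x.fst.cmp y.fst = 1 := by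
  simp only [Sorted, toList_node, List.pairwise_append, List.pairwise_cons, List.mem_cons,
    forall_eq_or_imp]
  constructor
  · rintro ⟨a, ⟨b, c⟩, d⟩
    exact ⟨a, c, fun x hx => (d x hx).1, b, fun x hx => (d x hx).2⟩
  · rintro ⟨a, b, c, d, e⟩
    exact ⟨a, ⟨d, b⟩, fun x hx => ⟨c x hx, e x hx⟩⟩

theorem sorted_of_toList {t u : Tree} (h : t.toList = u.toList) : t.Sorted ↔ u.Sorted := by
  simp [Sorted, h]

theorem sorted_bal {kv : Val} {l r : Tree} : (bal kv l r).Sorted ↔ (node 0 kv l r).Sorted :=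
  sorted_of_toList (by simp)

theorem mem_ins {t : Tree} (ht : t.Sorted) {kv x : Val} :
    x ∈ (t.ins kv).toList ↔ x = kv ∨ (x ∈ t.toList ∧ x.fst ≠ kv.fst) := by
  induction t with
  | leaf => simp [ins]
  | node h kv' l r ihl ihr =>
    obtain ⟨sl, sr, hl, hr, hlr⟩ := sorted_node.1 ht
    have ihl := ihl sl
    have ihr := ihr sr
    simp only [ins]
    split_ifs with h1 h2
    · have h1 := Val.cmp_eq_zero.1 h1
      have a : ∀ x ∈ l.toList, x.fst ≠ kv.fst := fun x hx => h1 ▸ Val.cmp_ne (hl x hx)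
      have b : ∀ x ∈ r.toList, x.fst ≠ kv.fst := fun x hx => h1 ▸ (Val.cmp_ne (hr x hx)).symm
      simp only [toList_mk, List.mem_append, List.mem_cons, toList_node]
      constructor
      · rintro (h | rfl | h)
        exacts [.inr ⟨.inl h, a x h⟩, .inl rfl, .inr ⟨.inr (.inr h), b x h⟩]
      · rintro (rfl | ⟨h | rfl | h, h'⟩)
        exacts [.inr (.inl rfl), .inl h, absurd h1.symm h', .inr (.inr h)]
    · have a : kv'.fst ≠ kv.fst := (Val.cmp_ne h2).symm
      have b : ∀ x ∈ r.toList, x.fst ≠ kv.fst := fun x hx =>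
        (Val.cmp_ne (Val.cmp_trans h2 (hr x hx))).symm
      simp only [toList_bal, List.mem_append, List.mem_cons, toList_node, ihl]
      constructor
      · rintro ((h | h) | rfl | h)
        exacts [.inl h, .inr ⟨.inl h.1, h.2⟩, .inr ⟨.inr (.inl rfl), a⟩,
          .inr ⟨.inr (.inr h), b x h⟩]
      · rintro (rfl | ⟨h | rfl | h, h'⟩)
        exacts [.inl (.inl rfl), .inl (.inr ⟨h, h'⟩), .inr (.inl rfl), .inr (.inr h)]
    · have h3 : kv'.fst.cmp kv.fst = 1 := by
        have := Val.cmp_le_two kv.fst kv'.fst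
        exact Val.cmp_eq_two.1 (by omega)
      have a : kv'.fst ≠ kv.fst := Val.cmp_ne h3
      have b : ∀ x ∈ l.toList, x.fst ≠ kv.fst := fun x hx =>
        Val.cmp_ne (Val.cmp_trans (hl x hx) h3)
      simp only [toList_bal, List.mem_append, List.mem_cons, toList_node, ihr]
      constructor
      · rintro (h | rfl | h | h)
        exacts [.inr ⟨.inl h, b x h⟩, .inr ⟨.inr (.inl rfl), a⟩, .inl h,
          .inr ⟨.inr (.inr h.1), h.2⟩]
      · rintro (rfl | ⟨h | rfl | h, h'⟩)
        exacts [.inr (.inr (.inl rfl)), .inl h, .inr (.inl rfl), .inr (.inr (.inr ⟨h, h'⟩))]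

theorem Sorted.ins {t : Tree} (ht : t.Sorted) (kv : Val) : (t.ins kv).Sorted := by
  induction t with
  | leaf => simp [Tree.ins, Sorted]
  | node h kv' l r ihl ihr =>
    obtain ⟨sl, sr, hl, hr, hlr⟩ := sorted_node.1 ht
    simp only [Tree.ins]
    split_ifs with h1 h2
    · have h1 := Val.cmp_eq_zero.1 h1
      refine sorted_node.2 ⟨sl, sr, ?_, ?_, hlr⟩ <;> rw [h1] <;> assumption
    · refine sorted_bal.2 (sorted_node.2 ⟨ihl sl, sr, ?_, hr, ?_⟩)
      · intro x hx
        rcases (mem_ins sl).1 hx with rfl | hx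
        exacts [h2, hl x hx.1]
      · intro x hx
        rcases (mem_ins sl).1 hx with rfl | hx
        exacts [fun y hy => Val.cmp_trans h2 (hr y hy), hlr x hx.1]
    · have h3 : kv'.fst.cmp kv.fst = 1 := by
        have := Val.cmp_le_two kv.fst kv'.fst
        exact Val.cmp_eq_two.1 (by omega)
      refine sorted_bal.2 (sorted_node.2 ⟨sl, ihr sr, hl, ?_, ?_⟩)
      · intro x hx
        rcases (mem_ins sr).1 hx with rfl | hx
        exacts [h3, hr x hx.1]
      · intro x hx y hy
        rcases (mem_ins sr).1 hy with rfl | hy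
        exacts [Val.cmp_trans (hl x hx) h3, hlr x hx y hy.1]

theorem length_ins_le (kv : Val) (t : Tree) : (t.ins kv).toList.length ≤ t.toList.length + 1 := by
  induction t with
  | leaf => simp [ins]
  | node h kv' l r ihl ihr =>
    simp only [ins]
    split_ifs <;> simp <;> omega

theorem toList_delMin {h : ℕ} {kv : Val} {l r : Tree} : (node h kv l r).toList =
    (node h kv l r).delMin.1 :: (node h kv l r).delMin.2.toList := by
  induction l generalizing h kv r with
  | leaf => simp [delMin]
  | node h' kv' l' r' ihl ihr =>
    have := @ihl h' kv' r'
    rw [toList_node, this]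
    simp [delMin]

/-- The sublist property is proved along with membership because it yields sortedness and the length
bound at once. -/
theorem mem_del_and_sublist {t : Tree} (ht : t.Sorted) (k : Val) :
    (∀ x, x ∈ (t.del k).toList ↔ x ∈ t.toList ∧ x.fst ≠ k) ∧
      (t.del k).toList.Sublist t.toList := by
  induction t with
  | leaf => simp [del]
  | node h kv l r ihl ihr =>
    obtain ⟨sl, sr, hl, hr, hlr⟩ := sorted_node.1 ht
    obtain ⟨ihl, jhl⟩ := ihl sl
    obtain ⟨ihr, jhr⟩ := ihr sr
    simp only [del]
    split_ifs with h1 h2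
    · obtain rfl := Val.cmp_eq_zero.1 h1
      have a : ∀ x ∈ l.toList, x.fst ≠ kv.fst := fun x hx => Val.cmp_ne (hl x hx)
      have b : ∀ x ∈ r.toList, x.fst ≠ kv.fst := fun x hx => (Val.cmp_ne (hr x hx)).symm
      have key : ∀ u : Tree, u.toList = l.toList ++ r.toList →
          (∀ x, x ∈ u.toList ↔ x ∈ (node h kv l r).toList ∧ x.fst ≠ kv.fst) ∧
            u.toList.Sublist (node h kv l r).toList := by
        intro u hu
        rw [hu]
        refine ⟨fun x => ?_, ?_⟩
        · simp only [List.mem_append, toList_node, List.mem_cons]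
          constructor
          · rintro (h | h)
            exacts [⟨.inl h, a x h⟩, ⟨.inr (.inr h), b x h⟩]
          · rintro ⟨h | rfl | h, h'⟩
            exacts [.inl h, absurd rfl h', .inr h]
        · exact (List.sublist_cons_self _ _).append_left _
      cases r with
      | leaf => exact key l (by simp)
      | node h' kv' l' r' => exact key _ (by rw [toList_bal, ← toList_delMin])
    · have a : kv.fst ≠ k := (Val.cmp_ne h2).symm
      have b : ∀ x ∈ r.toList, x.fst ≠ k := fun x hx =>
        (Val.cmp_ne (Val.cmp_trans h2 (hr x hx))).symm
      refine ⟨fun x => ?_, ?_⟩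
      · simp only [toList_bal, List.mem_append, List.mem_cons, toList_node, ihl]
        constructor
        · rintro (h | rfl | h)
          exacts [⟨.inl h.1, h.2⟩, ⟨.inr (.inl rfl), a⟩, ⟨.inr (.inr h), b x h⟩]
        · rintro ⟨h | rfl | h, h'⟩
          exacts [.inl ⟨h, h'⟩, .inr (.inl rfl), .inr (.inr h)]
      · rw [toList_bal]
        exact jhl.append_right _
    · have h3 : kv.fst.cmp k = 1 := by
        have := Val.cmp_le_two k kv.fst
        exact Val.cmp_eq_two.1 (by omega)
      have a : kv.fst ≠ k := Val.cmp_ne h3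
      have b : ∀ x ∈ l.toList, x.fst ≠ k := fun x hx => Val.cmp_ne (Val.cmp_trans (hl x hx) h3)
      refine ⟨fun x => ?_, ?_⟩
      · simp only [toList_bal, List.mem_append, List.mem_cons, toList_node, ihr]
        constructor
        · rintro (h | rfl | h)
          exacts [⟨.inl h, b x h⟩, ⟨.inr (.inl rfl), a⟩, ⟨.inr (.inr h.1), h.2⟩]
        · rintro ⟨h | rfl | h, h'⟩
          exacts [.inl h, .inr (.inl rfl), .inr (.inr ⟨h, h'⟩)]
      · rw [toList_bal]
        exact (jhr.cons_cons _).append_left _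

theorem mem_del {t : Tree} (ht : t.Sorted) {k x : Val} :
    x ∈ (t.del k).toList ↔ x ∈ t.toList ∧ x.fst ≠ k := (mem_del_and_sublist ht k).1 x

theorem Sorted.del {t : Tree} (ht : t.Sorted) (k : Val) : (t.del k).Sorted :=
  List.Pairwise.sublist (mem_del_and_sublist ht k).2 ht

theorem length_del_le {t : Tree} (ht : t.Sorted) (k : Val) :
    (t.del k).toList.length ≤ t.toList.length := (mem_del_and_sublist ht k).2.length_le

/-- The entries whose keys have first component `g`. -/
def group (g : Val) (t : Tree) : List Val :=
  t.toList.filter fun x => decide (g.cmp x.fst.fst = 0)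

theorem mem_group {g x : Val} {t : Tree} : x ∈ t.group g ↔ x ∈ t.toList ∧ x.fst.fst = g := by
  rw [group, List.mem_filter, decide_eq_true_eq, Val.cmp_eq_zero, eq_comm (a := g)]

/-- Since the search comes from the right, a counter of `n` leaves the last `n` entries of the
group. When it turns to one side only, `cmp_fst` excludes entries of the group on the other. -/
theorem find_eq {t : Tree} (ht : t.Sorted) (g : Val) (n : ℕ) (acc : List Val) :
    t.find g (n, acc) = (n - (t.group g).length,
      ((t.group g).drop ((t.group g).length - n)).map Val.snd ++ acc) := by
  induction t generalizing n acc with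
  | leaf => simp [find, group]
  | node h kv l r ihl ihr =>
    obtain ⟨sl, sr, hl, hr, hlr⟩ := sorted_node.1 ht
    have ihl := ihl sl
    have ihr := ihr sr
    simp only [find]
    split_ifs with h0 h1 h2 h3
    · subst h0
      simp
    · obtain rfl := Val.cmp_eq_zero.1 h1
      have e : (node h kv l r).group kv.fst.fst = l.group kv.fst.fst ++ kv :: r.group kv.fst.fst := by
        simp [group]
      rw [ihr] at h2 ⊢
      rw [e]
      simp only at h2
      simp only [List.length_append, List.length_cons, Prod.mk.injEq]
      refine ⟨by omega, ?_⟩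
      congr 2
      rw [List.drop_append, List.drop_eq_nil_of_le (as := l.group kv.fst.fst) (by omega)]
      obtain ⟨p, hp⟩ : ∃ p, (l.group kv.fst.fst).length + ((r.group kv.fst.fst).length + 1) - n -
        (l.group kv.fst.fst).length = p + 1 := ⟨(r.group kv.fst.fst).length - n, by omega⟩
      rw [hp, List.nil_append, List.drop_succ_cons]
      congr 1
      omega
    · obtain rfl := Val.cmp_eq_zero.1 h1
      have e : (node h kv l r).group kv.fst.fst = l.group kv.fst.fst ++ kv :: r.group kv.fst.fst := by
        simp [group]
      rw [ihr] at h2 ⊢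
      rw [ihl, e]
      simp only at h2
      simp only [List.length_append, List.length_cons, Prod.mk.injEq]
      refine ⟨by omega, ?_⟩
      rw [List.drop_append]
      have e1 : (r.group kv.fst.fst).length - n = 0 := by omega
      have e2 : (l.group kv.fst.fst).length + ((r.group kv.fst.fst).length + 1) - n -
        (l.group kv.fst.fst).length = 0 := by omega
      have e3 : (l.group kv.fst.fst).length + ((r.group kv.fst.fst).length + 1) - n =
        (l.group kv.fst.fst).length - (n - (r.group kv.fst.fst).length - 1) := by omega
      simp [e1, e2, e3]
    · have e : (node h kv l r).group g = l.group g := by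
        simp only [group, toList_node, List.filter_append]
        rw [List.append_right_eq_self, List.filter_eq_nil_iff]
        intro x hx
        simp only [decide_eq_true_eq]
        intro h4
        obtain rfl := Val.cmp_eq_zero.1 h4
        rcases List.mem_cons.1 hx with rfl | hx
        · exact h1 (by simp)
        · exact Val.cmp_fst (hr x hx) (Val.cmp_eq_two.2 h3)
      rw [ihl, e]
    · have h4 : kv.fst.fst.cmp g = 1 := by
        have := Val.cmp_le_two g kv.fst.fst
        exact Val.cmp_eq_two.1 (by omega)
      have e : (node h kv l r).group g = r.group g := by
        have : l.toList.filter (fun x => decide (g.cmp x.fst.fst = 0)) = [] := by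
          rw [List.filter_eq_nil_iff]
          intro x hx
          simp only [decide_eq_true_eq]
          intro h5
          obtain rfl := Val.cmp_eq_zero.1 h5
          exact Val.cmp_fst (hl x hx) (Val.cmp_eq_two.2 h4)
        simp [group, this, h1]
      rw [ihr, e]

/-- At most `n` values whose keys have first component `g`. -/
def values (n : ℕ) (t : Tree) (g : Val) : List Val := (t.find g (n, [])).2

theorem length_find (g : Val) (t : Tree) (acc : ℕ × List Val) :
    (t.find g acc).1 + (t.find g acc).2.length = acc.1 + acc.2.length := by
  induction t generalizing acc with
  | leaf => simp [find]
  | node h kv l r ihl ihr =>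
    simp only [find]
    split_ifs
    · rfl
    · exact ihr _
    · rw [ihl]
      simp only [List.length_cons]
      have := ihr acc
      omega
    · exact ihl _
    · exact ihr _

theorem length_values_le (n : ℕ) (t : Tree) (g : Val) : (t.values n g).length ≤ n := by
  have := length_find g t (n, [])
  simp [values] at *
  omega

theorem values_eq {t : Tree} (ht : t.Sorted) (n : ℕ) (g : Val) :
    t.values n g = ((t.group g).drop ((t.group g).length - n)).map Val.snd := by
  simp [values, find_eq ht]

theorem mem_of_mem_values {t : Tree} (ht : t.Sorted) {n : ℕ} {g v : Val} (h : v ∈ t.values n g) :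
    ∃ x ∈ t.toList, x.fst.fst = g ∧ x.snd = v := by
  rw [values_eq ht, List.mem_map] at h
  obtain ⟨x, hx, rfl⟩ := h
  obtain ⟨h1, h2⟩ := mem_group.1 (List.mem_of_mem_drop hx)
  exact ⟨x, h1, h2, rfl⟩

/-- Every use of a truncated search rests on this alternative: either it delivers as many values as
were allowed, or nothing is missing. -/
theorem values_complete {t : Tree} (ht : t.Sorted) (n : ℕ) (g : Val) :
    (t.values n g).length = n ∨ ∀ x ∈ t.toList, x.fst.fst = g → x.snd ∈ t.values n g := by
  rw [values_eq ht]
  rcases Nat.lt_or_ge (t.group g).length n with h | h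
  · right
    intro x hx hg
    rw [show (t.group g).length - n = 0 by omega]
    exact List.mem_map.2 ⟨x, by simpa using mem_group.2 ⟨hx, hg⟩, rfl⟩
  · left
    simp
    omega

theorem Sorted.nodup {t : Tree} (ht : t.Sorted) : t.toList.Nodup :=
  List.Pairwise.imp (fun h => by rintro rfl; exact Val.cmp_irrefl h) ht

theorem values_nodup {t : Tree} (ht : t.Sorted) (n : ℕ) (g : Val)
    (h : ∀ x ∈ t.toList, ∀ y ∈ t.toList, x.fst.fst = g → y.fst.fst = g → x.snd = y.snd → x = y) :
    (t.values n g).Nodup := by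
  rw [values_eq ht]
  refine List.Nodup.map_on ?_ (((ht.nodup.filter _)).sublist (List.drop_sublist _ _))
  intro x hx y hy hxy
  obtain ⟨h1, h2⟩ := mem_group.1 (List.mem_of_mem_drop hx)
  obtain ⟨h3, h4⟩ := mem_group.1 (List.mem_of_mem_drop hy)
  exact h x h1 y h3 h2 h4 hxy

end Tree
end DynLocalSearch

namespace DynLocalSearch
open Prog

/-! ### Functions on lists -/

namespace Val

@[simp] theorem ofVals_nil : ofVals [] = num 0 := rfl
@[simp] theorem ofVals_cons (a : Val) (l : List Val) : ofVals (a :: l) = pair a (ofVals l) := rfl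

/-- The list stored in a value. -/
def toVals : Val → List Val
  | num _ => []
  | pair a b => a :: b.toVals

@[simp] theorem toVals_num (n : ℕ) : (num n).toVals = [] := rfl
@[simp] theorem toVals_pair (a b : Val) : (pair a b).toVals = a :: b.toVals := rfl

@[simp] theorem toVals_ofVals (l : List Val) : (ofVals l).toVals = l := by
  induction l with
  | nil => rfl
  | cons a l ih => simp [ih]

/-- Equality of numbers, as tested by the machine. -/
def same (x y : Val) : Bool := !(x.lt y) && !(y.lt x)

/-- Membership in a list of numbers. -/
def memL (x : Val) (l : List Val) : Bool := l.any (same x)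

/-- Inclusion of lists of numbers. -/
def subL (l l' : List Val) : Bool := l.all fun x => memL x l'

/-- Insertion into a strictly decreasing list. -/
def sins (x : Val) : List Val → List Val
  | [] => [x]
  | y :: l => if y.lt x then x :: y :: l else if x.lt y then y :: sins x l else y :: l

theorem length_sins_le (x : Val) (l : List Val) : (sins x l).length ≤ l.length + 1 := by
  induction l with
  | nil => simp [sins]
  | cons y l ih => simp only [sins]; split_ifs <;> simp; omega

/-- Insertion of several elements. -/
def unionL (l acc : List Val) : List Val := l.foldl (fun acc x => sins x acc) acc

theorem length_unionL_le (l acc : List Val) : (unionL l acc).length ≤ acc.length + l.length := by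
  induction l generalizing acc with
  | nil => simp [unionL]
  | cons x l ih =>
    have := ih (sins x acc)
    have := length_sins_le x acc
    simp [unionL] at *
    omega

end Val

open Val

/-! ### List versions of boundaries, neighbourhoods and the connectedness test -/

section Tables

variable (nb vs : Val → List Val)

/-- Insert the vertices of `X` with an incidence outside of `A`. -/
def bdVs (A X acc : List Val) : List Val :=
  X.foldl (fun acc v => if subL (nb v) A then acc else sins v acc) acc

def bdEs (A A' acc : List Val) : List Val := A'.foldl (fun acc e => bdVs nb A (vs e) acc) acc

/-- The boundary of `A`. -/
def bdL (A : List Val) : List Val := bdEs nb vs A A []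

def stepVs (X acc : List Val) : List Val := X.foldl (fun acc v => unionL (nb v) acc) acc

def stepEs (L acc : List Val) : List Val := L.foldl (fun acc e => stepVs nb (vs e) acc) acc

/-- Iterated neighbourhood of a set of hyperedges. -/
def ballL : ℕ → List Val → List Val
  | 0, L => L
  | n + 1, L => ballL n (stepEs nb vs L L)

def noSplit (B : List Val) (Bs : List (List Val)) : Bool :=
  Bs.all fun A => A.isEmpty || !subL (bdL nb vs A) B

end Tables

/-- Prepend `cur`, extended by each subset of `L` with at most `n` elements. -/
def sublL : List Val → ℕ → List Val → List (List Val) → List (List Val)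
  | [], _, cur, acc => cur :: acc
  | x :: L, n, cur, acc =>
    if n = 0 then sublL L n cur acc else sublL L (n - 1) (x :: cur) (sublL L n cur acc)

def lenLe : List Val → ℕ → Bool
  | [], _ => true
  | _ :: l, n => if n = 0 then false else lenLe l (n - 1)

theorem lenLe_iff {l : List Val} {n : ℕ} : lenLe l n = true ↔ l.length ≤ n := by
  induction l generalizing n with
  | nil => simp [lenLe]
  | cons a l ih => simp only [lenLe]; split_ifs <;> simp [ih] <;> omega

/-- Prepend the elements of `A` to `cur`, and subtract `2` for each of them. -/
def appL : List Val → List Val → ℕ → List Val × ℕ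
  | [], cur, n => (cur, n)
  | a :: A, cur, n => appL A (a :: cur) (n - 1 - 1)

theorem appL_eq (A cur : List Val) (n : ℕ) :
    appL A cur n = (A.reverse ++ cur, n - 2 * A.length) := by
  induction A generalizing cur n with
  | nil => simp [appL]
  | cons a A ih => simp [appL, ih]; omega

/-- In use, `n` is `s` minus twice the length of `cur`, truncated at `0`, so `n = 0` means that half
of `s` is reached. The empty list stands for failure; it is also returned if the very last item is
needed to reach `s / 2`, since the union of a whole group may lose its boundary. -/
def witL (s : ℕ) : List Val → List Val → ℕ → List Val
  | [], _, _ => []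
  | A :: items, cur, n =>
    if (appL A.toVals [] s).2 = 0 then (appL A.toVals [] s).1
    else if (appL A.toVals cur n).2 = 0 then
      if items = [] then [] else (appL A.toVals cur n).1
    else witL s items (appL A.toVals cur n).1 (appL A.toVals cur n).2

/-! ### Simulation of the functions on lists -/

section Simulation

variable {ω : Val → Bool × ℕ}

theorem computes_mem (x : Val) (l : List Val) :
    Computes program ω iMem (pair x (ofVals l)) (ofBool (memL x l)) (40 * (l.length + 1)) := by
  induction l with
  | nil =>
    refine .of_wp rfl ?_
    simp [memC, Returns, memL, ofBool]
  | cons y l ih =>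
    refine .of_wp rfl ?_
    by_cases h1 : x.lt y = true
    · simp [memC, h1]
      refine ⟨_, _, ih, ?_⟩
      simp [Returns, memL, same, h1]
      omega
    · by_cases h2 : y.lt x = true
      · simp [memC, h1, h2]
        refine ⟨_, _, ih, ?_⟩
        simp [Returns, memL, same, h1, h2]
        omega
      · simp [memC, h1, h2, Returns, memL, same, ofBool]
        omega

theorem computes_sub (l l' : List Val) :
    Computes program ω iSub (pair (ofVals l) (ofVals l')) (ofBool (subL l l'))
      ((l.length + 1) * (40 * (l'.length + 1) + 20)) := by
  induction l with
  | nil =>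
    refine .of_wp rfl ?_
    simp [subC, Returns, subL, ofBool]
  | cons x l ih =>
    refine .of_wp rfl ?_
    simp [subC]
    refine ⟨_, _, computes_mem x l', ?_⟩
    rw [Nat.succ_mul]
    by_cases h1 : memL x l' = true
    · simp [h1]
      refine ⟨_, _, ih, ?_⟩
      simp [Returns, subL, h1]
      omega
    · simp [h1, Returns, subL, ofBool]
      omega

theorem computes_sins (x : Val) (l : List Val) :
    Computes program ω iSIns (pair x (ofVals l)) (ofVals (sins x l)) (40 * (l.length + 1)) := by
  induction l with
  | nil =>
    refine .of_wp rfl ?_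
    simp [sinsC, Returns, sins]
  | cons y l ih =>
    refine .of_wp rfl ?_
    by_cases h1 : y.lt x = true
    · simp [sinsC, h1, Returns, sins]
      omega
    · by_cases h2 : x.lt y = true
      · simp [sinsC, h1, h2]
        refine ⟨_, _, ih, ?_⟩
        simp [Returns, sins, h1, h2]
        omega
      · simp [sinsC, h1, h2, Returns, sins]
        omega

theorem computes_union (l acc : List Val) (Z : ℕ) (h : acc.length + l.length ≤ Z) :
    Computes program ω iUnion (pair (ofVals l) (ofVals acc)) (ofVals (unionL l acc))
      ((l.length + 1) * (40 * (Z + 1) + 20)) := by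
  induction l generalizing acc with
  | nil =>
    refine .of_wp rfl ?_
    simp [unionC, Returns, unionL]
  | cons x l ih =>
    refine .of_wp rfl ?_
    simp only [List.length_cons] at h
    have h1 := length_sins_le x acc
    simp [unionC]
    refine ⟨_, _, computes_sins x acc, _, _, ih (sins x acc) (by omega), ?_⟩
    rw [Nat.succ_mul]
    simp [Returns, unionL]
    omega

theorem computes_subl (L : List Val) (n : ℕ) (cur : List Val) (acc : List (List Val)) :
    Computes program ω iSubl
      (pair (ofVals L) (pair (num n) (pair (ofVals cur) (ofVals (acc.map ofVals)))))
      (ofVals ((sublL L n cur acc).map ofVals)) (60 * (2 ^ (L.length + 1) - 1)) := by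
  induction L generalizing n cur acc with
  | nil =>
    refine .of_wp rfl ?_
    simp [sublC, Returns, sublL]
  | cons x L ih =>
    refine .of_wp rfl ?_
    have h2 : 2 ^ (L.length + 1 + 1) = 2 * 2 ^ (L.length + 1) := by ring
    have h3 : 0 < 2 ^ (L.length + 1) := by positivity
    by_cases h : n = 0
    · simp [sublC]
      refine ⟨_, _, ih n cur acc, ?_⟩
      simp [h, Returns, sublL]
      omega
    · simp [sublC]
      refine ⟨_, _, ih n cur acc, ?_⟩
      simp [h]
      refine ⟨_, _, ih (n - 1) (x :: cur) _, ?_⟩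
      simp [h, Returns, sublL]
      omega

theorem computes_lenLe (l : List Val) (n : ℕ) :
    Computes program ω iLenLe (pair (ofVals l) (num n)) (ofBool (lenLe l n))
      (30 * (l.length + 1)) := by
  induction l generalizing n with
  | nil =>
    refine .of_wp rfl ?_
    simp [lenLeC, Returns, lenLe, ofBool]
  | cons x l ih =>
    refine .of_wp rfl ?_
    by_cases h : n = 0
    · simp [lenLeC, Returns, lenLe, ofBool, h]
      omega
    · simp [lenLeC, h]
      refine ⟨_, _, ih (n - 1), ?_⟩
      simp [h, Returns, lenLe]
      omega

theorem computes_app (A : Val) (cur : List Val) (n : ℕ) :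
    Computes program ω iApp (pair A (pair (ofVals cur) (num n)))
      (pair (ofVals (appL A.toVals cur n).1) (num (appL A.toVals cur n).2))
      (40 * (A.toVals.length + 1)) := by
  induction A generalizing cur n with
  | num m =>
    refine .of_wp rfl ?_
    simp [appC, Returns, appL]
  | pair a A _ ih =>
    refine .of_wp rfl ?_
    simp [appC]
    refine ⟨_, _, ih (a :: cur) (n - 1 - 1), ?_⟩
    simp [Returns, appL]
    omega

theorem computes_wit (s : ℕ) (items cur : List Val) (n Z : ℕ)
    (hZ : ∀ A ∈ items, A.toVals.length ≤ Z) :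
    Computes program ω iWit (pair (ofVals items) (pair (num s) (pair (ofVals cur) (num n))))
      (ofVals (witL s items cur n)) ((items.length + 1) * (80 * (Z + 1) + 60)) := by
  induction items generalizing cur n with
  | nil =>
    refine .of_wp rfl ?_
    simp [witC, Returns, witL]
  | cons A items ih =>
    refine .of_wp rfl ?_
    have hA := hZ A (by simp)
    simp [witC]
    refine ⟨_, _, computes_app A [] s, ?_⟩
    rw [Nat.succ_mul]
    by_cases h1 : (appL A.toVals [] s).2 = 0
    · simp [h1, Returns, witL]
      omega
    · simp [h1]
      refine ⟨_, _, computes_app A cur n, ?_⟩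
      by_cases h2 : (appL A.toVals cur n).2 = 0
      · cases items with
        | nil => simp [h1, h2, Returns, witL]; omega
        | cons A' items => simp [h1, h2, Returns, witL]; omega
      · simp [h2]
        refine ⟨_, _, ih _ _ fun A hA => hZ A (by simp [hA]), ?_⟩
        simp [h1, h2, Returns, witL]
        omega

end Simulation
end DynLocalSearch

namespace DynLocalSearch
open Prog Val

/-! ### Functions on the stored hypergraph -/

/-- Incidences of a vertex, at most `N`. -/
def nbT (N : ℕ) (TV : Tree) (v : Val) : List Val := TV.values N v

/-- The stored list of the vertices of a hyperedge. -/
def vsV (TE : Tree) (e : Val) : Val := (ofVals (TE.values 1 e)).fst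

/-- Vertices of a hyperedge. -/
def vsT (TE : Tree) (e : Val) : List Val := (vsV TE e).toVals

/-- Encoding of the stored hypergraph. -/
abbrev encTb (N : ℕ) (TE TV : Tree) : Val := pair (num N) (pair TE.enc TV.enc)

def allInL (TE : Tree) (A : List Val) : Bool := A.all fun e => !(TE.values 1 e).isEmpty

def qualL (ω : Val → Bool × ℕ) (N k : ℕ) (TE TV : Tree) (A : List Val) : Bool :=
  !A.isEmpty && allInL TE A && lenLe (bdL (nbT N TV) (vsT TE) A) k &&
    noSplit (nbT N TV) (vsT TE) (bdL (nbT N TV) (vsT TE) A) (sublL A.tail N [] []) &&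
    (ω (ofVals A)).1

/-- Recompute the witness for the boundary `B`. -/
def refreshT (N s : ℕ) (TF TW : Tree) (B : Val) : Tree :=
  if witL s (TF.values N B) [] s = [] then TW.del B
  else TW.ins (pair B (ofVals (witL s (TF.values N B) [] s)))

def remAllT (N s : ℕ) (TE TV : Tree) : List (List Val) → Tree → Tree → Tree × Tree
  | [], TF, TW => (TF, TW)
  | A :: cs, TF, TW =>
    remAllT N s TE TV cs (TF.del (pair (ofVals (bdL (nbT N TV) (vsT TE) A)) (ofVals A)))
      (refreshT N s (TF.del (pair (ofVals (bdL (nbT N TV) (vsT TE) A)) (ofVals A))) TW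
        (ofVals (bdL (nbT N TV) (vsT TE) A)))

def insAllT (ω : Val → Bool × ℕ) (N s k : ℕ) (TE TV : Tree) :
    List (List Val) → Tree → Tree → Tree × Tree
  | [], TF, TW => (TF, TW)
  | A :: cs, TF, TW =>
    if qualL ω N k TE TV A then
      insAllT ω N s k TE TV cs
        (TF.ins (pair (pair (ofVals (bdL (nbT N TV) (vsT TE) A)) (ofVals A)) (ofVals A)))
        (refreshT N s
          (TF.ins (pair (pair (ofVals (bdL (nbT N TV) (vsT TE) A)) (ofVals A)) (ofVals A))) TW
          (ofVals (bdL (nbT N TV) (vsT TE) A)))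
    else insAllT ω N s k TE TV cs TF TW

def addIncT (e : Val) (X : List Val) (TV : Tree) : Tree :=
  X.foldl (fun t v => t.ins (pair (pair v e) e)) TV

def delIncT (e : Val) (X : List Val) (TV : Tree) : Tree :=
  X.foldl (fun t v => t.del (pair v e)) TV

/-! ### Lengths -/

section Lengths

variable (nb vs : Val → List Val)

theorem length_bdVs_le (A X acc : List Val) :
    (bdVs nb A X acc).length ≤ acc.length + X.length := by
  induction X generalizing acc with
  | nil => simp [bdVs]
  | cons v X ih =>
    have h1 := ih acc
    have h2 := ih (sins v acc)
    have h3 := length_sins_le v acc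
    simp only [bdVs, List.foldl_cons, List.length_cons] at *
    split_ifs <;> omega

theorem length_bdEs_le {R : ℕ} (hR : ∀ e, (vs e).length ≤ R) (A A' acc : List Val) :
    (bdEs nb vs A A' acc).length ≤ acc.length + A'.length * R := by
  induction A' generalizing acc with
  | nil => simp [bdEs]
  | cons e A' ih =>
    have h1 := ih (bdVs nb A (vs e) acc)
    have h2 := length_bdVs_le nb A (vs e) acc
    have h3 := hR e
    simp only [bdEs, List.foldl_cons, List.length_cons, Nat.succ_mul] at *
    omega

theorem length_bdL_le {R : ℕ} (hR : ∀ e, (vs e).length ≤ R) (A : List Val) :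
    (bdL nb vs A).length ≤ A.length * R := by
  simpa [bdL] using length_bdEs_le nb vs hR A A []

theorem length_stepVs_le {N : ℕ} (hN : ∀ v, (nb v).length ≤ N) (X acc : List Val) :
    (stepVs nb X acc).length ≤ acc.length + X.length * N := by
  induction X generalizing acc with
  | nil => simp [stepVs]
  | cons v X ih =>
    have h1 := ih (unionL (nb v) acc)
    have h2 := length_unionL_le (nb v) acc
    have h3 := hN v
    simp only [stepVs, List.foldl_cons, List.length_cons, Nat.succ_mul] at *
    omega

theorem length_stepEs_le {N R : ℕ} (hN : ∀ v, (nb v).length ≤ N) (hR : ∀ e, (vs e).length ≤ R)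
    (L acc : List Val) : (stepEs nb vs L acc).length ≤ acc.length + L.length * (R * N) := by
  induction L generalizing acc with
  | nil => simp [stepEs]
  | cons e L ih =>
    have h1 := ih (stepVs nb (vs e) acc)
    have h2 := length_stepVs_le nb hN (vs e) acc
    have h3 := Nat.mul_le_mul_right N (hR e)
    simp only [stepEs, List.foldl_cons, List.length_cons, Nat.succ_mul] at *
    omega

theorem length_ballL_le {N R : ℕ} (hN : ∀ v, (nb v).length ≤ N) (hR : ∀ e, (vs e).length ≤ R)
    (n : ℕ) (L : List Val) : (ballL nb vs n L).length ≤ L.length * (1 + R * N) ^ n := by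
  induction n generalizing L with
  | zero => simp [ballL]
  | succ n ih =>
    have h := length_stepEs_le nb vs hN hR L L
    refine (ih _).trans ?_
    rw [pow_succ', ← Nat.mul_assoc]
    refine Nat.mul_le_mul_right _ (h.trans (le_of_eq ?_))
    ring

end Lengths

theorem mem_sublL {L : List Val} {n : ℕ} {cur B : List Val} {acc : List (List Val)} :
    B ∈ sublL L n cur acc ↔
      B ∈ acc ∨ ∃ s : List Val, s.Sublist L ∧ s.length ≤ n ∧ B = s.reverse ++ cur := by
  induction L generalizing n cur acc with
  | nil => simp [sublL, or_comm]
  | cons x L ih =>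
    simp only [sublL]
    split_ifs with h
    · subst h
      rw [ih]
      refine or_congr_right ⟨?_, ?_⟩ <;> rintro ⟨s, h1, h2, rfl⟩
      · exact ⟨s, h1.cons _, h2, rfl⟩
      · obtain rfl : s = [] := by simpa using h2
        exact ⟨[], by simp, by simp, rfl⟩
    · rw [ih, ih, or_assoc]
      refine or_congr_right ⟨?_, ?_⟩
      · rintro (⟨s, h1, h2, rfl⟩ | ⟨s, h1, h2, rfl⟩)
        · exact ⟨s, h1.cons _, h2, rfl⟩
        · exact ⟨x :: s, h1.cons_cons _, by simp; omega, by simp⟩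
      · rintro ⟨s, h1, h2, rfl⟩
        cases h1 with
        | cons _ h1 => exact .inl ⟨s, h1, h2, rfl⟩
        | cons_cons _ h1 =>
          rename_i s
          exact .inr ⟨s, h1, by simp at h2; omega, by simp⟩

theorem mem_sublL_nil {L : List Val} {n : ℕ} {B : List Val} :
    B ∈ sublL L n [] [] ↔ B.reverse.Sublist L ∧ B.length ≤ n := by
  rw [mem_sublL]
  constructor
  · rintro (h | ⟨s, h1, h2, rfl⟩)
    · simp at h
    · simpa using ⟨h1, h2⟩
  · rintro ⟨h1, h2⟩
    exact .inr ⟨B.reverse, h1, by simpa using h2, by simp⟩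

theorem length_sublL_le (L : List Val) (n : ℕ) (cur : List Val) (acc : List (List Val)) :
    (sublL L n cur acc).length ≤ acc.length + 2 ^ L.length := by
  induction L generalizing n cur acc with
  | nil => simp [sublL]
  | cons x L ih =>
    have h1 := ih n cur acc
    have h2 := ih (n - 1) (x :: cur) (sublL L n cur acc)
    have h3 : 2 ^ (L.length + 1) = 2 * 2 ^ L.length := by ring
    simp only [sublL, List.length_cons]
    split_ifs <;> omega

/-! ### Sizes -/

theorem mem_sins {x y : Val} {l : List Val} (h : x ∈ sins y l) : x = y ∨ x ∈ l := by
  induction l with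
  | nil => simpa [sins] using h
  | cons z l ih =>
    simp only [sins] at h
    split_ifs at h
    · simpa using h
    · rcases List.mem_cons.1 h with rfl | h
      · simp
      · rcases ih h with h | h <;> simp [h]
    · exact .inr h

section Sizes

variable {nb vs : Val → List Val}

theorem size_bdVs {A X acc : List Val} (hX : ∀ v ∈ X, v.size = 1) (h : ∀ v ∈ acc, v.size = 1) :
    ∀ v ∈ bdVs nb A X acc, v.size = 1 := by
  induction X generalizing acc with
  | nil => simpa [bdVs] using h
  | cons v X ih =>
    simp only [bdVs, List.foldl_cons] at *
    apply ih (fun w hw => hX w (by simp [hw]))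
    split_ifs
    · exact h
    · intro w hw
      rcases mem_sins hw with rfl | hw
      exacts [hX _ (by simp), h w hw]

theorem size_bdL (hvs : ∀ e, ∀ v ∈ vs e, v.size = 1) (A : List Val) :
    ∀ v ∈ bdL nb vs A, v.size = 1 := by
  suffices h : ∀ A' acc, (∀ v ∈ acc, v.size = 1) → ∀ v ∈ bdEs nb vs A A' acc, v.size = 1 from
    h A [] (by simp)
  intro A'
  induction A' with
  | nil => simp [bdEs]
  | cons e A' ih =>
    intro acc h
    exact ih _ (size_bdVs (hvs e) h)

theorem size_unionL {l acc : List Val} (hl : ∀ v ∈ l, v.size = 1) (h : ∀ v ∈ acc, v.size = 1) :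
    ∀ v ∈ unionL l acc, v.size = 1 := by
  induction l generalizing acc with
  | nil => simpa [unionL] using h
  | cons v l ih =>
    simp only [unionL, List.foldl_cons] at *
    apply ih (fun w hw => hl w (by simp [hw]))
    intro w hw
    rcases mem_sins hw with rfl | hw
    exacts [hl _ (by simp), h w hw]

theorem size_stepVs (hnb : ∀ v, ∀ f ∈ nb v, f.size = 1) {X acc : List Val}
    (h : ∀ v ∈ acc, v.size = 1) : ∀ v ∈ stepVs nb X acc, v.size = 1 := by
  induction X generalizing acc with
  | nil => simpa [stepVs] using h
  | cons v X ih => exact ih (size_unionL (hnb v) h)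

theorem size_stepEs (hnb : ∀ v, ∀ f ∈ nb v, f.size = 1) {L acc : List Val}
    (h : ∀ v ∈ acc, v.size = 1) : ∀ v ∈ stepEs nb vs L acc, v.size = 1 := by
  induction L generalizing acc with
  | nil => simpa [stepEs] using h
  | cons e L ih => exact ih (size_stepVs hnb h)

theorem size_ballL (hnb : ∀ v, ∀ f ∈ nb v, f.size = 1) {n : ℕ} {L : List Val}
    (h : ∀ v ∈ L, v.size = 1) : ∀ v ∈ ballL nb vs n L, v.size = 1 := by
  induction n generalizing L with
  | zero => exact h
  | succ n ih => exact ih (size_stepEs hnb h)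

theorem size_ofVals {l : List Val} (h : ∀ v ∈ l, v.size = 1) : (ofVals l).size = 2 * l.length + 1 := by
  induction l with
  | nil => rfl
  | cons a l ih =>
    simp [Val.size, ih fun v hv => h v (by simp [hv]), h a (by simp)]
    omega

end Sizes

/-! ### Time bounds -/

/-- The units in which running times are measured. -/
def cost (Z U j : ℕ) : ℕ := Z ^ j * U

theorem cost_mono {Z U i j : ℕ} (hZ : 1 ≤ Z) (h : i ≤ j) : cost Z U i ≤ cost Z U j :=
  Nat.mul_le_mul_right _ (Nat.pow_le_pow_right hZ h)

theorem mul_cost (Z U j : ℕ) : Z * cost Z U j = cost Z U (j + 1) := by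
  simp only [cost]; ring

theorem le_cost_one {Z U : ℕ} (hU : 1 ≤ U) : Z ≤ cost Z U 1 := by
  simpa [cost] using Nat.mul_le_mul_left Z hU

theorem sq_le_cost_two {Z U : ℕ} (hU : 1 ≤ U) : Z * Z ≤ cost Z U 2 := by
  rw [cost, sq]
  simpa using Nat.mul_le_mul_left (Z * Z) hU

/-- A loop of at most `Z` rounds raises the exponent by one; the last call, on exhausted input, is
absorbed by `n + 1 ≤ 2 * Z`. All time bounds are composed in this way. -/
theorem loop_le {Z U n c j : ℕ} (hZ : 1 ≤ Z) (hn : n ≤ Z) :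
    (n + 1) * (c * cost Z U j) ≤ 2 * c * cost Z U (j + 1) := by
  calc (n + 1) * (c * cost Z U j) ≤ (2 * Z) * (c * cost Z U j) :=
        Nat.mul_le_mul_right _ (by omega)
    _ = 2 * c * cost Z U (j + 1) := by rw [← mul_cost]; ring

/-- Assumptions on the stored hypergraph for the time bounds: `Z` bounds the lengths of lists, `U`
the heights of trees. -/
structure Tables (Z U R S N : ℕ) (TE TV : Tree) : Prop where
  hZ : 1 ≤ Z
  hU : 1 ≤ U
  hN : N + 1 ≤ Z
  hS : 2 * (S * R) + 2 * S + 3 ≤ Z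
  hS' : 2 ^ (S + 1) ≤ Z
  hR : R ≤ Z
  balE : TE.Balanced
  balV : TV.Balanced
  htE : TE.ht < U
  htV : TV.ht < U
  vs_len : ∀ e, (vsT TE e).length ≤ R
  vs_size : ∀ e, ∀ v ∈ vsT TE e, v.size = 1
  nb_size : ∀ v, ∀ f ∈ nbT N TV v, f.size = 1

section Simulation

variable {ω : Val → Bool × ℕ} {Z U R S N : ℕ} {TE TV : Tree}

theorem computes_values {n : ℕ} {t : Tree} (ht : t.Balanced) (hU : t.ht < U) (hn : n + 1 ≤ Z)
    {g : Val} (hg : g.size = 1) :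
    Computes program ω iFind (pair g (pair t.enc (pair (num n) (num 0))))
      (pair (num (t.find g (n, [])).1) (ofVals (t.values n g))) (280 * cost Z U 1) := by
  refine (computes_find g t ht n).mono ?_
  rw [hg]
  calc _ ≤ 140 * (Z * (2 * U)) := by gcongr; omega
    _ = _ := by simp only [cost]; ring

theorem computes_bdV (T : Tables Z U R S N TE TV) (X : Val) (A acc : List Val)
    (hX : ∀ v ∈ X.toVals, v.size = 1) (hA : A.length ≤ Z) (hacc : acc.length + X.toVals.length ≤ Z) :
    Computes program ω iBdV (pair X (pair (ofVals A) (pair (encTb N TE TV) (ofVals acc))))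
      (ofVals (bdVs (nbT N TV) A X.toVals acc)) ((X.toVals.length + 1) * (800 * cost Z U 2)) := by
  have hU := T.hU
  have hZ := T.hZ
  have c0 : 1 ≤ cost Z U 1 := hZ.trans (le_cost_one hU)
  have c1 := le_cost_one (Z := Z) hU
  have c2 : cost Z U 1 ≤ cost Z U 2 := cost_mono hZ (by norm_num)
  have c3 := sq_le_cost_two (Z := Z) hU
  induction X generalizing acc with
  | num n =>
    refine .of_wp rfl ?_
    simp [bdVC, Returns, bdVs]
    omega
  | pair v X _ ih =>
    refine .of_wp rfl ?_
    have hl := length_sins_le v acc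
    simp at hacc
    have hn := TV.length_values_le N v
    have := T.hN
    have hs : ((nbT N TV v).length + 1) * (40 * (A.length + 1) + 20) ≤ 200 * (Z * Z) :=
      calc _ ≤ Z * (200 * Z) := Nat.mul_le_mul (by simp only [nbT]; omega) (by omega)
        _ = _ := by ring
    simp [bdVC]
    refine ⟨_, _, computes_values T.balV T.htV T.hN (hX v (by simp)), ?_⟩
    simp
    refine ⟨_, _, computes_sub (nbT N TV v) A, ?_⟩
    rw [Nat.succ_mul]
    by_cases h : subL (nbT N TV v) A = true
    · simp [h]
      refine ⟨_, _, ih acc (fun w hw => hX w (by simp [hw])) (by omega), ?_⟩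
      simp [Returns, bdVs, h]
      omega
    · simp [h]
      refine ⟨_, _, computes_sins v acc, _, _,
        ih (sins v acc) (fun w hw => hX w (by simp [hw])) (by omega), ?_⟩
      simp [Returns, bdVs, h]
      omega

theorem computes_bdE (T : Tables Z U R S N TE TV) (A A' acc : List Val)
    (hA' : ∀ e ∈ A', e.size = 1) (hA : A.length ≤ Z) (hacc : acc.length + A'.length * R ≤ Z) :
    Computes program ω iBdE (pair (ofVals A') (pair (ofVals A) (pair (encTb N TE TV) (ofVals acc))))
      (ofVals (bdEs (nbT N TV) (vsT TE) A A' acc)) ((A'.length + 1) * (2000 * cost Z U 3)) := by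
  have hU := T.hU
  have hZ := T.hZ
  have c0 : 1 ≤ cost Z U 1 := hZ.trans (le_cost_one hU)
  have c1 := le_cost_one (Z := Z) hU
  have c2 : cost Z U 1 ≤ cost Z U 3 := cost_mono hZ (by norm_num)
  induction A' generalizing acc with
  | nil =>
    refine .of_wp rfl ?_
    simp [bdEC, Returns, bdEs]
    omega
  | cons e A' ih =>
    refine .of_wp rfl ?_
    have hl := length_bdVs_le (nbT N TV) A (vsT TE e) acc
    have hv := T.vs_len e
    simp [Nat.succ_mul] at hacc
    have := T.hN
    have hb : ((vsT TE e).length + 1) * (800 * cost Z U 2) ≤ 1600 * cost Z U 3 :=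
      loop_le hZ (hv.trans T.hR)
    have := T.hS
    simp [bdEC]
    refine ⟨_, _, computes_values T.balE T.htE (Z := Z) (by omega) (hA' e (by simp)), ?_⟩
    simp
    refine ⟨_, _, computes_bdV T (vsV TE e) A acc (T.vs_size e) hA (by simp only [vsT] at hv; omega),
      _, _, ih (bdVs (nbT N TV) A (vsT TE e) acc) (fun w hw => hA' w (by simp [hw])) (by omega), ?_⟩
    rw [Nat.succ_mul]
    simp only [vsT] at hb
    simp [Returns, bdEs, vsT]
    omega

theorem computes_bd (T : Tables Z U R S N TE TV) {A : List Val}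
    (hA : ∀ e ∈ A, e.size = 1) (hl : A.length ≤ S) :
    Computes program ω iBdE
      (pair (ofVals A) (pair (ofVals A) (pair (encTb N TE TV) (num 0))))
      (ofVals (bdL (nbT N TV) (vsT TE) A)) (4000 * cost Z U 4) := by
  have := T.hS
  have h : A.length * R ≤ S * R := Nat.mul_le_mul_right _ hl
  exact (computes_bdE T A A [] hA (by omega) (by simp; omega)).mono (loop_le T.hZ (by omega))

theorem computes_stepV (T : Tables Z U R S N TE TV) (X : Val) (acc : List Val)
    (hX : ∀ v ∈ X.toVals, v.size = 1) (hacc : acc.length + X.toVals.length * N ≤ Z) :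
    Computes program ω iStepV (pair X (pair (encTb N TE TV) (ofVals acc)))
      (ofVals (stepVs (nbT N TV) X.toVals acc)) ((X.toVals.length + 1) * (600 * cost Z U 2)) := by
  have hU := T.hU
  have hZ := T.hZ
  have c0 : 1 ≤ cost Z U 1 := hZ.trans (le_cost_one hU)
  have c1 := le_cost_one (Z := Z) hU
  have c2 : cost Z U 1 ≤ cost Z U 2 := cost_mono hZ (by norm_num)
  have c3 := sq_le_cost_two (Z := Z) hU
  induction X generalizing acc with
  | num n =>
    refine .of_wp rfl ?_
    simp [stepVC, Returns, stepVs]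
    omega
  | pair v X _ ih =>
    refine .of_wp rfl ?_
    have hl := length_unionL_le (nbT N TV v) acc
    have hn : (nbT N TV v).length ≤ N := TV.length_values_le N v
    simp [Nat.succ_mul] at hacc
    have := T.hN
    have hs : ((nbT N TV v).length + 1) * (40 * (Z + 1) + 20) ≤ 200 * (Z * Z) :=
      calc _ ≤ Z * (200 * Z) := Nat.mul_le_mul (by omega) (by omega)
        _ = _ := by ring
    simp [stepVC]
    refine ⟨_, _, computes_values T.balV T.htV T.hN (hX v (by simp)), ?_⟩
    simp
    refine ⟨_, _, computes_union (nbT N TV v) acc Z (by omega), _, _,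
      ih _ (fun w hw => hX w (by simp [hw])) (by omega), ?_⟩
    rw [Nat.succ_mul]
    simp [Returns, stepVs]
    omega

theorem computes_stepE (T : Tables Z U R S N TE TV) (L acc : List Val)
    (hL : ∀ e ∈ L, e.size = 1) (hacc : acc.length + L.length * (R * N) ≤ Z) :
    Computes program ω iStepE (pair (ofVals L) (pair (encTb N TE TV) (ofVals acc)))
      (ofVals (stepEs (nbT N TV) (vsT TE) L acc)) ((L.length + 1) * (1600 * cost Z U 3)) := by
  have hU := T.hU
  have hZ := T.hZ
  have c0 : 1 ≤ cost Z U 1 := hZ.trans (le_cost_one hU)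
  have c1 := le_cost_one (Z := Z) hU
  have c2 : cost Z U 1 ≤ cost Z U 3 := cost_mono hZ (by norm_num)
  induction L generalizing acc with
  | nil =>
    refine .of_wp rfl ?_
    simp [stepEC, Returns, stepEs]
    omega
  | cons e L ih =>
    refine .of_wp rfl ?_
    have hl := length_stepVs_le (nbT N TV) (TV.length_values_le N) (vsT TE e) acc
    have hv := T.vs_len e
    simp [Nat.succ_mul] at hacc
    have := T.hS
    have hv' := Nat.mul_le_mul_right N hv
    have hb : ((vsT TE e).length + 1) * (600 * cost Z U 2) ≤ 1200 * cost Z U 3 :=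
      loop_le hZ (hv.trans T.hR)
    simp [stepEC]
    refine ⟨_, _, computes_values T.balE T.htE (Z := Z) (by omega) (hL e (by simp)), ?_⟩
    simp
    refine ⟨_, _, computes_stepV T (vsV TE e) acc (T.vs_size e)
      (by simp only [vsT] at hv'; omega),
      _, _, ih (stepVs (nbT N TV) (vsT TE e) acc) (fun w hw => hL w (by simp [hw])) (by omega), ?_⟩
    rw [Nat.succ_mul]
    simp only [vsT] at hb
    simp [Returns, stepEs, vsT]
    omega

theorem computes_iter (T : Tables Z U R S N TE TV) (n : ℕ) (L : List Val)
    (hL : ∀ e ∈ L, e.size = 1) (hl : L.length * (1 + R * N) ^ n ≤ Z) :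
    Computes program ω iIter (pair (num n) (pair (encTb N TE TV) (ofVals L)))
      (ofVals (ballL (nbT N TV) (vsT TE) n L)) ((n + 1) * (3300 * cost Z U 4)) := by
  have hU := T.hU
  have hZ := T.hZ
  have c0 : 1 ≤ cost Z U 1 := hZ.trans (le_cost_one hU)
  have c2 : cost Z U 1 ≤ cost Z U 4 := cost_mono hZ (by norm_num)
  induction n generalizing L with
  | zero =>
    refine .of_wp rfl ?_
    simp [iterC, Returns, ballL]
    omega
  | succ n ih =>
    refine .of_wp rfl ?_
    have h1 := length_stepEs_le (nbT N TV) (vsT TE) (TV.length_values_le N) T.vs_len L L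
    -- The current length times the growth still possible stays below `Z`, so that every
    -- intermediate list is short as well.
    have h2 : (L.length + L.length * (R * N)) * (1 + R * N) ^ n ≤ Z :=
      le_trans (le_of_eq (by ring)) hl
    have h3 : L.length + L.length * (R * N) ≤ Z :=
      le_trans (Nat.le_mul_of_pos_right _ (by positivity)) h2
    have hb : (L.length + 1) * (1600 * cost Z U 3) ≤ 3200 * cost Z U 4 :=
      loop_le hZ (by omega)
    simp [iterC]
    refine ⟨_, _, computes_stepE T L L hL h3, _, _,
      ih _ (size_stepEs T.nb_size hL) ((Nat.mul_le_mul_right _ h1).trans h2), ?_⟩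
    rw [Nat.succ_mul]
    simp [Returns, ballL]
    omega

theorem computes_noSplit (T : Tables Z U R S N TE TV) (B : List Val) (Bs : List (List Val))
    (hBs : ∀ A ∈ Bs, A.length ≤ S ∧ ∀ e ∈ A, e.size = 1) (hB : B.length ≤ Z) :
    Computes program ω iNoSplit
      (pair (ofVals (Bs.map ofVals)) (pair (ofVals B) (encTb N TE TV)))
      (ofBool (noSplit (nbT N TV) (vsT TE) B Bs)) ((Bs.length + 1) * (4500 * cost Z U 4)) := by
  have hU := T.hU
  have hZ := T.hZ
  have c0 : 1 ≤ cost Z U 1 := hZ.trans (le_cost_one hU)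
  have c1 : cost Z U 1 ≤ cost Z U 4 := cost_mono hZ (by norm_num)
  have c2 : cost Z U 2 ≤ cost Z U 4 := cost_mono hZ (by norm_num)
  have c3 := sq_le_cost_two (Z := Z) hU
  induction Bs with
  | nil =>
    refine .of_wp rfl ?_
    simp [noSplitC, Returns, noSplit, ofBool]
    omega
  | cons A Bs ih =>
    obtain ⟨h1, h2⟩ := hBs A (by simp)
    have ih := ih fun A hA => hBs A (by simp [hA])
    refine .of_wp rfl ?_
    cases A with
    | nil =>
      simp [noSplitC]
      refine ⟨_, _, ih, ?_⟩
      rw [Nat.succ_mul]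
      simp [Returns, noSplit]
      omega
    | cons a A =>
      have hl := length_bdL_le (nbT N TV) (vsT TE) T.vs_len (a :: A)
      have hl' := hl.trans (Nat.mul_le_mul_right R h1)
      have := T.hS
      have hs : ((bdL (nbT N TV) (vsT TE) (a :: A)).length + 1) * (40 * (B.length + 1) + 20) ≤
          200 * (Z * Z) :=
        calc _ ≤ Z * (200 * Z) := Nat.mul_le_mul (by omega) (by omega)
          _ = _ := by ring
      simp [noSplitC]
      refine ⟨_, _, computes_bd T h2 h1, _, _, computes_sub _ _, ?_⟩
      rw [Nat.succ_mul]
      by_cases h : subL (bdL (nbT N TV) (vsT TE) (a :: A)) B = true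
      · simp [h, Returns, noSplit, ofBool]
        omega
      · simp [h]
        refine ⟨_, _, ih, ?_⟩
        simp [Returns, noSplit, h]
        omega

theorem computes_allIn (T : Tables Z U R S N TE TV) (A : List Val) (hA : ∀ e ∈ A, e.size = 1) :
    Computes program ω iAllIn (pair (ofVals A) (encTb N TE TV)) (ofBool (allInL TE A))
      ((A.length + 1) * (350 * cost Z U 1)) := by
  have hU := T.hU
  have hZ := T.hZ
  have c0 : 1 ≤ cost Z U 1 := hZ.trans (le_cost_one hU)
  induction A with
  | nil =>
    refine .of_wp rfl ?_
    simp [allInC, Returns, allInL, ofBool]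
    omega
  | cons e A ih =>
    refine .of_wp rfl ?_
    have := T.hS
    simp [allInC]
    refine ⟨_, _, computes_values T.balE T.htE (Z := Z) (by omega) (hA e (by simp)), ?_⟩
    rw [Nat.succ_mul]
    cases h : TE.values 1 e with
    | nil =>
      simp [Returns, allInL, ofBool, h]
      omega
    | cons x l =>
      simp
      refine ⟨_, _, ih fun w hw => hA w (by simp [hw]), ?_⟩
      simp [Returns, allInL, h]
      omega

/-- The oracle is called last, when all members of `A` are known to be stored hyperedges; so its
time needs to be bounded only in that case. -/
theorem computes_qual (T : Tables Z U R S N TE TV) {A : List Val} (k : ℕ)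
    (hA : ∀ e ∈ A, e.size = 1) (hl : A.length ≤ S)
    (hω : allInL TE A = true → (ω (ofVals A)).2 ≤ U) :
    Computes program ω iQual
      (pair (ofVals A) (pair (ofVals (bdL (nbT N TV) (vsT TE) A)) (pair (encTb N TE TV) (num k))))
      (ofBool (qualL ω N k TE TV A)) (12000 * cost Z U 5) := by
  have hU := T.hU
  have hZ := T.hZ
  have c0 : 1 ≤ cost Z U 1 := hZ.trans (le_cost_one hU)
  have c1 : cost Z U 1 ≤ cost Z U 5 := cost_mono hZ (by norm_num)
  have c2 : cost Z U 2 ≤ cost Z U 5 := cost_mono hZ (by norm_num)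
  have c3 := le_cost_one (Z := Z) hU
  have c4 : U ≤ cost Z U 5 := by simpa [cost] using Nat.mul_le_mul_right U (Nat.one_le_pow 5 Z hZ)
  have hS := T.hS
  have hS' := T.hS'
  have hb := (length_bdL_le (nbT N TV) (vsT TE) T.vs_len A).trans (Nat.mul_le_mul_right R hl)
  have hi : (A.length + 1) * (350 * cost Z U 1) ≤ 700 * cost Z U 2 := loop_le hZ (by omega)
  refine .of_wp rfl ?_
  cases A with
  | nil =>
    simp [qualC, Returns, qualL, ofBool]
    omega
  | cons a A =>
    simp only [List.length_cons] at hl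
    have h2 : 2 ^ (A.length + 1) ≤ 2 ^ (S + 1) := Nat.pow_le_pow_right (by norm_num) (by omega)
    have h2' : 2 ^ (A.length + 1) = 2 * 2 ^ A.length := by ring
    have h3 : (sublL A N [] []).length ≤ Z := by
      have := length_sublL_le A N [] []
      simp only [List.length_nil] at this
      omega
    have h4 : ((sublL A N [] []).length + 1) * (4500 * cost Z U 4) ≤ 9000 * cost Z U 5 :=
      loop_le hZ h3
    have h5 : ∀ B ∈ sublL A N [] [], B.length ≤ S ∧ ∀ e ∈ B, e.size = 1 := by
      intro B hB
      have hB := (mem_sublL_nil.1 hB).1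
      refine ⟨by have := hB.length_le; simp at this; omega, fun e he => hA e ?_⟩
      exact List.mem_cons_of_mem _ (hB.subset (by simpa using he))
    simp [qualC]
    refine ⟨_, _, computes_allIn T (a :: A) hA, ?_⟩
    by_cases g1 : allInL TE (a :: A) = true
    · have g0 := hω g1
      simp only [ofVals_cons] at g0
      simp [g1]
      refine ⟨_, _, computes_lenLe _ k, ?_⟩
      by_cases g2 : lenLe (bdL (nbT N TV) (vsT TE) (a :: A)) k = true
      · simp [g2]
        refine ⟨_, _, computes_subl A N [] [], _, _, computes_noSplit T _ _ h5 (by omega), ?_⟩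
        by_cases g3 : noSplit (nbT N TV) (vsT TE) (bdL (nbT N TV) (vsT TE) (a :: A))
            (sublL A N [] []) = true
        · simp [g1, g2, g3, Returns, qualL, ofBool]
          simp only [List.length_cons] at hi
          omega
        · simp [g1, g2, g3, Returns, qualL, ofBool]
          simp only [List.length_cons] at hi
          omega
      · simp [g1, g2, Returns, qualL, ofBool]
        simp only [List.length_cons] at hi
        omega
    · simp [g1, Returns, qualL, ofBool]
      simp only [List.length_cons] at hi
      omega

end Simulation
end DynLocalSearch

namespace DynLocalSearch
open Prog Val

/-! ### Simulation of the updates -/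

/-- Assumptions on the stored sets and witnesses for the time bounds; there is room for `c` more
entries in each tree. -/
structure Sets (M S c : ℕ) (TF TW : Tree) : Prop where
  balF : TF.Balanced
  balW : TW.Balanced
  sortF : TF.Sorted
  sortW : TW.Sorted
  lenF : TF.toList.length + c ≤ M
  lenW : TW.toList.length + c ≤ M
  val : ∀ x ∈ TF.toList, x.snd.toVals.length ≤ S

/-- Encoding of the parameters. -/
abbrev encPrm (s k N : ℕ) : Val := pair (num s) (pair (num k) (num N))

/-- The candidates for changes in the neighbourhood of `e`. -/
def candidates (N : ℕ) (TE TV : Tree) (e : Val) : List (List Val) :=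
  sublL (ballL (nbT N TV) (vsT TE) (N - 1) [e]) (N - 1) [] []

section Simulation

variable {ω : Val → Bool × ℕ} {Z U R S N M : ℕ} {TE TV TF TW : Tree}

theorem computes_ins' {kv : Val} {t : Tree} (ht : t.Balanced) (hU : t.ht < U)
    (hZ : 1 ≤ Z) (hk : kv.fst.size ≤ Z) :
    Computes program ω iIns (pair kv t.enc) (t.ins kv).enc (340 * cost Z U 1) := by
  refine (computes_ins kv t ht).mono ?_
  calc _ ≤ (340 * Z) * U := Nat.mul_le_mul (by omega) (by omega)
    _ = _ := by simp only [cost]; ring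

theorem computes_del' {k : Val} {t : Tree} (ht : t.Balanced) (hU : t.ht < U)
    (hZ : 1 ≤ Z) (hk : k.size ≤ Z) :
    Computes program ω iDel (pair k t.enc) (t.del k).enc (640 * cost Z U 1) := by
  refine (computes_del k t ht).mono ?_
  calc _ ≤ (640 * Z) * U := Nat.mul_le_mul (by omega) (by omega)
    _ = _ := by simp only [cost]; ring

theorem computes_refresh (T : Tables Z U R S N TE TV) {c : ℕ} (H : Sets M S c TF TW)
    (hM : ∀ t : Tree, t.Balanced → t.toList.length ≤ M → t.ht < U) (s k : ℕ) {B : Val}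
    (hB : B.size ≤ Z) :
    Computes program ω iRefresh (pair B (pair TF.enc (pair TW.enc (encPrm s k N))))
      (refreshT N s TF TW B).enc (1500 * cost Z U 2) := by
  have hU := T.hU
  have hZ := T.hZ
  have c0 : 1 ≤ cost Z U 1 := hZ.trans (le_cost_one hU)
  have c1 : cost Z U 1 ≤ cost Z U 2 := cost_mono hZ (by norm_num)
  have c3 := sq_le_cost_two (Z := Z) hU
  have hN := T.hN
  have hS := T.hS
  have hF := hM TF H.balF (by have := H.lenF; omega)
  have hW := hM TW H.balW (by have := H.lenW; omega)
  have f : Computes program ω iFind (pair B (pair TF.enc (pair (num N) (num 0))))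
      (pair (num (TF.find B (N, [])).1) (ofVals (TF.values N B))) (280 * cost Z U 2) := by
    refine (computes_find B TF H.balF N).mono ?_
    calc _ ≤ (140 * Z) * (Z * (2 * U)) :=
          Nat.mul_le_mul (by omega) (Nat.mul_le_mul (by omega) (by omega))
      _ = _ := by simp only [cost]; ring
  have hv : ∀ A ∈ TF.values N B, A.toVals.length ≤ Z := by
    intro A hA
    obtain ⟨x, hx, -, rfl⟩ := Tree.mem_of_mem_values H.sortF hA
    have := H.val x hx
    omega
  have hw : ((TF.values N B).length + 1) * (80 * (Z + 1) + 60) ≤ 220 * (Z * Z) := by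
    have := TF.length_values_le N B
    calc _ ≤ Z * (220 * Z) := Nat.mul_le_mul (by omega) (by omega)
      _ = _ := by ring
  refine .of_wp rfl ?_
  simp [refreshC]
  refine ⟨_, _, f, ?_⟩
  simp
  refine ⟨_, _, computes_wit s (TF.values N B) [] s Z hv, ?_⟩
  cases h : witL s (TF.values N B) [] s with
  | nil =>
    simp
    refine ⟨_, _, computes_del' H.balW hW hZ hB, ?_⟩
    simp [Returns, refreshT, h]
    omega
  | cons a l =>
    simp
    refine ⟨_, _, computes_ins' H.balW hW hZ hB, ?_⟩
    simp [Returns, refreshT, h]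
    omega

theorem Sets.refresh {c : ℕ} (H : Sets M S c TF TW) (hW : TW.toList.length + (c + 1) ≤ M) (s : ℕ)
    (B : Val) : Sets M S c TF (refreshT N s TF TW B) := by
  unfold refreshT
  split_ifs
  · exact { H with
      balW := H.balW.del B
      sortW := H.sortW.del B
      lenW := by have := Tree.length_del_le H.sortW B; omega }
  · exact { H with
      balW := H.balW.ins _
      sortW := H.sortW.ins _
      lenW := by
        have := Tree.length_ins_le (pair B (ofVals (witL s (TF.values N B) [] s))) TW
        omega }

/-- Deleting a set also uses up one unit of room, because refreshing is only known to add at most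
one witness. -/
theorem Sets.del {c : ℕ} (H : Sets M S (c + 1) TF TW) (s : ℕ) (k B : Val) :
    Sets M S c (TF.del k) (refreshT N s (TF.del k) TW B) := by
  refine Sets.refresh ⟨H.balF.del k, H.balW, H.sortF.del k, H.sortW, ?_, ?_, ?_⟩ H.lenW s B
  · have := Tree.length_del_le H.sortF k
    have := H.lenF
    omega
  · have := H.lenW
    omega
  · exact fun x hx => H.val x ((Tree.mem_del H.sortF).1 hx).1

theorem Sets.ins {c : ℕ} (H : Sets M S (c + 1) TF TW) (s : ℕ) {kv : Val}
    (hkv : kv.snd.toVals.length ≤ S) (B : Val) :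
    Sets M S c (TF.ins kv) (refreshT N s (TF.ins kv) TW B) := by
  refine Sets.refresh ⟨H.balF.ins kv, H.balW, H.sortF.ins kv, H.sortW, ?_, ?_, ?_⟩ H.lenW s B
  · have := Tree.length_ins_le kv TF
    have := H.lenF
    omega
  · have := H.lenW
    omega
  · intro x hx
    rcases (Tree.mem_ins H.sortF).1 hx with rfl | hx
    exacts [hkv, H.val x hx.1]

theorem Sets.mono {c c' : ℕ} (H : Sets M S c TF TW) (h : c' ≤ c) : Sets M S c' TF TW :=
  { H with
    lenF := by have := H.lenF; omega
    lenW := by have := H.lenW; omega }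

/-- A list of `n` numbers has size `2 * n + 1`, and the boundary has at most `S * R` vertices;
together with the node of the pair this makes `2 * (S * R) + 2 * S + 3`. -/
theorem size_key (T : Tables Z U R S N TE TV) {A : List Val} (hA : ∀ e ∈ A, e.size = 1)
    (hl : A.length ≤ S) :
    (pair (ofVals (bdL (nbT N TV) (vsT TE) A)) (ofVals A)).size ≤ Z ∧
      (ofVals (bdL (nbT N TV) (vsT TE) A)).size ≤ Z := by
  have hb := (length_bdL_le (nbT N TV) (vsT TE) T.vs_len A).trans (Nat.mul_le_mul_right R hl)
  have := T.hS
  simp only [Val.size, size_ofVals hA, size_ofVals (size_bdL T.vs_size A)]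
  omega

/-- Time and room are treated together, since the time of a round depends on the heights of the
trees left by the previous rounds. -/
theorem computes_remAll (T : Tables Z U R S N TE TV)
    (hM : ∀ t : Tree, t.Balanced → t.toList.length ≤ M → t.ht < U) (s k c : ℕ)
    (cs : List (List Val)) (hcs : ∀ A ∈ cs, A.length ≤ S ∧ ∀ e ∈ A, e.size = 1)
    (H : Sets M S (c + cs.length) TF TW) :
    Computes program ω iRemAll (pair (ofVals (cs.map ofVals))
        (pair (encTb N TE TV) (pair (encPrm s k N) (pair TF.enc TW.enc))))
      (pair (remAllT N s TE TV cs TF TW).1.enc (remAllT N s TE TV cs TF TW).2.enc)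
      ((cs.length + 1) * (7000 * cost Z U 4)) ∧
    Sets M S c (remAllT N s TE TV cs TF TW).1 (remAllT N s TE TV cs TF TW).2 := by
  have hU := T.hU
  have hZ := T.hZ
  have c0 : 1 ≤ cost Z U 1 := hZ.trans (le_cost_one hU)
  have c1 : cost Z U 1 ≤ cost Z U 4 := cost_mono hZ (by norm_num)
  have c2 : cost Z U 2 ≤ cost Z U 4 := cost_mono hZ (by norm_num)
  induction cs generalizing TF TW with
  | nil =>
    refine ⟨.of_wp rfl ?_, by simpa [remAllT] using H⟩
    simp [remAllC, Returns, remAllT]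
    omega
  | cons A cs ih =>
    obtain ⟨h1, h2⟩ := hcs A (by simp)
    obtain ⟨k1, k2⟩ := size_key T h2 h1
    have hF := hM TF H.balF (by have := H.lenF; omega)
    have H' := Sets.del (N := N) H s (pair (ofVals (bdL (nbT N TV) (vsT TE) A)) (ofVals A))
      (ofVals (bdL (nbT N TV) (vsT TE) A))
    obtain ⟨ih1, ih2⟩ := ih (fun A hA => hcs A (by simp [hA])) H'
    refine ⟨.of_wp rfl ?_, by simpa [remAllT] using ih2⟩
    simp [remAllC]
    refine ⟨_, _, computes_bd T h2 h1, _, _, computes_del' H.balF hF hZ k1, _, _,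
      computes_refresh T (TW := TW) (c := 0) ⟨H.balF.del _, H.balW, H.sortF.del _, H.sortW, ?_, ?_, ?_⟩
        hM s k k2, _, _, ih1, ?_⟩
    · have := H'.lenF
      omega
    · have := H.lenW
      omega
    · exact H'.val
    · rw [Nat.succ_mul]
      simp [Returns, remAllT]
      omega

theorem computes_insAll (T : Tables Z U R S N TE TV)
    (hM : ∀ t : Tree, t.Balanced → t.toList.length ≤ M → t.ht < U) (s k c : ℕ)
    (cs : List (List Val)) (hcs : ∀ A ∈ cs, A.length ≤ S ∧ ∀ e ∈ A, e.size = 1)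
    (hω : ∀ A ∈ cs, allInL TE A = true → (ω (ofVals A)).2 ≤ U)
    (H : Sets M S (c + cs.length) TF TW) :
    Computes program ω iInsAll (pair (ofVals (cs.map ofVals))
        (pair (encTb N TE TV) (pair (encPrm s k N) (pair TF.enc TW.enc))))
      (pair (insAllT ω N s k TE TV cs TF TW).1.enc (insAllT ω N s k TE TV cs TF TW).2.enc)
      ((cs.length + 1) * (20000 * cost Z U 5)) ∧
    Sets M S c (insAllT ω N s k TE TV cs TF TW).1 (insAllT ω N s k TE TV cs TF TW).2 := by
  have hU := T.hU
  have hZ := T.hZ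
  have c0 : 1 ≤ cost Z U 1 := hZ.trans (le_cost_one hU)
  have c1 : cost Z U 1 ≤ cost Z U 5 := cost_mono hZ (by norm_num)
  have c2 : cost Z U 2 ≤ cost Z U 5 := cost_mono hZ (by norm_num)
  have c3 : cost Z U 4 ≤ cost Z U 5 := cost_mono hZ (by norm_num)
  induction cs generalizing TF TW with
  | nil =>
    refine ⟨.of_wp rfl ?_, by simpa [insAllT] using H⟩
    simp [insAllC, Returns, insAllT]
    omega
  | cons A cs ih =>
    obtain ⟨h1, h2⟩ := hcs A (by simp)
    obtain ⟨k1, k2⟩ := size_key T h2 h1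
    have hF := hM TF H.balF (by have := H.lenF; omega)
    have hq := computes_qual T k h2 h1 (hω A (by simp))
    have ih := @ih
    by_cases h : qualL ω N k TE TV A = true
    · have H' := Sets.ins (N := N) H s
        (kv := pair (pair (ofVals (bdL (nbT N TV) (vsT TE) A)) (ofVals A)) (ofVals A))
        (by simpa using h1) (ofVals (bdL (nbT N TV) (vsT TE) A))
      obtain ⟨ih1, ih2⟩ := ih (fun A hA => hcs A (by simp [hA]))
        (fun A hA => hω A (by simp [hA])) H'
      refine ⟨.of_wp rfl ?_, by simpa [insAllT, h] using ih2⟩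
      simp [insAllC]
      refine ⟨_, _, computes_bd T h2 h1, _, _, hq, ?_⟩
      simp [h]
      refine ⟨_, _, computes_ins' H.balF hF hZ k1, _, _,
        computes_refresh T (TW := TW) (c := 0)
          ⟨H.balF.ins _, H.balW, H.sortF.ins _, H.sortW, ?_, ?_, ?_⟩ hM s k k2, _, _, ih1, ?_⟩
      · have := H'.lenF
        omega
      · have := H.lenW
        omega
      · exact H'.val
      · rw [Nat.succ_mul]
        simp [Returns, insAllT, h]
        omega
    · obtain ⟨ih1, ih2⟩ := ih (TF := TF) (TW := TW) (fun A hA => hcs A (by simp [hA]))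
        (fun A hA => hω A (by simp [hA])) (H.mono (by simp))
      refine ⟨.of_wp rfl ?_, by simpa [insAllT, h] using ih2⟩
      simp [insAllC]
      refine ⟨_, _, computes_bd T h2 h1, _, _, hq, ?_⟩
      simp [h]
      refine ⟨_, _, ih1, ?_⟩
      rw [Nat.succ_mul]
      simp [Returns, insAllT, h]
      omega

theorem balanced_addIncT {e : Val} {X : List Val} (h : TV.Balanced) :
    (addIncT e X TV).Balanced := by
  induction X generalizing TV with
  | nil => exact h
  | cons v X ih => exact ih (h.ins _)

theorem balanced_delIncT {e : Val} {X : List Val} (h : TV.Balanced) :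
    (delIncT e X TV).Balanced := by
  induction X generalizing TV with
  | nil => exact h
  | cons v X ih => exact ih (h.del _)

theorem sorted_addIncT {e : Val} {X : List Val} (h : TV.Sorted) : (addIncT e X TV).Sorted := by
  induction X generalizing TV with
  | nil => exact h
  | cons v X ih => exact ih (h.ins _)

theorem sorted_delIncT {e : Val} {X : List Val} (h : TV.Sorted) : (delIncT e X TV).Sorted := by
  induction X generalizing TV with
  | nil => exact h
  | cons v X ih => exact ih (h.del _)

theorem computes_addInc (hZ : 3 ≤ Z) (hU : 1 ≤ U)
    (hM : ∀ t : Tree, t.Balanced → t.toList.length ≤ M → t.ht < U) (X : Val) {e : Val}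
    (he : e.size = 1) (hX : ∀ v ∈ X.toVals, v.size = 1) (hV : TV.Balanced)
    (hl : TV.toList.length + X.toVals.length ≤ M) :
    Computes program ω iAddInc (pair X (pair e TV.enc)) (addIncT e X.toVals TV).enc
      ((X.toVals.length + 1) * (400 * cost Z U 1)) := by
  have c0 : 1 ≤ cost Z U 1 := le_trans (by omega) (le_cost_one (Z := Z) hU)
  induction X generalizing TV with
  | num n =>
    refine .of_wp rfl ?_
    simp [addIncC, Returns, addIncT]
    omega
  | pair v X _ ih =>
    simp at hl
    refine .of_wp rfl ?_
    have hv := hX v (by simp)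
    have := Tree.length_ins_le (pair (pair v e) e) TV
    simp [addIncC]
    refine ⟨_, _, computes_ins' hV (hM TV hV (by omega)) (Z := Z) (by omega)
      (by simp [Val.size]; omega), _, _, ih (fun w hw => hX w (by simp [hw])) (hV.ins _) (by omega), ?_⟩
    rw [Nat.succ_mul]
    simp [Returns, addIncT]
    omega

theorem computes_delInc (hZ : 3 ≤ Z) (hU : 1 ≤ U)
    (hM : ∀ t : Tree, t.Balanced → t.toList.length ≤ M → t.ht < U) (X : Val) {e : Val}
    (he : e.size = 1) (hX : ∀ v ∈ X.toVals, v.size = 1) (hV : TV.Balanced) (hs : TV.Sorted)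
    (hl : TV.toList.length ≤ M) :
    Computes program ω iDelInc (pair X (pair e TV.enc)) (delIncT e X.toVals TV).enc
      ((X.toVals.length + 1) * (700 * cost Z U 1)) := by
  have c0 : 1 ≤ cost Z U 1 := le_trans (by omega) (le_cost_one (Z := Z) hU)
  induction X generalizing TV with
  | num n =>
    refine .of_wp rfl ?_
    simp [delIncC, Returns, delIncT]
    omega
  | pair v X _ ih =>
    refine .of_wp rfl ?_
    have hv := hX v (by simp)
    have := Tree.length_del_le hs (pair v e)
    simp [delIncC]
    refine ⟨_, _, computes_del' hV (hM TV hV (by omega)) (Z := Z) (by omega)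
      (by simp [Val.size]; omega), _, _,
      ih (fun w hw => hX w (by simp [hw])) (hV.del _) (hs.del _) (by omega), ?_⟩
    rw [Nat.succ_mul]
    simp [Returns, delIncT]
    omega

theorem mem_candidates_size (T : Tables Z U R S N TE TV) (hNS : N = S + 1) {e : Val}
    (he : e.size = 1) : ∀ A ∈ candidates N TE TV e, A.length ≤ S ∧ ∀ e ∈ A, e.size = 1 := by
  intro A hA
  obtain ⟨h1, h2⟩ := mem_sublL_nil.1 hA
  refine ⟨by omega, fun f hf => ?_⟩
  exact size_ballL (n := N - 1) (L := [e]) T.nb_size (by simpa using he) f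
    (h1.subset (by simpa using hf))

/-- The trees of sets and witnesses after an update. -/
def updT (ω : Val → Bool × ℕ) (N s k : ℕ) (cs : List (List Val)) (TE TV TE' TV' TF TW : Tree) :
    Tree × Tree :=
  insAllT ω N s k TE' TV' cs (remAllT N s TE TV cs TF TW).1 (remAllT N s TE TV cs TF TW).2

/-- The ball has at most `(1 + R * N) ^ S` elements, so `Z` exceeds the number of its subsets and
bounds both loops over candidates. The room `Z + Z` is one unit for each removal and one for each
insertion. The highest exponent, `6`, comes from the insertion loop around the test of a candidate.
-/
theorem computes_upd {TE₁ TV₁ TE₂ TV₂ TE₃ TV₃ : Tree} (T₁ : Tables Z U R S N TE₁ TV₁)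
    (T₂ : Tables Z U R S N TE₂ TV₂) (T₃ : Tables Z U R S N TE₃ TV₃) (hNS : N = S + 1)
    (hM : ∀ t : Tree, t.Balanced → t.toList.length ≤ M → t.ht < U)
    (hZ : 2 ^ ((1 + R * N) ^ S + 1) ≤ Z) (s k : ℕ) {e : Val} (he : e.size = 1)
    (hω : ∀ A ∈ candidates N TE₁ TV₁ e, allInL TE₃ A = true → (ω (ofVals A)).2 ≤ U)
    (H : Sets M S (Z + Z) TF TW) :
    Computes program ω iUpd
      (pair e (pair (encTb N TE₁ TV₁) (pair (encTb N TE₂ TV₂) (pair (encTb N TE₃ TV₃)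
        (pair (encPrm s k N) (pair TF.enc TW.enc))))))
      (pair (updT ω N s k (candidates N TE₁ TV₁ e) TE₂ TV₂ TE₃ TV₃ TF TW).1.enc
        (updT ω N s k (candidates N TE₁ TV₁ e) TE₂ TV₂ TE₃ TV₃ TF TW).2.enc)
      (70000 * cost Z U 6) ∧
    Sets M S 0 (updT ω N s k (candidates N TE₁ TV₁ e) TE₂ TV₂ TE₃ TV₃ TF TW).1
      (updT ω N s k (candidates N TE₁ TV₁ e) TE₂ TV₂ TE₃ TV₃ TF TW).2 := by
  have hU := T₁.hU
  have hZ1 := T₁.hZ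
  have c0 : 1 ≤ cost Z U 1 := hZ1.trans (le_cost_one hU)
  have c1 : cost Z U 1 ≤ cost Z U 6 := cost_mono hZ1 (by norm_num)
  have c2 : cost Z U 5 ≤ cost Z U 6 := cost_mono hZ1 (by norm_num)
  have c3 := le_cost_one (Z := Z) hU
  have hS := T₁.hS
  have hN1 : N - 1 = S := by omega
  have hcs := mem_candidates_size T₁ hNS he
  have hb : (ballL (nbT N TV₁) (vsT TE₁) (N - 1) [e]).length ≤ (1 + R * N) ^ S := by
    have := length_ballL_le (nbT N TV₁) (vsT TE₁) (TV₁.length_values_le N) T₁.vs_len (N - 1) [e]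
    rw [hN1] at this ⊢
    simpa using this
  have hp : 2 ^ ((ballL (nbT N TV₁) (vsT TE₁) (N - 1) [e]).length + 1) ≤ Z :=
    (Nat.pow_le_pow_right (by norm_num) (by omega)).trans hZ
  have hcl : (candidates N TE₁ TV₁ e).length ≤ Z := by
    have h1 := length_sublL_le (ballL (nbT N TV₁) (vsT TE₁) (N - 1) [e]) (N - 1) [] []
    simp only [List.length_nil, pow_succ] at h1 hp
    simp only [candidates]
    omega
  have hq : (1 + R * N) ^ S ≤ Z :=
    ((Nat.lt_two_pow_self).le.trans (Nat.pow_le_pow_right (by norm_num) (by omega))).trans hZ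
  have hit := computes_iter (ω := ω) T₁ (N - 1) [e] (by simpa using he)
    (by rw [hN1]; simpa using hq)
  have hit' : (N - 1 + 1) * (3300 * cost Z U 4) ≤ 6600 * cost Z U 5 :=
    loop_le hZ1 (by omega)
  obtain ⟨r1, r2⟩ := computes_remAll (ω := ω) T₂ hM s k Z _ hcs
    (H.mono (Nat.add_le_add_left hcl Z))
  obtain ⟨i1, i2⟩ := computes_insAll T₃ hM s k 0 _ hcs hω (r2.mono (by simpa using hcl))
  have r3 : ((candidates N TE₁ TV₁ e).length + 1) * (7000 * cost Z U 4) ≤ 14000 * cost Z U 5 :=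
    loop_le hZ1 hcl
  have i3 : ((candidates N TE₁ TV₁ e).length + 1) * (20000 * cost Z U 5) ≤ 40000 * cost Z U 6 :=
    loop_le hZ1 hcl
  refine ⟨.of_wp rfl ?_, i2⟩
  simp [updC]
  refine ⟨_, _, hit, ?_⟩
  refine ⟨_, _, computes_subl _ (N - 1) [] [], _, _, r1, _, _, i1, ?_⟩
  simp [Returns, updT]
  omega

end Simulation
end DynLocalSearch

namespace DynLocalSearch

/-! ### Internally connected sets -/

namespace Hypergraph

variable {G H K : Hypergraph} {A B C : Finset ℕ}

theorem mem_bd {v : ℕ} :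
    v ∈ G.bd A ↔ (∃ e ∈ A, v ∈ G.inc e) ∧ ∃ f ∈ G.edges, f ∉ A ∧ v ∈ G.inc f := by
  simp [bd, vertsOf, and_assoc]

/-- A set of hyperedges with a non-trivial part whose boundary is in its boundary is not internally
connected. -/
theorem InternallyConnected.not_bd_subset (h : G.InternallyConnected A) (hB : B ⊆ A)
    (h0 : B.Nonempty) (h1 : ∃ x ∈ A, x ∉ B) : ¬ G.bd B ⊆ G.bd A := by
  intro hbd
  obtain ⟨x, hx, hx'⟩ := h1
  refine h.2.2 ⟨B, A \ B, h0, ⟨x, by simp [hx, hx']⟩, Finset.union_sdiff_of_subset hB,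
    Finset.disjoint_sdiff, hbd, ?_⟩
  -- It remains to see that `A \ B` has its boundary in `bd A`, too. A vertex that it shares with a
  -- hyperedge outside of `A` is in `bd A` directly, and one that it shares with `B` is in `bd B`.
  intro v hv
  obtain ⟨⟨e, he, hve⟩, f, hf, hfA, hvf⟩ := mem_bd.1 hv
  rw [Finset.mem_sdiff] at he hfA
  by_cases hf' : f ∈ A
  · have hfB : f ∈ B := by tauto
    exact hbd (mem_bd.2 ⟨⟨f, hfB, hvf⟩, e, h.1 he.1, he.2, hve⟩)
  · exact mem_bd.2 ⟨⟨e, he.1, hve⟩, f, hf, hf', hvf⟩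

/-- One part of every bipartition avoids `a`. This is why the program only tests subsets of the tail
of a list. -/
theorem internallyConnected_of_forall {a : ℕ} (hA : A ⊆ G.edges) (ha : a ∈ A)
    (h : ∀ B ⊆ A, B.Nonempty → a ∉ B → ¬ G.bd B ⊆ G.bd A) : G.InternallyConnected A := by
  refine ⟨hA, ⟨a, ha⟩, ?_⟩
  rintro ⟨B₁, B₂, h1, h2, rfl, hd, hb1, hb2⟩
  by_cases ha1 : a ∈ B₁
  · exact h B₂ Finset.subset_union_right h2 (Finset.disjoint_left.1 hd ha1) hb2
  · exact h B₁ Finset.subset_union_left h1 ha1 hb1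

theorem internallyConnected_singleton {a : ℕ} (ha : a ∈ G.edges) :
    G.InternallyConnected {a} := by
  refine internallyConnected_of_forall (a := a) (by simpa using ha) (by simp) ?_
  intro B hB h0 haB
  rcases Finset.subset_singleton_iff.1 hB with rfl | rfl
  · simp at h0
  · simp at haB

/-- Two internally connected sets with the same boundary are equal or disjoint. -/
theorem InternallyConnected.subset_of_inter (hA : G.InternallyConnected A)
    (hbd : G.bd C ⊆ G.bd A) (h : (A ∩ C).Nonempty) : A ⊆ C := by
  by_contra hs
  obtain ⟨x, hx, hx'⟩ := Finset.not_subset.1 hs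
  -- Otherwise `A ∩ C` splits `A`: a vertex that it shares with the rest of `A` belongs to `bd C`,
  -- hence to `bd A`.
  refine hA.not_bd_subset Finset.inter_subset_left h ⟨x, hx, by simp [hx']⟩ ?_
  intro v hv
  obtain ⟨⟨e, he, hve⟩, f, hf, hfA, hvf⟩ := mem_bd.1 hv
  rw [Finset.mem_inter] at he hfA
  by_cases hf' : f ∈ A
  · exact hbd (mem_bd.2 ⟨⟨e, he.2, hve⟩, f, hf, by tauto, hvf⟩)
  · exact mem_bd.2 ⟨⟨e, he.1, hve⟩, f, hf, hf', hvf⟩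

theorem InternallyConnected.eq_of_inter (hA : G.InternallyConnected A)
    (hC : G.InternallyConnected C) (hbd : G.bd A = G.bd C) (h : (A ∩ C).Nonempty) : A = C :=
  Finset.Subset.antisymm (hA.subset_of_inter hbd.ge h)
    (hC.subset_of_inter hbd.le (by rwa [Finset.inter_comm]))

/-- The union of some internally connected sets with boundary `B`, not all unless there is only
one, has boundary `B` and these sets as internal components. -/
theorem components_biUnion {F : Finset (Finset ℕ)} (hF : F.Nonempty)
    (h : ∀ A ∈ F, G.InternallyConnected A ∧ G.bd A = B)
    (h' : (∃ A, F = {A}) ∨ ∃ A, G.InternallyConnected A ∧ G.bd A = B ∧ A ∉ F) :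
    G.bd (F.biUnion id) = B ∧ ∀ C', G.IsInternalComponent (F.biUnion id) C' → C' ∈ F := by
  have hdis : ∀ A ∈ F, ∀ A', G.InternallyConnected A' → G.bd A' = B → A' ∉ F →
      ∀ f ∈ A', f ∉ A := by
    intro A hA A' h1 h2 h3 f hf hf'
    have := (h A hA).1.eq_of_inter h1 ((h A hA).2.trans h2.symm) ⟨f, by simp [hf, hf']⟩
    exact h3 (this ▸ hA)
  have hbd : G.bd (F.biUnion id) = B := by
    apply Finset.Subset.antisymm
    · intro v hv
      obtain ⟨⟨e, he, hve⟩, f, hf, hfA, hvf⟩ := mem_bd.1 hv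
      simp only [Finset.mem_biUnion, id] at he hfA
      obtain ⟨A, hA, heA⟩ := he
      rw [← (h A hA).2]
      exact mem_bd.2 ⟨⟨e, heA, hve⟩, f, hf, fun hh => hfA ⟨A, hA, hh⟩, hvf⟩
    -- A vertex of `B` must also be seen outside of the union. A set `A'` with boundary `B` that is
    -- left out is disjoint from all members of `F` and has a hyperedge at every such vertex.
    · rcases h' with ⟨A, rfl⟩ | ⟨A', h1, h2, h3⟩
      · simpa using (h A (by simp)).2.ge
      · intro v hv
        obtain ⟨A, hA⟩ := hF
        have hv1 := hv
        rw [← (h A hA).2] at hv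
        rw [← h2] at hv1
        obtain ⟨⟨e, he, hve⟩, -⟩ := mem_bd.1 hv
        obtain ⟨⟨f, hf, hvf⟩, -⟩ := mem_bd.1 hv1
        refine mem_bd.2 ⟨⟨e, Finset.mem_biUnion.2 ⟨A, hA, he⟩, hve⟩, f, h1.1 hf, ?_, hvf⟩
        intro hh
        obtain ⟨A₂, hA₂, hf₂⟩ := Finset.mem_biUnion.1 hh
        exact hdis A₂ hA₂ A' h1 h2 h3 f hf hf₂
  refine ⟨hbd, fun C' hC' => ?_⟩
  obtain ⟨⟨hsub, hic⟩, hmax⟩ := hC'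
  obtain ⟨c, hc⟩ := hic.2.1
  obtain ⟨A, hA, hcA⟩ := Finset.mem_biUnion.1 (hsub hc)
  simp only [id] at hcA
  have hAC : A ⊆ F.biUnion id := fun x hx => Finset.mem_biUnion.2 ⟨A, hA, hx⟩
  -- Otherwise `C' ∩ A` splits `C'`: a vertex that it shares with the rest of `C'` is in `bd A = B`,
  -- so it meets a hyperedge outside of the whole union and is in `bd C'`.
  have hCA : C' ⊆ A := by
    by_contra hs
    obtain ⟨x, hx, hx'⟩ := Finset.not_subset.1 hs
    refine hic.not_bd_subset (B := C' ∩ A) Finset.inter_subset_left ⟨c, by simp [hc, hcA]⟩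
      ⟨x, hx, by simp [hx']⟩ ?_
    intro v hv
    obtain ⟨⟨e, he, hve⟩, f, hf, hfA, hvf⟩ := mem_bd.1 hv
    rw [Finset.mem_inter] at he hfA
    by_cases hf' : f ∈ C'
    · have : v ∈ G.bd A := mem_bd.2 ⟨⟨e, he.2, hve⟩, f, hf, by tauto, hvf⟩
      rw [(h A hA).2, ← hbd] at this
      obtain ⟨-, g, hg, hgC, hvg⟩ := mem_bd.1 this
      exact mem_bd.2 ⟨⟨e, he.1, hve⟩, g, hg, fun hh => hgC (hsub hh), hvg⟩
    · exact mem_bd.2 ⟨⟨e, he.1, hve⟩, f, hf, hf', hvf⟩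
  have : A ⊆ C' := hmax ⟨hAC, (h A hA).1⟩ hCA
  rwa [Finset.Subset.antisymm hCA this]

/-- Singletons are internally connected, so every element lies below a maximal internally connected
subset. -/
theorem exists_component {c : ℕ} (hC : C ⊆ G.edges) (hc : c ∈ C) :
    ∃ C', G.IsInternalComponent C C' ∧ c ∈ C' := by
  have hfin : {A : Finset ℕ | A ⊆ C ∧ G.InternallyConnected A}.Finite :=
    (C.powerset.finite_toSet).subset fun A hA => by simpa using hA.1
  obtain ⟨C', h1, h2⟩ := hfin.exists_le_maximal (a := {c})
    ⟨by simpa using hc, internallyConnected_singleton (hC hc)⟩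
  exact ⟨C', h2, h1 (by simp)⟩

/-! ### Locality -/

/-- `K` arises from `H` by deleting the hyperedge `e`. -/
structure IsDeletion (H K : Hypergraph) (e : ℕ) : Prop where
  mem : e ∈ H.edges
  edges : K.edges = H.edges.erase e
  inc : ∀ f, f ≠ e → K.inc f = H.inc f

theorem IsDeletion.mem_bd {e v : ℕ} (h : IsDeletion H K e) (hA : A ⊆ K.edges) :
    v ∈ H.bd A ↔ v ∈ K.bd A ∨ ((∃ f ∈ A, v ∈ K.inc f) ∧ v ∈ H.inc e) := by
  have hne : ∀ f ∈ A, f ≠ e := fun f hf => by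
    have := hA hf
    rw [h.edges] at this
    exact Finset.ne_of_mem_erase this
  have h1 : (∃ f ∈ A, v ∈ H.inc f) ↔ ∃ f ∈ A, v ∈ K.inc f := by
    refine exists_congr fun f => and_congr_right fun hf => ?_
    rw [h.inc f (hne f hf)]
  rw [Hypergraph.mem_bd, Hypergraph.mem_bd, h1, ← and_or_left]
  refine and_congr_right fun _ => ⟨?_, ?_⟩
  · rintro ⟨f, hf, hfA, hv⟩
    by_cases hfe : f = e
    · subst hfe
      exact .inr hv
    · exact .inl ⟨f, by rw [h.edges]; exact Finset.mem_erase.2 ⟨hfe, hf⟩, hfA, by rwa [h.inc f hfe]⟩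
  · rintro (⟨f, hf, hfA, hv⟩ | hv)
    · rw [h.edges, Finset.mem_erase] at hf
      exact ⟨f, hf.2, hfA, by rwa [← h.inc f hf.1]⟩
    · exact ⟨e, h.mem, fun hh => hne e hh rfl, hv⟩

theorem IsDeletion.bd_eq {e : ℕ} (h : IsDeletion H K e) (hA : A ⊆ K.edges)
    (hv : ∀ v ∈ H.inc e, (∃ f ∈ A, v ∈ K.inc f) → v ∈ K.bd A) : H.bd A = K.bd A := by
  ext v
  rw [h.mem_bd hA]
  constructor
  · rintro (h1 | ⟨h1, h2⟩)
    exacts [h1, hv v h2 h1]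
  · exact .inl

/-- By `hv`, the hyperedge `e` touches `A` only in vertices of `bd A`. It may enlarge the boundary
of a part of `A`, but only by such vertices, which does not affect whether that boundary is
contained in `bd A`. -/
theorem IsDeletion.internallyConnected_iff {e : ℕ} (h : IsDeletion H K e) (hA : A ⊆ K.edges)
    (hv : ∀ v ∈ H.inc e, (∃ f ∈ A, v ∈ K.inc f) → v ∈ K.bd A) :
    H.InternallyConnected A ↔ K.InternallyConnected A := by
  have hbd := h.bd_eq hA hv
  have hAH : A ⊆ H.edges := fun f hf => by
    have := hA hf
    rw [h.edges] at this
    exact Finset.mem_of_mem_erase this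
  have key : ∀ B ⊆ A, H.bd B ⊆ H.bd A ↔ K.bd B ⊆ K.bd A := by
    intro B hB
    rw [hbd]
    constructor
    · intro h1 v hv
      exact h1 ((h.mem_bd (hB.trans hA)).2 (.inl hv))
    · intro h1 v hv'
      rcases (h.mem_bd (hB.trans hA)).1 hv' with h2 | ⟨⟨f, hf, hvf⟩, h3⟩
      exacts [h1 h2, hv v h3 ⟨f, hB hf, hvf⟩]
  unfold InternallyConnected
  simp only [hA, hAH, true_and]
  refine and_congr_right fun _ => not_congr ?_
  refine exists_congr fun B₁ => exists_congr fun B₂ => and_congr_right fun _ =>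
    and_congr_right fun _ => and_congr_right fun h1 => and_congr_right fun _ => ?_
  rw [key B₁ (h1 ▸ Finset.subset_union_left), key B₂ (h1 ▸ Finset.subset_union_right)]

/-- A growing family of sets of hyperedges, each of which contains the neighbours of the previous
one through vertices of degree at most `s + 1`. -/
structure IsBall (H : Hypergraph) (e s : ℕ) (ball : ℕ → Finset ℕ) : Prop where
  mem : e ∈ ball 0
  mono : ∀ i, ball i ⊆ ball (i + 1)
  step : ∀ i, ∀ f ∈ ball i, f ∈ H.edges → ∀ v ∈ H.inc f,
    (H.edges.filter fun g => v ∈ H.inc g).card ≤ s + 1 → ∀ g ∈ H.edges, v ∈ H.inc g → g ∈ ball (i + 1)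

variable {e s : ℕ} {ball : ℕ → Finset ℕ}

/-- While `A ∩ ball i` is a proper part of `A`, connectedness yields a vertex of its boundary
outside of `bd A`. All hyperedges of `G` there lie in `A`, so the degree is small and the next ball
gains an element of `A`. Starting with one element at `i = 1`, all of `A` is reached at `i = s`.
Here `G` stands for either of the two hypergraphs of an update, and `H` for the larger one. -/
theorem IsBall.subset (hb : IsBall H e s ball) (hG : G.edges ⊆ H.edges)
    (hG' : H.edges ⊆ insert e G.edges) (hi : ∀ f ∈ G.edges, G.inc f = H.inc f)
    (hA : G.InternallyConnected A) (hs : A.card ≤ s) (h1 : (A ∩ ball 1).Nonempty) :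
    A ⊆ ball s := by
  have hpos : 1 ≤ s := (Finset.card_pos.2 hA.2.1).trans_le hs
  have key : ∀ i, 1 ≤ i → A ⊆ ball i ∨ i ≤ (A ∩ ball i).card := by
    intro i hi1
    induction i, hi1 using Nat.le_induction with
    | base => exact .inr (Finset.card_pos.2 h1)
    | succ i hi1 ih =>
      rcases ih with ih | ih
      · exact .inl (ih.trans (hb.mono i))
      by_cases hsub : A ⊆ ball i
      · exact .inl (hsub.trans (hb.mono i))
      right
      obtain ⟨x, hx, hx'⟩ := Finset.not_subset.1 hsub
      have hne : (A ∩ ball i).Nonempty := Finset.card_pos.1 (by omega)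
      obtain ⟨v, hv, hv'⟩ := Finset.not_subset.1
        (hA.not_bd_subset Finset.inter_subset_left hne ⟨x, hx, by simp [hx']⟩)
      obtain ⟨⟨g, hg, hvg⟩, f, hf, hfA, hvf⟩ := mem_bd.1 hv
      rw [Finset.mem_inter] at hg
      have hall : ∀ f ∈ G.edges, v ∈ G.inc f → f ∈ A := by
        intro f hf hvf
        by_contra hfA
        exact hv' (mem_bd.2 ⟨⟨g, hg.1, hvg⟩, f, hf, hfA, hvf⟩)
      have hfA' := hall f hf hvf
      -- Degrees are counted in `H`, where `e` may be incident although it is missing in `G`; this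
      -- accounts for the `+ 1`.
      have hdeg : (H.edges.filter fun g => v ∈ H.inc g).card ≤ s + 1 := by
        have : (H.edges.filter fun g => v ∈ H.inc g) ⊆ insert e A := by
          intro f hf
          rw [Finset.mem_filter] at hf
          rcases Finset.mem_insert.1 (hG' hf.1) with rfl | hfG
          · simp
          · exact Finset.mem_insert_of_mem (hall f hfG (by rw [hi f hfG]; exact hf.2))
        exact (Finset.card_le_card this).trans ((Finset.card_insert_le _ _).trans (by omega))
      have hgG := hA.1 hg.1
      have hfb : f ∈ ball (i + 1) := hb.step i g hg.2 (hG hgG) v (by rwa [← hi g hgG]) hdeg f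
        (hG hf) (by rwa [← hi f hf])
      refine lt_of_le_of_lt ih (Finset.card_lt_card ?_)
      refine ⟨Finset.inter_subset_inter_left (hb.mono i), fun hh => hfA (hh ?_)⟩
      exact Finset.mem_inter.2 ⟨hfA', hfb⟩
  rcases key s hpos with h | h
  · exact h
  · have : A ∩ ball s = A := Finset.eq_of_subset_of_card_le Finset.inter_subset_left (hs.trans h)
    rw [← this]
    exact Finset.inter_subset_right

/-- Outside of the ball, nothing changes. -/
theorem IsDeletion.local (h : IsDeletion H K e) (hb : IsBall H e s ball) (hs : A.card ≤ s)
    (hA : ¬ A ⊆ ball s) (hc : H.InternallyConnected A ∨ K.InternallyConnected A) :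
    e ∉ A ∧ A ⊆ K.edges ∧ H.bd A = K.bd A ∧ (H.InternallyConnected A ↔ K.InternallyConnected A) := by
  have hKH : K.edges ⊆ H.edges := by rw [h.edges]; exact Finset.erase_subset _ _
  have hHK : H.edges ⊆ insert e K.edges := by
    rw [h.edges]
    intro f hf
    by_cases hfe : f = e <;> simp [hfe, hf]
  have hinc : ∀ f ∈ K.edges, K.inc f = H.inc f := fun f hf => by
    rw [h.edges] at hf
    exact h.inc f (Finset.ne_of_mem_erase hf)
  -- A set that is not swallowed by `ball s` does not even meet `ball 1`.
  have hdis : ∀ x ∈ A, x ∉ ball 1 := by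
    intro x hx hx'
    have hne : (A ∩ ball 1).Nonempty := ⟨x, by simp [hx, hx']⟩
    rcases hc with hc | hc
    · exact hA (hb.subset (fun _ h => h) (fun f hf => Finset.mem_insert_of_mem hf)
        (fun _ _ => rfl) hc hs hne)
    · exact hA (hb.subset hKH hHK hinc hc hs hne)
  have heA : e ∉ A := fun he => hdis e he (hb.mono 0 hb.mem)
  have hAK : A ⊆ K.edges := by
    rcases hc with hc | hc
    · intro f hf
      rw [h.edges]
      exact Finset.mem_erase.2 ⟨fun hfe => heA (hfe ▸ hf), hc.1 hf⟩
    · exact hc.1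
  -- If `v` were not in the boundary of `A`, its hyperedges other than `e` would all lie in `A`.
  -- Then `v` has small degree, and `ball 1` contains a member of `A` adjacent to `e` through `v`.
  have hv : ∀ v ∈ H.inc e, (∃ f ∈ A, v ∈ K.inc f) → v ∈ K.bd A := by
    rintro v hve ⟨f, hf, hvf⟩
    by_contra hbd
    have hall : ∀ f ∈ K.edges, v ∈ K.inc f → f ∈ A := by
      intro g hg hvg
      by_contra hgA
      exact hbd (Hypergraph.mem_bd.2 ⟨⟨f, hf, hvf⟩, g, hg, hgA, hvg⟩)
    have hdeg : (H.edges.filter fun g => v ∈ H.inc g).card ≤ s + 1 := by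
      have : (H.edges.filter fun g => v ∈ H.inc g) ⊆ insert e A := by
        intro f hf
        rw [Finset.mem_filter] at hf
        rcases Finset.mem_insert.1 (hHK hf.1) with rfl | hfG
        · simp
        · exact Finset.mem_insert_of_mem (hall f hfG (by rw [hinc f hfG]; exact hf.2))
      exact (Finset.card_le_card this).trans ((Finset.card_insert_le _ _).trans (by omega))
    have hfK := hAK hf
    exact hdis f hf (hb.step 0 e hb.mem h.mem v hve hdeg f (hKH hfK) (by rwa [← hinc f hfK]))
  exact ⟨heA, hAK, h.bd_eq hAK hv, h.internallyConnected_iff hAK hv⟩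

end Hypergraph
end DynLocalSearch

namespace DynLocalSearch
open Val

/-! ### Lists of numbers -/

/-- A list of numbers as a list of values. -/
abbrev nums (l : List ℕ) : List Val := l.map num

theorem num_injective : Function.Injective num := fun _ _ h => by simpa using h

theorem nums_injective : Function.Injective nums := List.map_injective_iff.2 num_injective

theorem ofVals_injective : Function.Injective ofVals := fun l l' h => by
  simpa using congrArg toVals h

theorem ofList_eq (l : List ℕ) : Val.ofList l = ofVals (nums l) := by
  induction l with
  | nil => rfl
  | cons a l ih => simp [Val.ofList, ih]

theorem memL_nums {x : ℕ} {l : List ℕ} : memL (num x) (nums l) = true ↔ x ∈ l := by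
  simp only [memL, List.any_map, List.any_eq_true, Function.comp, same, lt_num]
  constructor
  · rintro ⟨y, hy, h⟩
    simp at h
    rwa [show x = y by omega]
  · intro h
    exact ⟨x, h, by simp⟩

theorem subL_nums {l l' : List ℕ} : subL (nums l) (nums l') = true ↔ ∀ x ∈ l, x ∈ l' := by
  simp [subL, memL_nums]

/-- The elements in decreasing order. -/
def desc (S : Finset ℕ) : List ℕ := S.sort (· ≥ ·)

@[simp] theorem mem_desc {S : Finset ℕ} {x : ℕ} : x ∈ desc S ↔ x ∈ S := by simp [desc]

@[simp] theorem toFinset_desc (S : Finset ℕ) : (desc S).toFinset = S := by simp [desc]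

@[simp] theorem length_desc (S : Finset ℕ) : (desc S).length = S.card := by simp [desc]

theorem desc_nodup (S : Finset ℕ) : (desc S).Nodup := by simp [desc]

theorem desc_pairwise (S : Finset ℕ) : (desc S).Pairwise (· > ·) :=
  (Finset.sortedGT_sort S).pairwise

theorem desc_injective : Function.Injective desc := fun S T h => by
  simpa using congrArg List.toFinset h

/-- A strictly decreasing list is determined by its set, so boundaries can be compared as keys and
grouping by key is grouping by boundary. -/
theorem eq_desc {l : List ℕ} (h : l.Pairwise (· > ·)) {S : Finset ℕ} (hS : ∀ x, x ∈ l ↔ x ∈ S) :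
    l = desc S := by
  have h1 : l.toFinset = S := by ext x; simp [hS]
  have h2 : l.Nodup := h.imp fun h => ne_of_gt h
  rw [← h1, desc, (List.toFinset_sort (r := (· ≥ ·)) h2).2 (h.imp fun h => le_of_lt h)]

theorem desc_sublist {S T : Finset ℕ} (h : S ⊆ T) : (desc S).Sublist (desc T) := by
  have : (desc T).filter (· ∈ S) = desc S :=
    eq_desc ((desc_pairwise T).filter _) fun x => by
      simp only [List.mem_filter, mem_desc, decide_eq_true_eq]
      exact ⟨fun h => h.2, fun hx => ⟨h hx, hx⟩⟩
  rw [← this]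
  exact List.filter_sublist

/-- The elements in increasing order. -/
def asc (S : Finset ℕ) : List ℕ := (desc S).reverse

@[simp] theorem mem_asc {S : Finset ℕ} {x : ℕ} : x ∈ asc S ↔ x ∈ S := by simp [asc]
@[simp] theorem toFinset_asc (S : Finset ℕ) : (asc S).toFinset = S := by simp [asc]
@[simp] theorem length_asc (S : Finset ℕ) : (asc S).length = S.card := by simp [asc]
theorem asc_nodup (S : Finset ℕ) : (asc S).Nodup := by simpa [asc] using desc_nodup S
theorem asc_injective : Function.Injective asc := fun S T h => by
  simpa using congrArg List.toFinset h

theorem sins_nums (x : ℕ) {l : List ℕ} (hl : l.Pairwise (· > ·)) :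
    ∃ l', sins (num x) (nums l) = nums l' ∧ l'.Pairwise (· > ·) ∧ ∀ y, y ∈ l' ↔ y = x ∨ y ∈ l := by
  induction l with
  | nil => exact ⟨[x], by simp [sins]⟩
  | cons z l ih =>
    obtain ⟨h1, h2⟩ := List.pairwise_cons.1 hl
    obtain ⟨l', e, h3, h4⟩ := ih h2
    simp only [nums, List.map_cons, sins, lt_num, decide_eq_true_eq]
    split_ifs with c1 c2
    · refine ⟨x :: z :: l, rfl, List.pairwise_cons.2 ⟨?_, hl⟩, by simp⟩
      intro y hy
      rcases List.mem_cons.1 hy with rfl | hy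
      · exact c1
      · exact lt_trans (h1 y hy) c1
    · refine ⟨z :: l', by simpa using e, List.pairwise_cons.2 ⟨?_, h3⟩, ?_⟩
      · intro y hy
        rcases (h4 y).1 hy with rfl | hy
        exacts [c2, h1 y hy]
      · intro y
        simp only [List.mem_cons, h4]
        tauto
    · obtain rfl : x = z := by omega
      exact ⟨x :: l, rfl, hl, by simp⟩

theorem unionL_nums (l : List ℕ) {acc : List ℕ} (h : acc.Pairwise (· > ·)) :
    ∃ l', unionL (nums l) (nums acc) = nums l' ∧ l'.Pairwise (· > ·) ∧
      ∀ y, y ∈ l' ↔ y ∈ l ∨ y ∈ acc := by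
  induction l generalizing acc with
  | nil => exact ⟨acc, rfl, h, by simp⟩
  | cons x l ih =>
    obtain ⟨l₁, e₁, p₁, m₁⟩ := sins_nums x h
    obtain ⟨l₂, e₂, p₂, m₂⟩ := ih p₁
    refine ⟨l₂, ?_, p₂, fun y => ?_⟩
    · simp only [unionL, nums, List.map_cons, List.foldl_cons] at *
      rw [e₁, e₂]
    · rw [m₂, m₁, List.mem_cons]
      tauto

/-! ### The stored hypergraph -/

/-- The functions `nb` and `vs` return the incidences of vertices, as far as they are needed, and
the vertices of hyperedges. -/
structure Represents (G : Hypergraph) (N : ℕ) (nb vs : Val → List Val) (X : ℕ → List ℕ) : Prop where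
  vs_eq : ∀ e, vs (num e) = nums (X e)
  X_inc : ∀ e ∈ G.edges, ∀ v, v ∈ X e ↔ v ∈ G.inc e
  nb_eq : ∀ v, ∃ l : List ℕ, nb (num v) = nums l ∧ l.Nodup ∧ (∀ f ∈ l, f ∈ G.edges ∧ v ∈ G.inc f) ∧
    (l.length = N ∨ ∀ f ∈ G.edges, v ∈ G.inc f → f ∈ l)

namespace Represents

variable {G : Hypergraph} {N : ℕ} {nb vs : Val → List Val} {X : ℕ → List ℕ}

theorem bdVs_nums (A : List Val) (Y : List ℕ) {acc : List ℕ}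
    (h : acc.Pairwise (· > ·)) :
    ∃ l', bdVs nb A (nums Y) (nums acc) = nums l' ∧ l'.Pairwise (· > ·) ∧
      ∀ y, y ∈ l' ↔ y ∈ acc ∨ (y ∈ Y ∧ subL (nb (num y)) A = false) := by
  induction Y generalizing acc with
  | nil => exact ⟨acc, rfl, h, by simp⟩
  | cons x Y ih =>
    simp only [bdVs, nums, List.map_cons, List.foldl_cons] at *
    split_ifs with c
    · obtain ⟨l₂, e₂, p₂, m₂⟩ := ih h
      refine ⟨l₂, e₂, p₂, fun y => ?_⟩
      rw [m₂, List.mem_cons]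
      constructor
      · tauto
      · rintro (h | ⟨rfl | h, h'⟩)
        · exact .inl h
        · simp [c] at h'
        · exact .inr ⟨h, h'⟩
    · obtain ⟨l₁, e₁, p₁, m₁⟩ := sins_nums x h
      obtain ⟨l₂, e₂, p₂, m₂⟩ := ih p₁
      refine ⟨l₂, ?_, p₂, fun y => ?_⟩
      · simp only [nums] at e₁
        rw [e₁, e₂]
      · rw [m₂, m₁, List.mem_cons]
        constructor
        · rintro ((rfl | h) | h)
          · exact .inr ⟨.inl rfl, by simpa using c⟩
          · exact .inl h
          · exact .inr ⟨.inr h.1, h.2⟩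
        · tauto

theorem bdEs_nums (R : Represents G N nb vs X) (A : List Val) (A' : List ℕ) {acc : List ℕ}
    (h : acc.Pairwise (· > ·)) :
    ∃ l', bdEs nb vs A (nums A') (nums acc) = nums l' ∧ l'.Pairwise (· > ·) ∧
      ∀ y, y ∈ l' ↔ y ∈ acc ∨ ∃ e ∈ A', y ∈ X e ∧ subL (nb (num y)) A = false := by
  induction A' generalizing acc with
  | nil => exact ⟨acc, rfl, h, by simp⟩
  | cons e A' ih =>
    obtain ⟨l₁, e₁, p₁, m₁⟩ := bdVs_nums (nb := nb) A (X e) h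
    obtain ⟨l₂, e₂, p₂, m₂⟩ := ih p₁
    refine ⟨l₂, ?_, p₂, fun y => ?_⟩
    · simp only [bdEs, nums, List.map_cons, List.foldl_cons] at *
      rw [R.vs_eq, e₁, e₂]
    · rw [m₂, m₁]
      simp only [List.mem_cons, exists_eq_or_imp]
      tauto

/-- Truncation does no harm: if `N` distinct incidences were found, they cannot all lie in the
shorter list `A`, and otherwise the list is complete. -/
theorem subL_nb (R : Represents G N nb vs X) {A : List ℕ} (hN : A.length < N) (v : ℕ) :
    subL (nb (num v)) (nums A) = false ↔ ∃ f ∈ G.edges, f ∉ A ∧ v ∈ G.inc f := by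
  obtain ⟨l, e, hd, h1, h2⟩ := R.nb_eq v
  rw [e, ← Bool.not_eq_true, subL_nums]
  push Not
  constructor
  · rintro ⟨f, hf, hfA⟩
    exact ⟨f, (h1 f hf).1, hfA, (h1 f hf).2⟩
  · rintro ⟨f, hf, hfA, hv⟩
    rcases h2 with h2 | h2
    · by_contra hh
      push Not at hh
      have := (List.subperm_of_subset hd hh).length_le
      omega
    · exact ⟨f, h2 f hf hv, hfA⟩

theorem bdL_nums (R : Represents G N nb vs X) {A : List ℕ} (hA : A.toFinset ⊆ G.edges)
    (hN : A.length < N) : bdL nb vs (nums A) = nums (desc (G.bd A.toFinset)) := by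
  obtain ⟨l', e, hp, hm⟩ := R.bdEs_nums (nums A) A (acc := []) List.Pairwise.nil
  rw [bdL, show ([] : List Val) = nums [] from rfl, e, eq_desc hp]
  intro y
  rw [hm, Hypergraph.mem_bd]
  simp only [R.subL_nb hN, List.mem_toFinset, List.not_mem_nil, false_or]
  constructor
  · rintro ⟨e, he, hy, h⟩
    exact ⟨⟨e, he, (R.X_inc e (hA (by simpa using he)) y).1 hy⟩, h⟩
  · rintro ⟨⟨e, he, hy⟩, h⟩
    exact ⟨e, he, (R.X_inc e (hA (by simpa using he)) y).2 hy, h⟩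

theorem stepVs_nums (R : Represents G N nb vs X) (Y : List ℕ) {acc : List ℕ}
    (h : acc.Pairwise (· > ·)) :
    ∃ l', stepVs nb (nums Y) (nums acc) = nums l' ∧ l'.Pairwise (· > ·) ∧
      ∀ y, y ∈ l' ↔ y ∈ acc ∨ ∃ v ∈ Y, num y ∈ nb (num v) := by
  induction Y generalizing acc with
  | nil => exact ⟨acc, rfl, h, by simp⟩
  | cons v Y ih =>
    obtain ⟨l, e, -⟩ := R.nb_eq v
    obtain ⟨l₁, e₁, p₁, m₁⟩ := unionL_nums l h
    obtain ⟨l₂, e₂, p₂, m₂⟩ := ih p₁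
    refine ⟨l₂, ?_, p₂, fun y => ?_⟩
    · simp only [stepVs, nums, List.map_cons, List.foldl_cons] at *
      rw [e, e₁, e₂]
    · rw [m₂, m₁]
      simp only [List.mem_cons, exists_eq_or_imp, e, List.mem_map_of_injective num_injective]
      tauto

theorem stepEs_nums (R : Represents G N nb vs X) (L : List ℕ) {acc : List ℕ}
    (h : acc.Pairwise (· > ·)) :
    ∃ l', stepEs nb vs (nums L) (nums acc) = nums l' ∧ l'.Pairwise (· > ·) ∧
      ∀ y, y ∈ l' ↔ y ∈ acc ∨ ∃ e ∈ L, ∃ v ∈ X e, num y ∈ nb (num v) := by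
  induction L generalizing acc with
  | nil => exact ⟨acc, rfl, h, by simp⟩
  | cons e L ih =>
    obtain ⟨l₁, e₁, p₁, m₁⟩ := R.stepVs_nums (X e) h
    obtain ⟨l₂, e₂, p₂, m₂⟩ := ih p₁
    refine ⟨l₂, ?_, p₂, fun y => ?_⟩
    · simp only [stepEs, nums, List.map_cons, List.foldl_cons] at *
      rw [R.vs_eq, e₁, e₂]
    · rw [m₂, m₁]
      simp only [List.mem_cons, exists_eq_or_imp]
      exact or_assoc

theorem ballL_succ (n : ℕ) (L : List Val) :
    ballL nb vs (n + 1) L = stepEs nb vs (ballL nb vs n L) (ballL nb vs n L) := by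
  induction n generalizing L with
  | zero => rfl
  | succ n ih =>
    rw [ballL, ih]
    rfl

/-- The iterated neighbourhoods of a hyperedge, as sets. -/
theorem exists_ball (R : Represents G N nb vs X) (e : ℕ) {s : ℕ} (hN : N = s + 1) :
    ∃ ball : ℕ → Finset ℕ, (∀ i, ballL nb vs i [num e] = nums (desc (ball i))) ∧
      Hypergraph.IsBall G e s ball := by
  have h : ∀ i, ∃ S : Finset ℕ, ballL nb vs i [num e] = nums (desc S) := by
    intro i
    induction i with
    | zero => exact ⟨{e}, by simp [ballL, desc]⟩
    | succ i ih =>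
      obtain ⟨S, hS⟩ := ih
      obtain ⟨l, e, hp, hm⟩ := R.stepEs_nums (desc S) (desc_pairwise S)
      exact ⟨l.toFinset, by rw [ballL_succ, hS, e]; exact congrArg nums (eq_desc hp (by simp))⟩
  choose ball hball using h
  have hmem : ∀ i y, y ∈ ball (i + 1) ↔
      y ∈ ball i ∨ ∃ f ∈ ball i, ∃ v ∈ X f, num y ∈ nb (num v) := by
    intro i y
    obtain ⟨l, e, hp, hm⟩ := R.stepEs_nums (desc (ball i)) (desc_pairwise (ball i))
    have h1 := hball (i + 1)
    rw [ballL_succ, hball i, e] at h1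
    have h2 := hm y
    rw [nums_injective h1] at h2
    simpa using h2
  refine ⟨ball, hball, ?_, ?_, ?_⟩
  · have h0 := hball 0
    have : [e] = desc (ball 0) := nums_injective (by simpa [ballL] using h0)
    rw [← mem_desc, ← this]
    simp
  · intro i y hy
    exact (hmem i y).2 (.inl hy)
  · intro i f hf hfG v hv hdeg g hg hvg
    refine (hmem i g).2 (.inr ⟨f, hf, v, (R.X_inc f hfG v).2 hv, ?_⟩)
    obtain ⟨l, e, hd, h1, h2⟩ := R.nb_eq v
    rw [e, List.mem_map_of_injective num_injective]
    -- A truncated list has `N = s + 1` entries; as the degree is at most `s + 1`, it is complete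
    -- after all. At vertices of larger degree the ball may receive arbitrary neighbours, which is
    -- harmless.
    rcases h2 with h2 | h2
    · have hsub : l.toFinset ⊆ G.edges.filter fun g => v ∈ G.inc g := by
        intro x hx
        exact Finset.mem_filter.2 (h1 x (by simpa using hx))
      have := Finset.eq_of_subset_of_card_le hsub
        (by rw [List.toFinset_card_of_nodup hd]; omega)
      rw [← List.mem_toFinset, this]
      exact Finset.mem_filter.2 ⟨hg, hvg⟩
    · exact h2 g hg hvg

/-- A splitting part may be chosen to avoid the head `a`, so the subsets of the tail suffice. All of
these are enumerated, since their length is below the limit `N`. -/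
theorem noSplit_iff (R : Represents G N nb vs X) {a : ℕ} {A : List ℕ} (hd : (a :: A).Nodup)
    (hA : (a :: A).toFinset ⊆ G.edges) (hN : (a :: A).length < N) :
    noSplit nb vs (bdL nb vs (nums (a :: A))) (sublL (nums A) N [] []) = true ↔
      G.InternallyConnected (a :: A).toFinset := by
  rw [R.bdL_nums hA hN]
  obtain ⟨haA, hd'⟩ := List.nodup_cons.1 hd
  simp only [List.length_cons] at hN
  constructor
  · intro h
    refine Hypergraph.internallyConnected_of_forall (a := a) hA (by simp) ?_
    intro B hB h0 haB hbd
    have hl : (A.filter (· ∈ B)).reverse.toFinset = B := by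
      ext x
      simp only [List.toFinset_reverse, List.mem_toFinset, List.mem_filter, decide_eq_true_eq]
      refine ⟨fun h => h.2, fun hx => ⟨?_, hx⟩⟩
      have := hB hx
      simp only [List.toFinset_cons, Finset.mem_insert, List.mem_toFinset] at this
      rcases this with rfl | h
      exacts [absurd hx haB, h]
    have hle : (A.filter (· ∈ B)).length ≤ A.length := List.length_filter_le _ _
    have hmem : nums (A.filter (· ∈ B)).reverse ∈ sublL (nums A) N [] [] := by
      rw [mem_sublL_nil]
      refine ⟨?_, by simp; omega⟩
      rw [← List.map_reverse, List.reverse_reverse]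
      exact List.filter_sublist.map _
    have := List.all_eq_true.1 h _ hmem
    rw [R.bdL_nums (by rw [hl]; exact hB.trans hA) (by simp; omega), hl] at this
    simp only [Bool.or_eq_true, List.isEmpty_iff, Bool.not_eq_true'] at this
    rcases this with h1 | h1
    · have : B = ∅ := by rw [← hl, List.map_eq_nil_iff.1 h1]; rfl
      simp [this] at h0
    · rw [← Bool.not_eq_true, subL_nums] at h1
      exact h1 fun x hx => mem_desc.2 (hbd (mem_desc.1 hx))
  · intro h
    refine List.all_eq_true.2 fun B hB => ?_
    obtain ⟨h1, h2⟩ := mem_sublL_nil.1 hB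
    obtain ⟨l, hl, hl'⟩ := List.sublist_map_iff.1 h1
    have hBl : B = nums l.reverse := by
      rw [← List.reverse_reverse B, hl', ← List.map_reverse]
    subst hBl
    cases l with
    | nil => simp
    | cons b l =>
      have hlen := hl.length_le
      have hs : (b :: l).reverse.toFinset ⊆ (a :: A).toFinset := by
        intro x hx
        simp only [List.toFinset_reverse, List.mem_toFinset] at hx
        simp [hl.subset hx]
      rw [R.bdL_nums (hs.trans hA) (by simp at hlen ⊢; omega)]
      simp only [Bool.or_eq_true, Bool.not_eq_true']
      right
      rw [← Bool.not_eq_true, subL_nums]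
      intro hh
      refine h.not_bd_subset hs ⟨b, by simp⟩ ⟨a, by simp, ?_⟩
        fun x hx => mem_desc.1 (hh x (mem_desc.2 hx))
      intro hx
      simp only [List.toFinset_reverse, List.mem_toFinset] at hx
      exact haA (hl.subset hx)

end Represents
end DynLocalSearch

/-! ### The hypergraph as stored in the edge tree and the incidence tree -/

namespace DynLocalSearch
open Val

/-- The trees `TE` and `TV` store the hyperedges with their lists `X` of vertices, and the
incidences of `G`. -/
structure GraphInv (r : ℕ) (G : Hypergraph) (X : ℕ → List ℕ) (TE TV : Tree) : Prop where
  balE : TE.Balanced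
  balV : TV.Balanced
  sortE : TE.Sorted
  sortV : TV.Sorted
  memE : ∀ x, x ∈ TE.toList ↔ ∃ e ∈ G.edges, x = pair (pair (num e) (num 0)) (ofVals (nums (X e)))
  memV : ∀ x, x ∈ TV.toList ↔
    ∃ e ∈ G.edges, ∃ v ∈ G.inc e, x = pair (pair (num v) (num e)) (num e)
  X_nil : ∀ e, e ∉ G.edges → X e = []
  X_len : ∀ e, (X e).length ≤ r
  X_inc : ∀ e ∈ G.edges, ∀ v, v ∈ X e ↔ v ∈ G.inc e

namespace GraphInv

variable {r N : ℕ} {G : Hypergraph} {X : ℕ → List ℕ} {TE TV : Tree}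

theorem values_edge (I : GraphInv r G X TE TV) {e : ℕ} (he : e ∈ G.edges) :
    TE.values 1 (num e) = [ofVals (nums (X e))] := by
  have h1 : ∀ v ∈ TE.values 1 (num e), v = ofVals (nums (X e)) := by
    intro v hv
    obtain ⟨x, hx, hg, rfl⟩ := Tree.mem_of_mem_values I.sortE hv
    obtain ⟨f, -, rfl⟩ := (I.memE x).1 hx
    simp only [fst_pair, num.injEq] at hg
    subst hg
    rfl
  have h2 := TE.length_values_le 1 (num e)
  have h3 : TE.values 1 (num e) ≠ [] := by
    rcases Tree.values_complete I.sortE 1 (num e) with h | h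
    · intro h'
      simp [h'] at h
    · exact List.ne_nil_of_mem (h _ ((I.memE _).2 ⟨e, he, rfl⟩) rfl)
  match hv : TE.values 1 (num e) with
  | [] => exact absurd hv h3
  | [a] => rw [h1 a (by simp [hv])]
  | a :: b :: l => simp [hv] at h2

theorem values_nonedge (I : GraphInv r G X TE TV) {e : ℕ} (he : e ∉ G.edges) :
    TE.values 1 (num e) = [] := by
  rw [List.eq_nil_iff_forall_not_mem]
  intro v hv
  obtain ⟨x, hx, hg, rfl⟩ := Tree.mem_of_mem_values I.sortE hv
  obtain ⟨f, hf, rfl⟩ := (I.memE x).1 hx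
  simp only [fst_pair, num.injEq] at hg
  subst hg
  exact he hf

theorem vsT_eq (I : GraphInv r G X TE TV) (e : ℕ) : vsT TE (num e) = nums (X e) := by
  by_cases he : e ∈ G.edges
  · simp [vsT, vsV, I.values_edge he]
  · simp [vsT, vsV, I.values_nonedge he, I.X_nil e he]

/-- The time bounds refer to arbitrary values `g`, including those that are not labels, and this
covers them all. -/
theorem vsT_cases (I : GraphInv r G X TE TV) (g : Val) : ∃ e, vsT TE g = nums (X e) ∨ vsT TE g = [] := by
  unfold vsT vsV
  cases h : TE.values 1 g with
  | nil => exact ⟨0, .inr rfl⟩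
  | cons v l =>
    obtain ⟨x, hx, hg, hv⟩ := Tree.mem_of_mem_values I.sortE (h ▸ List.mem_cons_self : v ∈ TE.values 1 g)
    obtain ⟨f, hf, rfl⟩ := (I.memE x).1 hx
    refine ⟨f, .inl ?_⟩
    rw [← hv]
    simp

theorem represents (I : GraphInv r G X TE TV) (N : ℕ) :
    Represents G N (nbT N TV) (vsT TE) X where
  vs_eq := I.vsT_eq
  X_inc := I.X_inc
  nb_eq v := by
    have h1 : ∀ w ∈ TV.values N (num v), ∃ f, f ∈ G.edges ∧ v ∈ G.inc f ∧ w = num f := by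
      intro w hw
      obtain ⟨x, hx, hg, rfl⟩ := Tree.mem_of_mem_values I.sortV hw
      obtain ⟨f, hf, u, hu, rfl⟩ := (I.memV x).1 hx
      simp only [fst_pair, num.injEq] at hg
      subst hg
      exact ⟨f, hf, hu, rfl⟩
    obtain ⟨l, hl⟩ : ∃ l : List ℕ, TV.values N (num v) = nums l := by
      have : ∀ L : List Val, (∀ w ∈ L, ∃ f, f ∈ G.edges ∧ v ∈ G.inc f ∧ w = num f) →
          ∃ l : List ℕ, L = nums l := by
        intro L
        induction L with
        | nil => exact fun _ => ⟨[], rfl⟩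
        | cons w L ih =>
          intro h
          obtain ⟨l, rfl⟩ := ih fun w hw => h w (by simp [hw])
          obtain ⟨f, -, -, rfl⟩ := h w (by simp)
          exact ⟨f :: l, rfl⟩
      exact this _ h1
    have hnd : (TV.values N (num v)).Nodup := by
      refine Tree.values_nodup I.sortV N (num v) ?_
      intro x hx y hy hgx hgy hxy
      obtain ⟨f, hf, u, hu, rfl⟩ := (I.memV x).1 hx
      obtain ⟨f', hf', u', hu', rfl⟩ := (I.memV y).1 hy
      simp only [fst_pair, snd_pair, num.injEq] at *
      subst hgx hgy hxy
      rfl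
    rw [hl] at hnd
    refine ⟨l, hl, (List.nodup_map_iff num_injective).1 hnd, ?_, ?_⟩
    · intro f hf
      obtain ⟨f', h2, h3, h4⟩ := h1 (num f) (by rw [hl]; exact List.mem_map_of_mem hf)
      simp only [num.injEq] at h4
      subst h4
      exact ⟨h2, h3⟩
    · rcases Tree.values_complete I.sortV N (num v) with h | h
      · left
        rw [hl] at h
        simpa using h
      · right
        intro f hf hv
        have := h _ ((I.memV _).2 ⟨f, hf, v, hv, rfl⟩) rfl
        rw [hl, snd_pair, List.mem_map_of_injective num_injective] at this
        exact this

theorem tables (I : GraphInv r G X TE TV) {Z U S N : ℕ} (hZ : 1 ≤ Z) (hU : 1 ≤ U) (hN : N + 1 ≤ Z)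
    (hS : 2 * (S * r) + 2 * S + 3 ≤ Z) (hS' : 2 ^ (S + 1) ≤ Z) (hr : r ≤ Z) (htE : TE.ht < U)
    (htV : TV.ht < U) : Tables Z U r S N TE TV where
  hZ := hZ
  hU := hU
  hN := hN
  hS := hS
  hS' := hS'
  hR := hr
  balE := I.balE
  balV := I.balV
  htE := htE
  htV := htV
  vs_len g := by
    obtain ⟨e, h | h⟩ := I.vsT_cases g <;> rw [h]
    · simpa using I.X_len e
    · simp
  vs_size g := by
    obtain ⟨e, h | h⟩ := I.vsT_cases g <;> rw [h] <;> simp [Val.size]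
  nb_size g f hf := by
    obtain ⟨x, hx, hg, rfl⟩ := Tree.mem_of_mem_values I.sortV hf
    obtain ⟨f, hf, u, hu, rfl⟩ := (I.memV x).1 hx
    rfl

theorem allInL_iff (I : GraphInv r G X TE TV) {A : List ℕ} :
    allInL TE (nums A) = true ↔ A.toFinset ⊆ G.edges := by
  simp only [allInL, List.all_map, List.all_eq_true, Function.comp, Bool.not_eq_true',
    Finset.subset_iff, List.mem_toFinset]
  refine forall_congr' fun e => imp_congr_right fun _ => ?_
  by_cases he : e ∈ G.edges
  · simp [I.values_edge he, he]
  · simp [I.values_nonedge he, he]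

end GraphInv

/-- The sets that are stored: the possible internal components of eligible sets. -/
def Qualifies (G : Hypergraph) (O : Oracle) (s k : ℕ) (A : Finset ℕ) : Prop :=
  G.InternallyConnected A ∧ A.card ≤ s ∧ G.lam A ≤ k ∧ oracleHolds O G A

/-- The size condition of `Qualifies` is not tested, as every candidate has at most `s` elements by
construction. The limit `s + 1` on incidences exceeds the size of `A`, so boundaries are computed
exactly. -/
theorem qualL_iff {r s k K : ℕ} {G : Hypergraph} {X : ℕ → List ℕ} {TE TV : Tree} {O : Oracle}
    {ω : Val → Bool × ℕ} (I : GraphInv r G X TE TV) (hω : OracleBehaviour O s K G ω) {A : Finset ℕ}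
    (hs : A.card ≤ s) : qualL ω (s + 1) k TE TV (nums (asc A)) = true ↔ Qualifies G O s k A := by
  have R := I.represents (s + 1)
  simp only [qualL, Bool.and_eq_true, Bool.not_eq_true', lenLe_iff, I.allInL_iff, toFinset_asc]
  by_cases hA : A ⊆ G.edges
  · have hbd : bdL (nbT (s + 1) TV) (vsT TE) (nums (asc A)) = nums (desc (G.bd A)) := by
      rw [R.bdL_nums (by simpa using hA) (by simp; omega), toFinset_asc]
    have hor := (hω (asc A) (asc_nodup A) (by simpa using hA) (by simpa using hs)).1
    rw [toFinset_asc, ofList_eq] at hor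
    rw [hor]
    cases h : asc A with
    | nil =>
      have : A = ∅ := by rw [← toFinset_asc A, h]; rfl
      subst this
      simp [Qualifies, Hypergraph.InternallyConnected]
    | cons a l =>
      have hns := R.noSplit_iff (a := a) (A := l) (h ▸ asc_nodup A)
        (by rw [← h, toFinset_asc]; exact hA) (by rw [← h, length_asc]; omega)
      rw [← h, toFinset_asc] at hns
      rw [h] at hbd
      rw [h] at hns
      simp only [nums, List.map_cons] at hbd hns
      simp only [Qualifies, ← hns, nums, List.map_cons, List.tail_cons, hbd]
      simp only [List.length_map, length_desc, Hypergraph.lam]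
      simp [hA, hs, and_comm, and_assoc, and_left_comm]
  · simp only [hA, and_false, false_and, Qualifies, false_iff]
    intro h
    exact hA h.1.1

/-- The ball is listed in decreasing order and `sublL` reverses the chosen sublists. So every small
subset of the ball appears as its increasing list, the form in which sets occur in keys. -/
theorem mem_candidates {r s : ℕ} {G : Hypergraph} {X : ℕ → List ℕ} {TE TV : Tree}
    (I : GraphInv r G X TE TV) (e : ℕ) :
    ∃ ball : ℕ → Finset ℕ, Hypergraph.IsBall G e s ball ∧
      ∀ A, A ∈ candidates (s + 1) TE TV (num e) ↔
        ∃ C, C ⊆ ball s ∧ C.card ≤ s ∧ A = nums (asc C) := by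
  obtain ⟨ball, h1, h2⟩ := (I.represents (s + 1)).exists_ball e (s := s) rfl
  refine ⟨ball, h2, fun A => ?_⟩
  rw [candidates, Nat.add_sub_cancel, h1, mem_sublL_nil]
  constructor
  · rintro ⟨h3, h4⟩
    obtain ⟨l, hl, hl'⟩ := List.sublist_map_iff.1 h3
    have hd : l = desc l.toFinset := eq_desc ((desc_pairwise _).sublist hl) (by simp)
    have hA : A = nums l.reverse := by rw [← List.reverse_reverse A, hl', ← List.map_reverse]
    refine ⟨l.toFinset, ?_, ?_, ?_⟩
    · intro x hx
      simpa using hl.subset (List.mem_toFinset.1 hx)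
    · rw [hA] at h4
      simp only [List.length_map, List.length_reverse] at h4
      exact l.toFinset_card_le.trans h4
    · rw [hA, asc, ← hd]
  · rintro ⟨C, h3, h4, rfl⟩
    refine ⟨?_, by simpa using h4⟩
    rw [asc, ← List.map_reverse, List.reverse_reverse]
    exact (desc_sublist h3).map _

end DynLocalSearch

namespace DynLocalSearch
open Val

/-! ### Witnesses -/

/-- The entry for the set `A` with boundary `B`. -/
def setEntry (B : Val) (A : List Val) : Val := pair (pair B (ofVals A)) (ofVals A)

theorem setEntry_inj {B B' : Val} {A A' : List Val} :
    setEntry B A = setEntry B' A' ↔ B = B' ∧ A = A' := by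
  simp [setEntry, ofVals_injective.eq_iff]

/-- The list `w` enumerates a union of sets from the family `F` with at least `s / 2` elements:
either a single set, or not the whole family and not more than `s` elements. -/
def GoodWitness (s : ℕ) (F : Set (List Val)) (w : List Val) : Prop :=
  ∃ l : List (List Val), l.Nodup ∧ l ≠ [] ∧ (∀ A ∈ l, A ∈ F) ∧ w.Perm l.flatten ∧
    s ≤ 2 * w.length ∧ ((∃ A, l = [A]) ∨ (w.length ≤ s ∧ ∃ A ∈ F, A ∉ l))

/-- The family `F` has fewer than `s` elements in total. -/
def SmallFamily (s : ℕ) (F : Set (List Val)) : Prop :=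
  ∀ l : List (List Val), l.Nodup → (∀ A ∈ l, A ∈ F) → l.flatten.length < s

/-- The tree `TW` is correct for a family with boundary `B`. -/
structure WitnessFor (s : ℕ) (F : Set (List Val)) (TW : Tree) (B : Val) : Prop where
  good : ∀ x ∈ TW.toList, x.fst = B → ∃ w, x = pair B (ofVals w) ∧ GoodWitness s F w
  small : (∀ x ∈ TW.toList, x.fst ≠ B) → 1 ≤ s → SmallFamily s F

/-- All entries of the tree are of the form `setEntry`, for non-empty sets. -/
def SetShape (TF : Tree) : Prop := ∀ x ∈ TF.toList, ∃ B A, x = setEntry B A ∧ A ≠ []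

/-- The sets stored with boundary `B`. -/
def family (TF : Tree) (B : Val) : Set (List Val) := {A | setEntry B A ∈ TF.toList}

/-- All witnesses are correct. -/
def Witnesses (s : ℕ) (TF TW : Tree) : Prop := ∀ B, WitnessFor s (family TF B) TW B

/-- Here `p` collects the sets already united in `cur`, which is below `s / 2`. A union is returned
as soon as it reaches `s / 2` by adding a set that is itself below `s / 2`, so it stays below `s`.
Failure means that the items ran out below `s / 2`, or that the last one was needed; in both cases
the total is below `s`. For `s = 0` the first item is returned at once. -/
theorem witL_spec {s : ℕ} {L p : List (List Val)} {cur : List Val} (hc : cur.Perm p.flatten)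
    (hlt : 2 * cur.length < s ∨ s = 0) (hne : ∀ A ∈ L, A ≠ []) :
    (witL s (L.map ofVals) cur (s - 2 * cur.length) ≠ [] →
      ∃ l : List (List Val), l ≠ [] ∧
        (witL s (L.map ofVals) cur (s - 2 * cur.length)).Perm l.flatten ∧
        s ≤ 2 * (witL s (L.map ofVals) cur (s - 2 * cur.length)).length ∧
        ((∃ A ∈ L, l = [A]) ∨
          ((witL s (L.map ofVals) cur (s - 2 * cur.length)).length ≤ s ∧
            ∃ t, t ≠ [] ∧ p ++ L = l ++ t))) ∧
    (witL s (L.map ofVals) cur (s - 2 * cur.length) = [] → 1 ≤ s →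
      cur.length + L.flatten.length < s) := by
  induction L generalizing p cur with
  | nil =>
    simp only [List.map_nil, witL, ne_eq, not_true_eq_false, false_implies, true_and,
      List.flatten_nil, List.length_nil, forall_const]
    omega
  | cons A L ih =>
    have hA := hne A (by simp)
    have hA' : 0 < A.length := List.length_pos_of_ne_nil hA
    simp only [List.map_cons, witL, appL_eq, toVals_ofVals, List.append_nil]
    split_ifs with h1 h2 h3
    · refine ⟨fun _ => ⟨[A], by simp, by simp, by simp; omega,
        .inl ⟨A, by simp⟩⟩, fun h => absurd h (by simpa using hA)⟩
    -- The last set is needed to reach `s / 2`, but both `cur` and this set are smaller than `s /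
    -- 2`, so the total is below `s`.
    · obtain rfl : L = [] := by simpa using h3
      simp only [ne_eq, not_true_eq_false, false_implies, true_and, List.flatten_cons,
        List.flatten_nil, List.append_nil, forall_const]
      omega
    · refine ⟨fun _ => ⟨p ++ [A], by simp, ?_, by simp; omega, .inr ⟨by simp; omega, L, ?_, by simp⟩⟩,
        fun h => absurd h (by simp [hA])⟩
      · rw [List.flatten_append]
        simp only [List.flatten_cons, List.flatten_nil, List.append_nil]
        exact List.perm_append_comm.trans (hc.append (List.reverse_perm A))
      · simpa using h3
    · have hc' : (A.reverse ++ cur).Perm (p ++ [A]).flatten := by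
        rw [List.flatten_append]
        simp only [List.flatten_cons, List.flatten_nil, List.append_nil]
        exact List.perm_append_comm.trans (hc.append (List.reverse_perm A))
      have := ih hc' (by simp; omega) fun A hA => hne A (by simp [hA])
      rw [show s - 2 * (A.reverse ++ cur).length = s - 2 * cur.length - 2 * A.length by
        simp; omega] at this
      obtain ⟨g1, g2⟩ := this
      refine ⟨fun h => ?_, fun h hs => ?_⟩
      · obtain ⟨l, l0, l1, l2, l3⟩ := g1 h
        refine ⟨l, l0, l1, l2, l3.imp ?_ ?_⟩
        · rintro ⟨A', hA', rfl⟩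
          exact ⟨A', by simp [hA'], rfl⟩
        · rintro ⟨k1, t, k2, k3⟩
          exact ⟨k1, t, k2, by simpa using k3⟩
      · have := g2 h hs
        simp only [List.length_append, List.length_reverse, List.flatten_cons] at *
        omega

section Witness

variable {s N : ℕ} {TF TW : Tree}

theorem exists_values (hs : TF.Sorted) (hF : SetShape TF) (N : ℕ) (B : Val) :
    ∃ L : List (List Val), TF.values N B = L.map ofVals ∧ L.Nodup ∧
      (∀ A ∈ L, A ∈ family TF B ∧ A ≠ []) ∧ (L.length = N ∨ ∀ A ∈ family TF B, A ∈ L) := by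
  have h1 : ∀ v ∈ TF.values N B, ∃ A, v = ofVals A ∧ A ∈ family TF B ∧ A ≠ [] := by
    intro v hv
    obtain ⟨x, hx, hg, rfl⟩ := Tree.mem_of_mem_values hs hv
    obtain ⟨B', A, rfl, h0⟩ := hF x hx
    obtain rfl : B' = B := hg
    exact ⟨A, rfl, hx, h0⟩
  have hnd : (TF.values N B).Nodup := by
    refine Tree.values_nodup hs N B fun x hx y hy hgx hgy hxy => ?_
    obtain ⟨B', A, rfl, -⟩ := hF x hx
    obtain ⟨B'', A', rfl, -⟩ := hF y hy
    simp only [setEntry, fst_pair, snd_pair] at *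
    simp_all
  have h2 := Tree.values_complete hs N B
  have h3 : (TF.values N B).map (ofVals ∘ toVals) = TF.values N B := by
    conv_rhs => rw [← List.map_id (TF.values N B)]
    refine List.map_congr_left fun v hv => ?_
    obtain ⟨A, rfl, -⟩ := h1 v hv
    simp
  refine ⟨(TF.values N B).map toVals, by rw [List.map_map, h3], ?_, ?_, ?_⟩
  · refine List.Nodup.of_map ofVals ?_
    rwa [List.map_map, h3]
  · intro A hA
    obtain ⟨v, hv, rfl⟩ := List.mem_map.1 hA
    obtain ⟨A, rfl, h⟩ := h1 v hv
    simpa using h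
  · refine h2.imp (by simp) fun h A hA => ?_
    exact List.mem_map.2 ⟨ofVals A, h _ hA rfl, by simp⟩

/-- Inspecting `N > s` sets is enough. If they contain no witness and `1 ≤ s`, their total size is
below `s`; being non-empty they are fewer than `N`, so the search was complete. If a proper prefix
is the witness, the next item shows that the family is not exhausted. -/
theorem witnessFor_refreshT (hF : TF.Sorted) (hF' : SetShape TF) (hW : TW.Sorted) (hN : s < N)
    (B : Val) : WitnessFor s (family TF B) (refreshT N s TF TW B) B := by
  obtain ⟨L, hL, hnd, hmem, hall⟩ := exists_values hF hF' N B
  have key := witL_spec (s := s) (L := L) (p := []) (cur := []) (by simp) (by simp; omega)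
    fun A hA => (hmem A hA).2
  unfold refreshT
  rw [hL]
  simp only [List.length_nil, Nat.mul_zero, Nat.sub_zero, List.nil_append, Nat.zero_add] at key
  split_ifs with h
  · refine ⟨fun x hx hB => absurd hB ((Tree.mem_del hW).1 hx).2, fun _ hs l hl hl' => ?_⟩
    have hlt := key.2 h hs
    have hlen : L.length ≤ L.flatten.length := by
      have : ∀ L : List (List Val), (∀ A ∈ L, A ≠ []) → L.length ≤ L.flatten.length := by
        intro L
        induction L with
        | nil => simp
        | cons A L ih =>
          intro h
          have h1 := List.length_pos_of_ne_nil (h A (by simp))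
          have h2 := ih fun A hA => h A (by simp [hA])
          simp only [List.flatten_cons, List.length_append, List.length_cons]
          omega
      exact this L fun A hA => (hmem A hA).2
    have hall := hall.resolve_left (by omega)
    obtain ⟨l', h1, h2⟩ := List.subperm_of_subset hl fun A hA => hall A (hl' A hA)
    rw [← h1.flatten.length_eq]
    exact h2.flatten.length_le.trans_lt hlt
  · refine ⟨fun x hx hB => ?_, fun h' => absurd rfl (h' _ ((Tree.mem_ins hW).2 (.inl rfl)))⟩
    rcases (Tree.mem_ins hW).1 hx with rfl | hx
    · refine ⟨_, rfl, ?_⟩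
      obtain ⟨l, l0, l1, l2, l3⟩ := key.1 h
      rcases l3 with ⟨A, hA, rfl⟩ | ⟨k1, t, k2, rfl⟩
      · exact ⟨[A], by simp, l0, by simpa using (hmem A hA).1, l1, l2, .inl ⟨A, rfl⟩⟩
      · obtain ⟨d1, d2, d3⟩ := List.nodup_append.1 hnd
        refine ⟨l, d1, l0, fun A hA => (hmem A (by simp [hA])).1, l1, l2, .inr ⟨k1, ?_⟩⟩
        obtain ⟨A, hA⟩ := List.exists_mem_of_ne_nil t k2
        exact ⟨A, (hmem A (by simp [hA])).1, fun hA' => d3 A hA' A hA rfl⟩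
    · exact absurd hB hx.2

theorem mem_refreshT (hW : TW.Sorted) {B x : Val} (hx : x.fst ≠ B) :
    x ∈ (refreshT N s TF TW B).toList ↔ x ∈ TW.toList := by
  unfold refreshT
  split_ifs
  · simp [Tree.mem_del hW, hx]
  · rw [Tree.mem_ins hW, fst_pair]
    simp only [hx, ne_eq, not_false_eq_true, and_true, or_iff_right_iff_imp]
    rintro rfl
    simp at hx

theorem sorted_refreshT (hW : TW.Sorted) (B : Val) : (refreshT N s TF TW B).Sorted := by
  unfold refreshT
  split_ifs
  exacts [hW.del _, hW.ins _]

/-- Refreshing one witness suffices after a change of the sets with one boundary. -/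
theorem Witnesses.refresh {TF' : Tree} (h : Witnesses s TF TW) (hF : TF'.Sorted)
    (hF' : SetShape TF') (hW : TW.Sorted) (hN : s < N) {B : Val}
    (hB : ∀ B', B' ≠ B → family TF' B' = family TF B') :
    Witnesses s TF' (refreshT N s TF' TW B) := by
  intro B'
  by_cases hBB : B' = B
  · subst hBB
    exact witnessFor_refreshT hF hF' hW hN B'
  · rw [hB B' hBB]
    obtain ⟨h1, h2⟩ := h B'
    refine ⟨fun x hx hx' => h1 x ((mem_refreshT hW (by rwa [hx'])).1 hx) hx', fun hx => h2 ?_⟩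
    intro x hx1 hx2
    exact hx x ((mem_refreshT hW (by rwa [hx2])).2 hx1) hx2

/-- The sets and witnesses are stored correctly. -/
structure SetsInv (s : ℕ) (TF TW : Tree) : Prop where
  balF : TF.Balanced
  balW : TW.Balanced
  sortF : TF.Sorted
  sortW : TW.Sorted
  shape : SetShape TF
  wit : Witnesses s TF TW

theorem balanced_refreshT (h : TW.Balanced) (B : Val) : (refreshT N s TF TW B).Balanced := by
  unfold refreshT
  split_ifs
  exacts [h.del _, h.ins _]

theorem SetsInv.del (h : SetsInv s TF TW) (hN : s < N) (B A : Val) :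
    SetsInv s (TF.del (pair B A)) (refreshT N s (TF.del (pair B A)) TW B) := by
  have hsh : SetShape (TF.del (pair B A)) := fun x hx => h.shape x ((Tree.mem_del h.sortF).1 hx).1
  refine ⟨h.balF.del _, balanced_refreshT h.balW _, h.sortF.del _, sorted_refreshT h.sortW _, hsh,
    h.wit.refresh (h.sortF.del _) hsh h.sortW hN fun B' hB => ?_⟩
  ext A'
  simp [family, Tree.mem_del h.sortF, setEntry, hB]

theorem SetsInv.ins (h : SetsInv s TF TW) (hN : s < N) (B : Val) {A : List Val} (hA : A ≠ []) :
    SetsInv s (TF.ins (setEntry B A)) (refreshT N s (TF.ins (setEntry B A)) TW B) := by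
  have hsh : SetShape (TF.ins (setEntry B A)) := fun x hx => by
    rcases (Tree.mem_ins h.sortF).1 hx with rfl | hx
    exacts [⟨B, A, rfl, hA⟩, h.shape x hx.1]
  refine ⟨h.balF.ins _, balanced_refreshT h.balW _, h.sortF.ins _, sorted_refreshT h.sortW _, hsh,
    h.wit.refresh (h.sortF.ins _) hsh h.sortW hN fun B' hB => ?_⟩
  ext A'
  simp [family, Tree.mem_ins h.sortF, setEntry, hB]

end Witness

/-! ### Removing and inserting all candidates -/

section Updates

variable {s N k : ℕ} {TE TV TF TW : Tree} {ω : Val → Bool × ℕ}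

theorem SetsInv.remAll (h : SetsInv s TF TW) (hN : s < N) (cs : List (List Val)) :
    SetsInv s (remAllT N s TE TV cs TF TW).1 (remAllT N s TE TV cs TF TW).2 ∧
    ∀ x, x ∈ (remAllT N s TE TV cs TF TW).1.toList ↔ x ∈ TF.toList ∧ ∀ A ∈ cs,
      x.fst ≠ pair (ofVals (bdL (nbT N TV) (vsT TE) A)) (ofVals A) := by
  induction cs generalizing TF TW with
  | nil => exact ⟨h, by simp [remAllT]⟩
  | cons A cs ih =>
    obtain ⟨h1, h2⟩ := ih (h.del hN (ofVals (bdL (nbT N TV) (vsT TE) A)) (ofVals A))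
    refine ⟨h1, fun x => ?_⟩
    simp only [remAllT, h2, Tree.mem_del h.sortF, List.forall_mem_cons, and_assoc]

theorem SetsInv.insAll (h : SetsInv s TF TW) (hN : s < N) (cs : List (List Val)) :
    SetsInv s (insAllT ω N s k TE TV cs TF TW).1 (insAllT ω N s k TE TV cs TF TW).2 ∧
    ∀ x, x ∈ (insAllT ω N s k TE TV cs TF TW).1.toList ↔
      (∃ A ∈ cs, qualL ω N k TE TV A = true ∧
        x = setEntry (ofVals (bdL (nbT N TV) (vsT TE) A)) A) ∨
      (x ∈ TF.toList ∧ ∀ A ∈ cs, qualL ω N k TE TV A = true →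
        x ≠ setEntry (ofVals (bdL (nbT N TV) (vsT TE) A)) A) := by
  induction cs generalizing TF TW with
  | nil => exact ⟨h, by simp [insAllT]⟩
  | cons A cs ih =>
    unfold insAllT
    split_ifs with hq
    · have hA : A ≠ [] := by
        rintro rfl
        simp [qualL] at hq
      obtain ⟨h1, h2⟩ := ih (h.ins hN (ofVals (bdL (nbT N TV) (vsT TE) A)) hA)
      refine ⟨h1, fun x => (h2 x).trans ?_⟩
      rw [Tree.mem_ins h.sortF]
      -- The value of an entry is determined by its key, so comparing keys amounts to comparing
      -- entries.
      have hx : x ∈ TF.toList → (x.fst ≠ (setEntry (ofVals (bdL (nbT N TV) (vsT TE) A)) A).fst ↔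
          x ≠ setEntry (ofVals (bdL (nbT N TV) (vsT TE) A)) A) := by
        intro hx
        obtain ⟨B', A', rfl, -⟩ := h.shape x hx
        simp [setEntry]
      simp only [List.exists_mem_cons_iff, List.forall_mem_cons, hq, true_and, forall_const]
      grind
    · obtain ⟨h1, h2⟩ := ih h
      refine ⟨h1, fun x => (h2 x).trans ?_⟩
      simp [hq]

end Updates

end DynLocalSearch

namespace DynLocalSearch
open Val

/-! ### Updates of the stored hypergraph -/

section Incidences

variable {TV : Tree} {e x : Val} {Y : List Val}

theorem mem_addIncT (h : TV.Sorted) : x ∈ (addIncT e Y TV).toList ↔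
    (∃ v ∈ Y, x = pair (pair v e) e) ∨ (x ∈ TV.toList ∧ ∀ v ∈ Y, x.fst ≠ pair v e) := by
  induction Y generalizing TV with
  | nil => simp [addIncT]
  | cons v Y ih =>
    have := ih (h.ins (pair (pair v e) e))
    simp only [addIncT, List.foldl_cons] at *
    rw [this, Tree.mem_ins h]
    simp only [List.exists_mem_cons_iff, List.forall_mem_cons, fst_pair]
    constructor
    · rintro (h1 | ⟨rfl | h1, h2⟩)
      exacts [.inl (.inr h1), .inl (.inl rfl), .inr ⟨h1.1, h1.2, h2⟩]
    · rintro ((rfl | h1) | ⟨h1, h2, h3⟩)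
      · by_cases hv : v ∈ Y
        · exact .inl ⟨v, hv, rfl⟩
        · refine .inr ⟨.inl rfl, fun w hw hh => hv ?_⟩
          simp only [fst_pair, pair.injEq, and_true] at hh
          rwa [hh]
      exacts [.inl h1, .inr ⟨.inr ⟨h1, h2⟩, h3⟩]

theorem mem_delIncT (h : TV.Sorted) : x ∈ (delIncT e Y TV).toList ↔
    x ∈ TV.toList ∧ ∀ v ∈ Y, x.fst ≠ pair v e := by
  induction Y generalizing TV with
  | nil => simp [delIncT]
  | cons v Y ih =>
    have := ih (h.del (pair v e))
    simp only [delIncT, List.foldl_cons] at *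
    rw [this, Tree.mem_del h, List.forall_mem_cons, and_assoc]

end Incidences

namespace GraphInv

variable {r e : ℕ} {G : Hypergraph} {X : ℕ → List ℕ} {TE TV : Tree}

theorem addHyperedge (I : GraphInv r G X TE TV) {l : List ℕ} (he : e ∉ G.edges)
    (hr : l.length ≤ r) (hV : l.toFinset ⊆ G.verts) :
    GraphInv r (G.addHyperedge e l.toFinset hV) (Function.update X e l)
      (TE.ins (pair (pair (num e) (num 0)) (ofVals (nums l)))) (addIncT (num e) (nums l) TV) where
  balE := I.balE.ins _
  balV := balanced_addIncT I.balV
  sortE := I.sortE.ins _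
  sortV := sorted_addIncT I.sortV
  memE x := by
    have hne : ∀ f ∈ G.edges, f ≠ e := fun f hf h => he (h ▸ hf)
    simp only [Tree.mem_ins I.sortE, I.memE, Hypergraph.addHyperedge, Finset.exists_mem_insert,
      Function.update_self, fst_pair]
    refine or_congr_right ⟨?_, ?_⟩
    · rintro ⟨⟨f, hf, rfl⟩, -⟩
      exact ⟨f, hf, by rw [Function.update_of_ne (hne f hf)]⟩
    · rintro ⟨f, hf, rfl⟩
      refine ⟨⟨f, hf, by rw [Function.update_of_ne (hne f hf)]⟩, by simpa using hne f hf⟩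
  memV x := by
    have hne : ∀ f ∈ G.edges, f ≠ e := fun f hf h => he (h ▸ hf)
    simp only [mem_addIncT I.sortV, I.memV, Hypergraph.addHyperedge, Finset.exists_mem_insert,
      Function.update_self, List.mem_toFinset, List.mem_map, exists_exists_and_eq_and]
    refine or_congr_right ⟨?_, ?_⟩
    · rintro ⟨⟨f, hf, v, hv, rfl⟩, -⟩
      exact ⟨f, hf, v, by rwa [Function.update_of_ne (hne f hf)], rfl⟩
    · rintro ⟨f, hf, v, hv, rfl⟩
      rw [Function.update_of_ne (hne f hf)] at hv
      refine ⟨⟨f, hf, v, hv, rfl⟩, ?_⟩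
      rintro _ ⟨w, hw, rfl⟩
      simp [hne f hf]
  X_nil f hf := by
    simp only [Hypergraph.addHyperedge, Finset.mem_insert, not_or] at hf
    rw [Function.update_of_ne hf.1, I.X_nil f hf.2]
  X_len f := by
    by_cases hf : f = e
    · subst hf; simpa using hr
    · rw [Function.update_of_ne hf]; exact I.X_len f
  X_inc f hf v := by
    simp only [Hypergraph.addHyperedge, Finset.mem_insert] at hf ⊢
    by_cases hfe : f = e
    · subst hfe; simp
    · rw [Function.update_of_ne hfe, Function.update_of_ne hfe]
      exact I.X_inc f (hf.resolve_left hfe) v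

theorem deleteHyperedge (I : GraphInv r G X TE TV) (he : e ∈ G.edges) :
    GraphInv r (G.deleteHyperedge e) (Function.update X e [])
      (TE.del (pair (num e) (num 0))) (delIncT (num e) (nums (X e)) TV) where
  balE := I.balE.del _
  balV := balanced_delIncT I.balV
  sortE := I.sortE.del _
  sortV := sorted_delIncT I.sortV
  memE x := by
    simp only [Tree.mem_del I.sortE, I.memE, Hypergraph.deleteHyperedge, Finset.mem_erase]
    constructor
    · rintro ⟨⟨f, hf, rfl⟩, h⟩
      have h : f ≠ e := by simpa using h
      exact ⟨f, ⟨h, hf⟩, by rw [Function.update_of_ne h]⟩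
    · rintro ⟨f, ⟨h, hf⟩, rfl⟩
      exact ⟨⟨f, hf, by rw [Function.update_of_ne h]⟩, by simpa using h⟩
  memV x := by
    simp only [mem_delIncT I.sortV, I.memV, Hypergraph.deleteHyperedge, Finset.mem_erase,
      List.mem_map]
    constructor
    · rintro ⟨⟨f, hf, v, hv, rfl⟩, h⟩
      refine ⟨f, ⟨?_, hf⟩, v, hv, rfl⟩
      rintro rfl
      exact h (num v) ⟨v, (I.X_inc f hf v).2 hv, rfl⟩ rfl
    · rintro ⟨f, ⟨h, hf⟩, v, hv, rfl⟩
      refine ⟨⟨f, hf, v, hv, rfl⟩, ?_⟩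
      rintro _ ⟨w, hw, rfl⟩
      simp [h]
  X_nil f hf := by
    by_cases hfe : f = e
    · subst hfe; simp
    · rw [Function.update_of_ne hfe]
      exact I.X_nil f fun h => hf (Finset.mem_erase.2 ⟨hfe, h⟩)
  X_len f := by
    by_cases hf : f = e
    · subst hf; simp
    · rw [Function.update_of_ne hf]; exact I.X_len f
  X_inc f hf v := by
    obtain ⟨h, hf⟩ := Finset.mem_erase.1 hf
    rw [Function.update_of_ne h]
    exact I.X_inc f hf v

theorem length_TE_le (I : GraphInv r G X TE TV) : TE.toList.length ≤ G.edges.card := by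
  have : TE.toList ⊆ G.edges.toList.map
      fun e => pair (pair (num e) (num 0)) (ofVals (nums (X e))) := by
    intro x hx
    obtain ⟨e, he, rfl⟩ := (I.memE x).1 hx
    exact List.mem_map.2 ⟨e, by simpa using he, rfl⟩
  simpa using (List.subperm_of_subset I.sortE.nodup this).length_le

theorem length_TV_le (I : GraphInv r G X TE TV) : TV.toList.length ≤ G.edges.card * r := by
  have : TV.toList ⊆ G.edges.toList.flatMap
      fun e => (X e).map fun v => pair (pair (num v) (num e)) (num e) := by
    intro x hx
    obtain ⟨e, he, v, hv, rfl⟩ := (I.memV x).1 hx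
    exact List.mem_flatMap.2 ⟨e, by simpa using he,
      List.mem_map.2 ⟨v, (I.X_inc e he v).2 hv, rfl⟩⟩
  refine (List.subperm_of_subset I.sortV.nodup this).length_le.trans ?_
  rw [List.length_flatMap]
  refine (List.sum_le_card_nsmul _ r ?_).trans (by simp)
  intro n hn
  obtain ⟨e, -, rfl⟩ := List.mem_map.1 hn
  simpa using I.X_len e

end GraphInv

/-! ### Updates of the stored sets -/

/-- The entry for the set `A` of hyperedges of `G`. -/
def entryOf (G : Hypergraph) (A : Finset ℕ) : Val :=
  setEntry (ofVals (nums (desc (G.bd A)))) (nums (asc A))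

theorem entryOf_snd {G : Hypergraph} {A : Finset ℕ} :
    (entryOf G A).snd.toVals.length = A.card := by simp [entryOf, setEntry]

/-- A set of at most `s` elements arises in `s` rounds, each of which adds one of the elements of
`E` or none. The bound is polynomial in `E.card`, which keeps the tree of sets at logarithmic
height. -/
theorem exists_list_subsets (E : Finset ℕ) (s : ℕ) :
    ∃ L : List (Finset ℕ), L.length ≤ (E.card + 1) ^ s ∧ ∀ A ⊆ E, A.card ≤ s → A ∈ L := by
  induction s with
  | zero => exact ⟨[∅], by simp, by simp⟩
  | succ s ih =>
    obtain ⟨L, h1, h2⟩ := ih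
    refine ⟨L ++ E.toList.flatMap fun e => L.map (insert e), ?_, ?_⟩
    · simp only [List.length_append, List.length_flatMap, List.length_map, List.map_const',
        List.sum_replicate, Finset.length_toList, smul_eq_mul]
      calc _ = L.length * (E.card + 1) := by ring
        _ ≤ _ := by rw [pow_succ]; exact Nat.mul_le_mul_right _ h1
    · intro A hA hs
      rcases A.eq_empty_or_nonempty with rfl | ⟨e, he⟩
      · exact List.mem_append_left _ (h2 _ hA (by simp))
      · refine List.mem_append_right _ (List.mem_flatMap.2 ⟨e, by simpa using hA he,
          List.mem_map.2 ⟨A.erase e, h2 _ ((Finset.erase_subset _ _).trans hA) ?_,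
            Finset.insert_erase he⟩⟩)
        rw [Finset.card_erase_of_mem he]
        omega

section SetUpdates

variable {G G' H K : Hypergraph} {O : Oracle} {s₁ s k r e : ℕ} {TE TV TE' TV' TF TW : Tree}
  {X X' : ℕ → List ℕ} {ω : Val → Bool × ℕ}

theorem length_TF_le (hs : TF.Sorted)
    (hF : ∀ x, x ∈ TF.toList ↔ ∃ A, Qualifies G O s k A ∧ x = entryOf G A) :
    TF.toList.length ≤ (G.edges.card + 1) ^ s := by
  obtain ⟨L, h1, h2⟩ := exists_list_subsets G.edges s
  have : TF.toList ⊆ L.map (entryOf G) := by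
    intro x hx
    obtain ⟨A, hA, rfl⟩ := (hF x).1 hx
    exact List.mem_map.2 ⟨A, h2 A hA.1.1 hA.2.1, rfl⟩
  refine (List.subperm_of_subset hs.nodup this).length_le.trans ?_
  simpa using h1

/-- The keys of the witnesses are distinct, and each of them is the boundary key of some stored set.
-/
theorem SetsInv.length_le (h : SetsInv s TF TW) : TW.toList.length ≤ TF.toList.length := by
  have hnd : (TW.toList.map Val.fst).Nodup := by
    have := h.sortW
    rw [List.Nodup, List.pairwise_map]
    exact List.Pairwise.imp (fun h => Val.cmp_ne h) this
  have : TW.toList.map Val.fst ⊆ TF.toList.map fun x => x.fst.fst := by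
    intro B hB
    obtain ⟨x, hx, rfl⟩ := List.mem_map.1 hB
    obtain ⟨w, -, l, -, h0, hl, -⟩ := (h.wit x.fst).good x hx rfl
    obtain ⟨A, hA⟩ := List.exists_mem_of_ne_nil l h0
    exact List.mem_map.2 ⟨_, hl A hA, rfl⟩
  simpa using (List.subperm_of_subset hnd this).length_le

/-- The oracle sees `A` only through its labelled hyperedges and its boundary, neither of which
changes outside of the ball. This is the one place where that assumption on the oracle is needed for
locality. -/
theorem Hypergraph.IsDeletion.qualifies_iff {ball : ℕ → Finset ℕ} (h : IsDeletion H K e)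
    (hb : IsBall H e s ball) {A : Finset ℕ} (hs : A.card ≤ s) (hA : ¬ A ⊆ ball s) :
    (Qualifies H O s k A ↔ Qualifies K O s k A) ∧ (Qualifies K O s k A → entryOf H A = entryOf K A) := by
  have key : H.InternallyConnected A ∨ K.InternallyConnected A →
      H.bd A = K.bd A ∧ (H.InternallyConnected A ↔ K.InternallyConnected A) ∧
      (oracleHolds O H A ↔ oracleHolds O K A) := by
    intro hc
    obtain ⟨h1, h2, h3, h4⟩ := h.local hb hs hA hc
    refine ⟨h3, h4, ?_⟩
    have : H.labelled A = K.labelled A := by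
      refine Finset.image_congr fun f hf => ?_
      rw [h.inc f]
      rintro rfl
      exact h1 hf
    simp only [oracleHolds, this, h3]
  refine ⟨⟨fun hq => ?_, fun hq => ?_⟩, fun hq => ?_⟩
  · obtain ⟨h1, h2, h3⟩ := key (.inl hq.1)
    exact ⟨h2.1 hq.1, hs, by rw [Hypergraph.lam, ← h1]; exact hq.2.2.1, h3.1 hq.2.2.2⟩
  · obtain ⟨h1, h2, h3⟩ := key (.inr hq.1)
    exact ⟨h2.2 hq.1, hs, by rw [Hypergraph.lam, h1]; exact hq.2.2.1, h3.2 hq.2.2.2⟩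
  · rw [entryOf, (key (.inr hq.1)).1, entryOf]

theorem GraphInv.entry_eq (I : GraphInv r G X TE TV) {A : Finset ℕ} (hA : A ⊆ G.edges)
    (hs : A.card ≤ s) :
    setEntry (ofVals (bdL (nbT (s + 1) TV) (vsT TE) (nums (asc A)))) (nums (asc A)) =
      entryOf G A := by
  rw [(I.represents (s + 1)).bdL_nums (by simpa using hA) (by simp; omega), toFinset_asc, entryOf]

/-- The update of the sets and witnesses is correct if nothing changes apart from the candidates. -/
theorem SetsInv.upd {K' : ℕ} {ball : Finset ℕ} {cs : List (List Val)} (h : SetsInv s₁ TF TW)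
    (hs : s₁ ≤ s)
    (I : GraphInv r G X TE TV) (I' : GraphInv r G' X' TE' TV') (hω : OracleBehaviour O s K' G' ω)
    (hF : ∀ x, x ∈ TF.toList ↔ ∃ A, Qualifies G O s k A ∧ x = entryOf G A)
    (hcs : ∀ L, L ∈ cs ↔ ∃ C, C ⊆ ball ∧ C.card ≤ s ∧ L = nums (asc C))
    (hloc : ∀ A, A.card ≤ s → ¬ A ⊆ ball → (Qualifies G O s k A ↔ Qualifies G' O s k A) ∧
      (Qualifies G O s k A → entryOf G A = entryOf G' A)) :
    SetsInv s₁ (updT ω (s + 1) s₁ k cs TE TV TE' TV' TF TW).1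
      (updT ω (s + 1) s₁ k cs TE TV TE' TV' TF TW).2 ∧
    ∀ x, x ∈ (updT ω (s + 1) s₁ k cs TE TV TE' TV' TF TW).1.toList ↔
      ∃ A, Qualifies G' O s k A ∧ x = entryOf G' A := by
  have hN : s₁ < s + 1 := by omega
  obtain ⟨h1, h2⟩ := h.remAll (TE := TE) (TV := TV) hN cs
  obtain ⟨h3, h4⟩ := h1.insAll (ω := ω) (k := k) (TE := TE') (TV := TV') hN cs
  refine ⟨h3, fun x => (h4 x).trans ?_⟩
  rw [h2, hF]
  constructor
  · rintro (⟨L, hL, hq, rfl⟩ | ⟨⟨⟨A, hA, rfl⟩, h5⟩, -⟩)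
    · obtain ⟨C, -, hC, rfl⟩ := (hcs L).1 hL
      rw [qualL_iff I' hω hC] at hq
      exact ⟨C, hq, I'.entry_eq hq.1.1 hC⟩
    · have hb : ¬ A ⊆ ball := by
        intro hb
        refine h5 _ ((hcs _).2 ⟨A, hb, hA.2.1, rfl⟩) ?_
        rw [← I.entry_eq hA.1.1 hA.2.1]
        rfl
      obtain ⟨h6, h7⟩ := hloc A hA.2.1 hb
      exact ⟨A, h6.1 hA, h7 hA⟩
  · rintro ⟨A, hA, rfl⟩
    by_cases hb : A ⊆ ball
    · refine .inl ⟨_, (hcs _).2 ⟨A, hb, hA.2.1, rfl⟩, (qualL_iff I' hω hA.2.1).2 hA,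
        (I'.entry_eq hA.1.1 hA.2.1).symm⟩
    · obtain ⟨h6, h7⟩ := hloc A hA.2.1 hb
      -- A candidate may contain a hyperedge that is absent from the old hypergraph, and then the
      -- boundary computed for its removal is meaningless. But keys also contain the set itself, so
      -- no entry for a set outside of the ball is affected.
      have hne : ∀ L ∈ cs, nums (asc A) ≠ L := by
        intro L hL hAL
        obtain ⟨C, hC, -, rfl⟩ := (hcs L).1 hL
        rw [asc_injective (nums_injective hAL)] at hb
        exact hb hC
      refine .inr ⟨⟨⟨A, h6.2 hA, (h7 (h6.2 hA)).symm⟩, fun L hL hk => hne L hL ?_⟩,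
        fun L hL _ hk => hne L hL ?_⟩
      · simp only [entryOf, setEntry, fst_pair, pair.injEq] at hk
        exact ofVals_injective hk.2
      · exact (setEntry_inj.1 hk).2

end SetUpdates

/-- The set of vertices described by a log of insertions `(1, v)` and deletions `(0, v)`. -/
def logVerts : Val → Finset ℕ
  | pair (pair (num 0) (num v)) log => (logVerts log).erase v
  | pair (pair (num _) (num v)) log => insert v (logVerts log)
  | _ => ∅

/-- Correctness of the stored data. -/
structure Inv (r s₁ s k : ℕ) (O : Oracle) (G : Hypergraph) (X : ℕ → List ℕ) (log : Val)
    (TE TV TF TW : Tree) : Prop where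
  log : logVerts log = G.verts
  graph : GraphInv r G X TE TV
  sets : SetsInv s₁ TF TW
  memF : ∀ x, x ∈ TF.toList ↔ ∃ A, Qualifies G O s k A ∧ x = entryOf G A

/-! ### The invariant and its preservation -/

section Inv

variable {r s₁ s k : ℕ} {O : Oracle} {G : Hypergraph} {X : ℕ → List ℕ} {log : Val}
  {TE TV TF TW : Tree}

theorem inv_empty : Inv r s₁ s k O Hypergraph.empty (fun _ => []) (num 0) .leaf .leaf .leaf .leaf where
  log := rfl
  graph := by constructor <;> simp [Tree.Balanced, Tree.sorted_leaf, Hypergraph.empty]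
  sets := by
    refine ⟨trivial, trivial, Tree.sorted_leaf, Tree.sorted_leaf, by simp [SetShape], fun B => ?_⟩
    refine ⟨by simp, fun _ hs l _ hl => ?_⟩
    have : l = [] := List.eq_nil_iff_forall_not_mem.2 fun A hA => by simpa [family] using hl A hA
    subst this
    exact hs
  memF x := by
    simp only [Tree.toList_leaf, List.not_mem_nil, false_iff, not_exists, not_and]
    rintro A ⟨⟨h1, h2, -⟩, -⟩
    simp only [Hypergraph.empty, Finset.subset_empty] at h1
    simp [h1] at h2

theorem Inv.addVertex (I : Inv r s₁ s k O G X log TE TV TF TW) (v : ℕ) :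
    Inv r s₁ s k O (G.addVertex v) X (pair (pair (num 1) (num v)) log) TE TV TF TW where
  log := by simp [logVerts, Hypergraph.addVertex, I.log]
  graph := ⟨I.graph.balE, I.graph.balV, I.graph.sortE, I.graph.sortV, I.graph.memE, I.graph.memV,
    I.graph.X_nil, I.graph.X_len, I.graph.X_inc⟩
  sets := I.sets
  memF := I.memF

theorem Inv.deleteVertex (I : Inv r s₁ s k O G X log TE TV TF TW) (v : ℕ)
    (hv : ∀ e ∈ G.edges, v ∉ G.inc e) :
    Inv r s₁ s k O (G.deleteVertex v hv) X (pair (pair (num 0) (num v)) log) TE TV TF TW where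
  log := by simp [logVerts, Hypergraph.deleteVertex, I.log]
  graph := ⟨I.graph.balE, I.graph.balV, I.graph.sortE, I.graph.sortV, I.graph.memE, I.graph.memV,
    I.graph.X_nil, I.graph.X_len, I.graph.X_inc⟩
  sets := I.sets
  memF := I.memF

/-- An insertion is a deletion read backwards: the ball is taken in the new hypergraph, and the
equivalences for sets outside of it are reversed. -/
theorem Inv.addHyperedge (I : Inv r s₁ s k O G X log TE TV TF TW) (hs : s₁ ≤ s) {e K : ℕ}
    {l : List ℕ} (he : e ∉ G.edges) (hr : l.length ≤ r) (hV : l.toFinset ⊆ G.verts)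
    {ω : Val → Bool × ℕ} (hω : OracleBehaviour O s K (G.addHyperedge e l.toFinset hV) ω)
    {TE' TV' : Tree} (hE : TE' = TE.ins (pair (pair (num e) (num 0)) (ofVals (nums l))))
    (hT : TV' = addIncT (num e) (nums l) TV) {P : Tree × Tree}
    (hP : P = updT ω (s + 1) s₁ k (candidates (s + 1) TE' TV' (num e)) TE TV TE' TV' TF TW) :
    Inv r s₁ s k O (G.addHyperedge e l.toFinset hV) (Function.update X e l) log TE' TV' P.1 P.2 := by
  have I' := I.graph.addHyperedge he hr hV
  rw [← hE, ← hT] at I'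
  obtain ⟨ball, hb, hcs⟩ := mem_candidates (s := s) I' e
  have hd : Hypergraph.IsDeletion (G.addHyperedge e l.toFinset hV) G e :=
    ⟨by simp [Hypergraph.addHyperedge], by simp [Hypergraph.addHyperedge, he],
      fun f hf => by simp [Hypergraph.addHyperedge, hf]⟩
  obtain ⟨h1, h2⟩ := I.sets.upd hs I.graph I' hω I.memF hcs fun A hA hA' => by
    obtain ⟨h1, h2⟩ := hd.qualifies_iff (O := O) (k := k) hb hA hA'
    exact ⟨h1.symm, fun h => (h2 h).symm⟩
  subst hP
  exact ⟨I.log, I', h1, h2⟩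

theorem Inv.deleteHyperedge (I : Inv r s₁ s k O G X log TE TV TF TW) (hs : s₁ ≤ s) {e K : ℕ}
    (he : e ∈ G.edges) {ω : Val → Bool × ℕ} (hω : OracleBehaviour O s K (G.deleteHyperedge e) ω)
    {TE' TV' : Tree} (hE : TE' = TE.del (pair (num e) (num 0)))
    (hT : TV' = delIncT (num e) (nums (X e)) TV) {P : Tree × Tree}
    (hP : P = updT ω (s + 1) s₁ k (candidates (s + 1) TE TV (num e)) TE TV TE' TV' TF TW) :
    Inv r s₁ s k O (G.deleteHyperedge e) (Function.update X e []) log TE' TV' P.1 P.2 := by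
  have I' := I.graph.deleteHyperedge he
  rw [← hE, ← hT] at I'
  obtain ⟨ball, hb, hcs⟩ := mem_candidates (s := s) I.graph e
  have hd : Hypergraph.IsDeletion G (G.deleteHyperedge e) e := ⟨he, rfl, fun f hf => rfl⟩
  obtain ⟨h1, h2⟩ := I.sets.upd hs I.graph I' hω I.memF hcs fun A hA hA' => by
    obtain ⟨h1, h2⟩ := hd.qualifies_iff (O := O) (k := k) hb hA hA'
    exact ⟨h1, fun h => h2 (h1.1 h)⟩
  subst hP
  exact ⟨I.log, I', h1, h2⟩

end Inv
end DynLocalSearch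

namespace DynLocalSearch
open Val

/-! ### Correctness of the queries -/

section Query

variable {r s₁ s k : ℕ} {O : Oracle} {G : Hypergraph} {X : ℕ → List ℕ} {log : Val}
  {TE TV TF TW : Tree}

theorem mem_family_iff (hF : ∀ x, x ∈ TF.toList ↔ ∃ A, Qualifies G O s k A ∧ x = entryOf G A)
    {B : Val} {L : List Val} : L ∈ family TF B ↔
      ∃ A, Qualifies G O s k A ∧ B = ofVals (nums (desc (G.bd A))) ∧ L = nums (asc A) := by
  simp only [family, Set.mem_ofPred_eq, hF, entryOf, setEntry_inj]

/-- The empty set has no internal components, so the conditions on them hold vacuously. -/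
theorem eligible_empty : Eligible G O k ∅ := by
  have h : ∀ C', ¬ G.IsInternalComponent ∅ C' := by
    rintro C' ⟨⟨h1, -, h2, -⟩, -⟩
    rw [Finset.subset_empty.1 h1] at h2
    simp at h2
  exact ⟨by simp, by simp [Hypergraph.lam, Hypergraph.bd, Hypergraph.vertsOf],
    fun C' h' => absurd h' (h C'), fun C' h' => absurd h' (h C')⟩

/-- The components of an eligible set are stored, with its boundary. -/
theorem Eligible.card_lt {C : Finset ℕ} (h : Eligible G O k C) (hs : C.card ≤ s)
    (hF : ∀ x, x ∈ TF.toList ↔ ∃ A, Qualifies G O s k A ∧ x = entryOf G A)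
    (hsm : SmallFamily s₁ (family TF (ofVals (nums (desc (G.bd C)))))) : C.card < s₁ := by
  classical
  obtain ⟨hC, hk, h1, h2⟩ := h
  set D := C.powerset.filter fun C' => G.IsInternalComponent C C' with hD
  have hmem : ∀ C', C' ∈ D ↔ G.IsInternalComponent C C' := by
    intro C'
    simp only [hD, Finset.mem_filter, Finset.mem_powerset, and_iff_right_iff_imp]
    exact fun h => h.1.1
  have hlt := hsm (D.toList.map fun A => nums (asc A))
    ((Finset.nodup_toList D).map fun A A' h => asc_injective (nums_injective h)) (by
      intro L hL
      obtain ⟨C', hC', rfl⟩ := List.mem_map.1 hL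
      have hc := (hmem C').1 (by simpa using hC')
      refine (mem_family_iff hF).2 ⟨C', ⟨hc.1.2, (Finset.card_le_card hc.1.1).trans hs, ?_, h2 _ hc⟩,
        by rw [h1 _ hc], rfl⟩
      rw [Hypergraph.lam, h1 _ hc]
      exact hk)
  refine lt_of_le_of_lt ?_ hlt
  -- The components cover `C`, so their sizes add up to at least `C.card`; disjointness is not
  -- required.
  have hsub : C ⊆ D.biUnion id := by
    intro c hc
    obtain ⟨C', h3, h4⟩ := Hypergraph.exists_component hC hc
    exact Finset.mem_biUnion.2 ⟨C', (hmem C').2 h3, h4⟩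
  refine (Finset.card_le_card hsub).trans (Finset.card_biUnion_le.trans (le_of_eq ?_))
  rw [List.length_flatten, List.map_map, Finset.sum_eq_multiset_sum, ← Finset.coe_toList D,
    Multiset.map_coe, Multiset.sum_coe]
  simp [Function.comp_def]

theorem exists_nums_perm {w : List Val} {l : List ℕ} (h : w.Perm (nums l)) :
    ∃ w', w = nums w' ∧ w'.Perm l := by
  induction l generalizing w with
  | nil => exact ⟨[], by simpa using h, .refl _⟩
  | cons a l ih =>
    have ha : num a ∈ w := h.mem_iff.2 (by simp)
    obtain ⟨u, v, rfl⟩ := List.append_of_mem ha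
    have h1 : (u ++ v).Perm (nums l) :=
      (List.perm_cons (num a)).1 ((List.perm_middle.symm).trans h)
    obtain ⟨w', h2, h3⟩ := ih h1
    obtain ⟨u', v', rfl, rfl, rfl⟩ := List.map_eq_append_iff.1 h2.symm
    exact ⟨u' ++ a :: v', by simp, List.perm_middle.trans (h3.cons a)⟩

/-- A witness describes an eligible set. -/
theorem GoodWitness.eligible {B : Val} {w : List Val} (h : GoodWitness s₁ (family TF B) w)
    (hs : s₁ ≤ s) (hF : ∀ x, x ∈ TF.toList ↔ ∃ A, Qualifies G O s k A ∧ x = entryOf G A) :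
    ∃ l : List ℕ, w = nums l ∧ l.Nodup ∧ (s₁ : ℚ) / 2 ≤ (l.toFinset.card : ℚ) ∧
      l.toFinset.card ≤ s ∧ Eligible G O k l.toFinset := by
  obtain ⟨l, hnd, h0, hmem, hperm, hlow, hcase⟩ := h
  obtain ⟨L, rfl⟩ : ∃ L : List (Finset ℕ), l = L.map fun A => nums (asc A) := by
    have : ∀ l : List (List Val), (∀ A ∈ l, A ∈ family TF B) →
        ∃ L : List (Finset ℕ), l = L.map fun A => nums (asc A) := by
      intro l
      induction l with
      | nil => exact fun _ => ⟨[], rfl⟩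
      | cons A l ih =>
        intro h
        obtain ⟨L, rfl⟩ := ih fun A hA => h A (by simp [hA])
        obtain ⟨S, -, -, rfl⟩ := (mem_family_iff hF).1 (h A (by simp))
        exact ⟨S :: L, rfl⟩
    exact this l hmem
  have hinj : Function.Injective fun A => nums (asc A) :=
    fun A A' h => asc_injective (nums_injective h)
  have hndL : L.Nodup := hnd.of_map _
  have hmemL : ∀ A ∈ L, Qualifies G O s k A ∧ B = ofVals (nums (desc (G.bd A))) := by
    intro A hA
    obtain ⟨A', h1, h2, h3⟩ := (mem_family_iff hF).1 (hmem _ (List.mem_map_of_mem hA))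
    rw [hinj h3]
    exact ⟨h1, h2⟩
  obtain ⟨A₀, hA₀⟩ : ∃ A, A ∈ L := List.exists_mem_of_ne_nil L (by simpa using h0)
  have hbdB : ∀ A, B = ofVals (nums (desc (G.bd A))) → G.bd A = G.bd A₀ := by
    intro A hA
    rw [(hmemL A₀ hA₀).2] at hA
    exact (desc_injective (nums_injective (ofVals_injective hA))).symm
  have hfl : (L.map fun A => nums (asc A)).flatten = nums (L.flatMap asc) := by
    rw [nums, List.map_flatMap, List.flatMap_def]
  rw [hfl] at hperm
  obtain ⟨w, rfl, hp⟩ := exists_nums_perm hperm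
  have hset : w.toFinset = L.toFinset.biUnion id := by
    ext x
    simp [hp.mem_iff]
  -- Distinct members of the group are disjoint, so the concatenated lists have no repetitions and
  -- the length of the witness is the size of the set.
  have hwnd : w.Nodup := by
    rw [hp.nodup_iff, List.nodup_flatMap]
    refine ⟨fun A _ => asc_nodup A, ?_⟩
    refine hndL.imp_of_mem fun {A A'} hA hA' hne => ?_
    simp only [Function.onFun, List.disjoint_iff_ne]
    rintro x hx _ hx' rfl
    refine hne ((hmemL A hA).1.1.eq_of_inter (hmemL A' hA').1.1 ?_ ⟨x, by simp_all⟩)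
    rw [hbdB A (hmemL A hA).2, hbdB A' (hmemL A' hA').2]
  have hcard : w.toFinset.card = w.length := List.toFinset_card_of_nodup hwnd
  obtain ⟨hb, hcomp⟩ := Hypergraph.components_biUnion (G := G) (B := G.bd A₀) (F := L.toFinset)
    ⟨A₀, by simpa using hA₀⟩
    (fun A hA => ⟨(hmemL A (by simpa using hA)).1.1, hbdB A (hmemL A (by simpa using hA)).2⟩) (by
      rcases hcase with ⟨A, hA⟩ | ⟨-, A, hA, hA'⟩
      · left
        obtain ⟨S, hS, -⟩ := List.map_eq_singleton_iff.1 hA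
        exact ⟨S, by simp [hS]⟩
      · right
        obtain ⟨S, h1, h2, rfl⟩ := (mem_family_iff hF).1 hA
        refine ⟨S, h1.1, hbdB S h2, fun h => hA' (List.mem_map_of_mem (by simpa using h))⟩)
  rw [← hset] at hb hcomp
  refine ⟨w, rfl, hwnd, ?_, ?_, ?_, ?_, ?_, ?_⟩
  · rw [hcard, div_le_iff₀ (by norm_num)]
    simp only [List.length_map] at hlow
    exact_mod_cast (by omega : s₁ ≤ w.length * 2)
  · rw [hcard]
    -- A single stored set has at most `s` elements because it qualifies; a proper union has at most
    -- `s₁ ≤ s`.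
    rcases hcase with ⟨A, hA⟩ | ⟨h1, -⟩
    · obtain ⟨S, rfl, -⟩ := List.map_eq_singleton_iff.1 hA
      rw [hp.length_eq]
      simpa using (hmemL S (by simp)).1.2.1
    · simp only [List.length_map] at h1
      omega
  · intro x hx
    rw [hset, Finset.mem_biUnion] at hx
    obtain ⟨A, hA, hx⟩ := hx
    exact (hmemL A (by simpa using hA)).1.1.1 hx
  · rw [Hypergraph.lam, hb]
    exact (hmemL A₀ hA₀).1.2.2.1
  · intro C' hC'
    have := hcomp C' hC'
    rw [hb, hbdB C' (hmemL C' (by simpa using this)).2]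
  · intro C' hC'
    have := hcomp C' hC'
    exact (hmemL C' (by simpa using this)).1.2.2.2

/-- The output of a query. -/
def queryT (s₁ : ℕ) (TW : Tree) : Val :=
  if s₁ = 0 then pair (num 1) (num 0)
  else match TW with
    | .leaf => num 0
    | .node _ kv _ _ => pair (num 1) kv.snd

/-- An empty witness tree says that every family is small, in particular the one for `bd C`, which
rules out an eligible `C` with `s₁ ≤ C.card ≤ s`. Otherwise the witness at the root is eligible. -/
theorem Inv.queryCorrect (I : Inv r s₁ s k O G X log TE TV TF TW) (hs : s₁ ≤ s) :
    QueryCorrect G O s₁ s k (queryT s₁ TW) := by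
  unfold queryT
  split_ifs with h0
  · subst h0
    exact .inl ⟨[], rfl, by simp, by simp, by simp, by simpa using eligible_empty⟩
  · cases TW with
    | leaf =>
      refine .inr ⟨rfl, ?_⟩
      rintro ⟨C, h1, h2, h3⟩
      have := h3.card_lt h2 I.memF ((I.sets.wit _).small (by simp) (by omega))
      omega
    | node h kv l r =>
      obtain ⟨w, hw, hg⟩ := (I.sets.wit kv.fst).good kv (by simp) rfl
      obtain ⟨u, rfl, hu⟩ := hg.eligible hs I.memF
      refine .inl ⟨u, ?_, hu⟩
      rw [hw, ofList_eq]
      rfl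

end Query

/-! ### Decoding -/

/-- The number stored in a value. -/
def Val.toNat : Val → ℕ
  | num n => n
  | pair _ _ => 0

/-- The labelled hyperedge described by an entry. -/
def labelOf (x : Val) : ℕ × Finset ℕ := (x.fst.fst.toNat, (x.snd.toVals.map Val.toNat).toFinset)

/-- The labelled hyperedges in the entries of a tree. -/
def treeLabels : Val → Finset (ℕ × Finset ℕ)
  | pair _ (pair x (pair l r)) => insert (labelOf x) (treeLabels l ∪ treeLabels r)
  | _ => ∅

/-- The hypergraph described by the stored value. -/
def decodeState (σ : Val) : Finset ℕ × Finset (ℕ × Finset ℕ) :=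
  (logVerts σ.fst, treeLabels σ.snd.snd.fst.fst)

theorem mem_treeLabels {t : Tree} {y : ℕ × Finset ℕ} :
    y ∈ treeLabels t.enc ↔ ∃ x ∈ t.toList, y = labelOf x := by
  induction t with
  | leaf => simp [Tree.enc, treeLabels]
  | node h kv l r ihl ihr =>
    simp only [Tree.enc, treeLabels, Finset.mem_insert, Finset.mem_union, ihl, ihr,
      Tree.toList_node, List.mem_append, List.mem_cons, or_and_right, exists_or, exists_eq_left]
    exact or_left_comm

theorem GraphInv.treeLabels_eq {r : ℕ} {G : Hypergraph} {X : ℕ → List ℕ} {TE TV : Tree}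
    (I : GraphInv r G X TE TV) : treeLabels TE.enc = G.labelled G.edges := by
  have h : ∀ e ∈ G.edges,
      labelOf (pair (pair (num e) (num 0)) (ofVals (nums (X e)))) = (e, G.inc e) := by
    intro e he
    simp only [labelOf, fst_pair, snd_pair, toVals_ofVals, List.map_map, Val.toNat, Prod.mk.injEq,
      true_and]
    ext v
    simp [Val.toNat, I.X_inc e he v]
  ext y
  simp only [mem_treeLabels, I.memE, Hypergraph.labelled, Finset.mem_image]
  constructor
  · rintro ⟨_, ⟨e, he, rfl⟩, rfl⟩
    exact ⟨e, he, (h e he).symm⟩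
  · rintro ⟨e, he, rfl⟩
    exact ⟨_, ⟨e, he, rfl⟩, (h e he).symm⟩

end DynLocalSearch

namespace DynLocalSearch
open Prog Val

/-! ### Time bounds -/

/-- A bound for the sizes of all small objects. -/
def sizeBound (r s : ℕ) : ℕ :=
  2 ^ ((1 + r * (s + 1)) ^ s + 1) + (2 * (s * r) + 2 * s + 3) + 2 ^ (s + 1) + r + (s + 2)

theorem le_sizeBound (r s : ℕ) : 2 ^ ((1 + r * (s + 1)) ^ s + 1) ≤ sizeBound r s ∧
    2 * (s * r) + 2 * s + 3 ≤ sizeBound r s ∧ 2 ^ (s + 1) ≤ sizeBound r s ∧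
    r + 1 ≤ sizeBound r s ∧ s + 2 ≤ sizeBound r s ∧ 3 ≤ sizeBound r s := by
  unfold sizeBound
  generalize 2 ^ ((1 + r * (s + 1)) ^ s + 1) = a
  generalize 2 ^ (s + 1) = b
  generalize s * r = c
  omega

/-- The factor at the logarithm in the bound for the heights of trees and the oracle time. -/
def heightFactor (r s K : ℕ) : ℕ := 4 * (s + r + 1) + 4 * sizeBound r s + 6 + 2 * K

/-- The factor at the logarithm in the bound for the updates. -/
def timeFactor (r s K : ℕ) : ℕ := 80000 * (sizeBound r s ^ 6 * heightFactor r s K)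

/-- A bound for the number of entries of a tree. -/
def entryBound (r s m : ℕ) : ℕ := (m + 2) ^ (s + r + 1) + (sizeBound r s + sizeBound r s)

theorem logTime_pos (m : ℕ) : 1 ≤ logTime m := Nat.log_pos (by norm_num) (by omega)

theorem logTime_mono {m n : ℕ} (h : m ≤ n) : logTime m ≤ logTime n :=
  Nat.log_mono_right (by omega)

/-- Update times refer to the hypergraph before the update, the oracle to the one after it. Their
sizes differ by at most one, so this factor `2` compensates for the difference. -/
theorem logTime_succ_le (m : ℕ) : logTime (m + 1) ≤ 2 * logTime m := by
  have h1 : logTime (m + 1) ≤ logTime m + 1 := by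
    unfold logTime
    rw [← Nat.log_mul_base (by norm_num) (by omega)]
    exact Nat.log_mono_right (by omega)
  have := logTime_pos m
  omega

/-- The height is at most about twice the binary logarithm of the number of entries, and that number
is a power of `m + 2` of fixed degree plus a constant. The term `2 * K` of the factor is not needed
here; it is reserved for the oracle, so that one bound covers heights and oracle calls. -/
theorem ht_lt {r s m K : ℕ} {t : Tree} (ht : t.Balanced)
    (hl : t.toList.length ≤ entryBound r s m) : t.ht < logTime m * heightFactor r s K := by
  have h1 := Tree.two_pow_le ht
  have hlg := logTime_pos m
  set lg := logTime m with hlgd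
  have h2 : m + 2 ≤ 2 ^ (2 * lg) := by
    refine (Nat.lt_pow_succ_log_self (b := 2) (by norm_num) (m + 2)).le.trans ?_
    refine Nat.pow_le_pow_right (by norm_num) ?_
    change lg + 1 ≤ 2 * lg
    omega
  have h3 : (m + 2) ^ (s + r + 1) ≤ 2 ^ (2 * lg * (s + r + 1)) := by
    rw [pow_mul]
    exact Nat.pow_le_pow_left h2 _
  have h4 : t.toList.length + 1 ≤
      2 ^ (2 * lg * (s + r + 1) + (2 * sizeBound r s + 2)) := by
    rw [pow_add]
    have h5 := Nat.lt_two_pow_self (n := 2 * sizeBound r s + 2)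
    have h6 : 1 ≤ 2 ^ (2 * lg * (s + r + 1)) := Nat.one_le_two_pow
    unfold entryBound at hl
    generalize 2 ^ (2 * lg * (s + r + 1)) = a at *
    generalize 2 ^ (2 * sizeBound r s + 2) = b at *
    have h7 : a + b ≤ a * b + 1 := by
      obtain ⟨a, rfl⟩ := Nat.exists_eq_add_of_le h6
      obtain ⟨b, rfl⟩ := Nat.exists_eq_add_of_le (show 1 ≤ b by omega)
      nlinarith [Nat.zero_le (a * b)]
    omega
  have h5 := (Nat.pow_le_pow_iff_right (by norm_num)).1 (h1.trans h4)
  have h6 : t.ht ≤ 2 * (2 * lg * (s + r + 1) + (2 * sizeBound r s + 2)) + 1 := by omega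
  refine h6.trans_lt ?_
  unfold heightFactor
  have h7 : lg * (4 * sizeBound r s + 6) ≥ 4 * sizeBound r s + 6 := Nat.le_mul_of_pos_left _ hlg
  have h8 : lg * (4 * (s + r + 1) + 4 * sizeBound r s + 6 + 2 * K) =
      2 * (2 * lg * (s + r + 1)) + lg * (4 * sizeBound r s + 6) + lg * (2 * K) := by ring
  omega

section Bounds

variable {r s₁ s k m : ℕ} {O : Oracle} {G : Hypergraph} {X : ℕ → List ℕ} {log : Val}
  {TE TV TF TW : Tree}

theorem pow_le_entryBound {a b : ℕ} (hb : b ≤ s + r + 1) (h : a ≤ (m + 2) ^ b) :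
    a + (sizeBound r s + sizeBound r s) ≤ entryBound r s m := by
  unfold entryBound
  have := Nat.pow_le_pow_right (n := m + 2) (by omega) hb
  omega

theorem GraphInv.length_le (I : GraphInv r G X TE TV) (hm : G.edges.card ≤ m + 1) :
    TE.toList.length ≤ entryBound r s m ∧ TV.toList.length ≤ entryBound r s m := by
  have h1 := I.length_TE_le
  have h2 := I.length_TV_le
  have h3 : (m + 1) * r ≤ (m + 2) ^ (r + 1) := by
    rw [pow_succ, Nat.mul_comm]
    refine Nat.mul_le_mul ?_ (by omega)
    exact (Nat.lt_two_pow_self).le.trans (Nat.pow_le_pow_left (by omega) _)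
  have h4 := Nat.mul_le_mul_right r hm
  have h5 : G.edges.card ≤ (m + 2) ^ 1 := by rw [pow_one]; omega
  have h6 := pow_le_entryBound (r := r) (s := s) (m := m) (b := 1) (by omega) h5
  have h7 := pow_le_entryBound (r := r) (s := s) (m := m) (b := r + 1) (by omega) h3
  omega

theorem GraphInv.tables_of_card (I : GraphInv r G X TE TV) (s K : ℕ) (hm : G.edges.card ≤ m + 1) :
    Tables (sizeBound r s) (logTime m * heightFactor r s K) r s (s + 1) TE TV := by
  obtain ⟨h1, h2⟩ := I.length_le (s := s) hm
  obtain ⟨-, z1, z2, z3, z4, z5⟩ := le_sizeBound r s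
  exact I.tables (by omega) (Nat.mul_pos (logTime_pos m) (by unfold heightFactor; omega))
    (by omega) z1 z2 (by omega) (ht_lt I.balE h1) (ht_lt I.balV h2)

theorem Inv.sets_of_card (I : Inv r s₁ s k O G X log TE TV TF TW) :
    Sets (entryBound r s G.edges.card) s (sizeBound r s + sizeBound r s) TF TW := by
  have h1 := length_TF_le I.sets.sortF I.memF
  have h2 := I.sets.length_le
  have h3 := pow_le_entryBound (r := r) (s := s) (m := G.edges.card) (b := s) (by omega)
    (Nat.pow_le_pow_left (by omega) _ : (G.edges.card + 1) ^ s ≤ _)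
  refine ⟨I.sets.balF, I.sets.balW, I.sets.sortF, I.sets.sortW, by omega, by omega, ?_⟩
  intro x hx
  obtain ⟨A, hA, rfl⟩ := (I.memF x).1 hx
  rw [entryOf_snd]
  exact hA.2.1

theorem oracle_time_le {K : ℕ} {ω : Val → Bool × ℕ} (I : GraphInv r G X TE TV)
    (hω : OracleBehaviour O s K G ω) (hm : G.edges.card ≤ m + 1) {A : Finset ℕ} (hA : A.card ≤ s)
    (hin : allInL TE (nums (asc A)) = true) :
    (ω (ofVals (nums (asc A)))).2 ≤ logTime m * heightFactor r s K := by
  have h := (hω (asc A) (asc_nodup A) (I.allInL_iff.1 hin) (by simpa using hA)).2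
  rw [ofList_eq] at h
  refine h.trans ?_
  calc K * logTime G.edges.card ≤ K * (2 * logTime m) :=
        Nat.mul_le_mul_left _ ((logTime_mono hm).trans (logTime_succ_le m))
    _ = logTime m * (2 * K) := by ring
    _ ≤ _ := Nat.mul_le_mul_left _ (by unfold heightFactor; omega)

end Bounds

/-! ### Simulation of the operations -/

/-- The stored value. -/
def encState (s₁ s k : ℕ) (log : Val) (TE TV TF TW : Tree) : Val :=
  pair log (pair (encPrm s₁ k (s + 1)) (pair (pair TE.enc TV.enc) (pair TF.enc TW.enc)))

section Operations

variable {r s₁ s k K : ℕ} {O : Oracle} {G : Hypergraph} {X : ℕ → List ℕ} {log : Val}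
  {TE TV TF TW : Tree} {ω : Val → Bool × ℕ}

theorem runs_start : ∃ t, searchStructure.RunsStart r s₁ s k
    (encState s₁ s k (num 0) .leaf .leaf .leaf .leaf) t ∧ t ≤ 100 := by
  refine runs_of_wp ?_
  simp [searchStructure, startC, Returns, encState, Val.ofList, Tree.enc]

theorem runs_addVertex (v : ℕ) : ∃ t, searchStructure.RunsUpdate ω
    (encState s₁ s k log TE TV TF TW) (.addVertex v)
    (encState s₁ s k (pair (pair (num 1) (num v)) log) TE TV TF TW) t ∧ t ≤ 100 := by
  refine runs_of_wp ?_
  simp [searchStructure, DataStructure.updateCode, Update.input, addVertexC, Returns, encState]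

theorem runs_deleteVertex (v : ℕ) : ∃ t, searchStructure.RunsUpdate ω
    (encState s₁ s k log TE TV TF TW) (.deleteVertex v)
    (encState s₁ s k (pair (pair (num 0) (num v)) log) TE TV TF TW) t ∧ t ≤ 100 := by
  refine runs_of_wp ?_
  simp [searchStructure, DataStructure.updateCode, Update.input, deleteVertexC, Returns, encState]

theorem runs_query : ∃ t, searchStructure.RunsQuery ω
    (encState s₁ s k log TE TV TF TW) (queryT s₁ TW) t ∧ t ≤ 100 := by
  refine runs_of_wp ?_
  by_cases h : s₁ = 0
  · subst h
    simp [searchStructure, queryC, Returns, encState, queryT]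
  · cases TW <;> simp [searchStructure, queryC, Returns, encState, queryT, Tree.enc, h]

theorem timeFactor_mul (m : ℕ) : timeFactor r s K * logTime m =
    80000 * cost (sizeBound r s) (logTime m * heightFactor r s K) 6 := by
  simp only [timeFactor, cost]
  ring

/-- All tables, old and new, are measured by the old number of hyperedges: the bounds allow for one
more hyperedge, so a single height bound serves the whole update. -/
theorem Inv.runs_addHyperedge (I : Inv r s₁ s k O G X log TE TV TF TW) {e : ℕ}
    {l : List ℕ} (he : e ∉ G.edges) (hr : l.length ≤ r) (hV : l.toFinset ⊆ G.verts)
    (hω : OracleBehaviour O s K (G.addHyperedge e l.toFinset hV) ω) {TE' TV' : Tree}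
    (hE : TE' = TE.ins (pair (pair (num e) (num 0)) (ofVals (nums l))))
    (hT : TV' = addIncT (num e) (nums l) TV) {P : Tree × Tree}
    (hP : P = updT ω (s + 1) s₁ k (candidates (s + 1) TE' TV' (num e)) TE TV TE' TV' TF TW) :
    ∃ t, searchStructure.RunsUpdate ω (encState s₁ s k log TE TV TF TW) (.addHyperedge e l)
      (encState s₁ s k log TE' TV' P.1 P.2) t ∧ t ≤ timeFactor r s K * logTime G.edges.card := by
  have I' := I.graph.addHyperedge he hr hV
  rw [← hE, ← hT] at I'
  have hc : (G.addHyperedge e l.toFinset hV).edges.card ≤ G.edges.card + 1 :=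
    Finset.card_insert_le _ _
  have T := I.graph.tables_of_card s K (Nat.le_succ G.edges.card)
  have T' := I'.tables_of_card s K hc
  have hM : ∀ t : Tree, t.Balanced → t.toList.length ≤ entryBound r s G.edges.card →
      t.ht < logTime G.edges.card * heightFactor r s K := fun t ht hl => ht_lt ht hl
  obtain ⟨ball, -, hcs⟩ := mem_candidates (s := s) I' e
  obtain ⟨hZ, -, -, hZr, -, hZ3⟩ := le_sizeBound r s
  have hu := (computes_upd T' T T' rfl hM hZ s₁ k (e := num e) rfl (ω := ω) (by
    intro A hA hin
    obtain ⟨C, -, hC, rfl⟩ := (hcs A).1 hA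
    exact oracle_time_le I' hω hc hC hin) I.sets_of_card).1
  rw [← hP] at hu
  rw [timeFactor_mul]
  have hlV : TV.toList.length + (ofVals (nums l)).toVals.length ≤ entryBound r s G.edges.card := by
    have h1 := I.graph.length_TV_le
    have h2 := pow_le_entryBound (r := r) (s := s) (m := G.edges.card) (b := r + 1)
      (a := (G.edges.card + 1) * r) (by omega) (by
        rw [pow_succ, Nat.mul_comm]
        refine Nat.mul_le_mul ?_ (by omega)
        exact (Nat.lt_two_pow_self).le.trans (Nat.pow_le_pow_left (by omega) _))
    rw [Nat.succ_mul] at h2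
    simp only [toVals_ofVals, List.length_map]
    omega
  have hi := computes_ins' (ω := ω) (kv := pair (pair (num e) (num 0)) (ofVals (nums l)))
    I.graph.balE T.htE T.hZ (by simp [Val.size]; omega)
  have ha := computes_addInc (ω := ω) hZ3 T.hU hM (ofVals (nums l)) (e := num e) rfl
    (by simp [Val.size]) I.graph.balV hlV
  rw [toVals_ofVals, ← hT] at ha
  rw [← hE] at hi
  have ha' : ((nums l).length + 1) * (400 * cost (sizeBound r s)
      (logTime G.edges.card * heightFactor r s K) 1) ≤
      800 * cost (sizeBound r s) (logTime G.edges.card * heightFactor r s K) 2 :=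
    loop_le T.hZ (by simp; omega)
  generalize logTime G.edges.card * heightFactor r s K = U at *
  have c0 : 1 ≤ cost (sizeBound r s) U 1 := T.hZ.trans (le_cost_one T.hU)
  have c1 : cost (sizeBound r s) U 1 ≤ cost (sizeBound r s) U 6 := cost_mono T.hZ (by norm_num)
  have c2 : cost (sizeBound r s) U 2 ≤ cost (sizeBound r s) U 6 := cost_mono T.hZ (by norm_num)
  refine runs_of_wp ?_
  simp [searchStructure, DataStructure.updateCode, Update.input, addHyperedgeC, encState, ofList_eq]
  refine ⟨_, _, hi, _, _, ha, _, _, hu, ?_⟩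
  simp [Returns]
  simp at ha'
  omega

theorem Inv.runs_deleteHyperedge (I : Inv r s₁ s k O G X log TE TV TF TW) {e : ℕ}
    (he : e ∈ G.edges) (hω : OracleBehaviour O s K (G.deleteHyperedge e) ω) {TE' TV' : Tree}
    (hE : TE' = TE.del (pair (num e) (num 0)))
    (hT : TV' = delIncT (num e) (nums (X e)) TV) {P : Tree × Tree}
    (hP : P = updT ω (s + 1) s₁ k (candidates (s + 1) TE TV (num e)) TE TV TE' TV' TF TW) :
    ∃ t, searchStructure.RunsUpdate ω (encState s₁ s k log TE TV TF TW) (.deleteHyperedge e)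
      (encState s₁ s k log TE' TV' P.1 P.2) t ∧ t ≤ timeFactor r s K * logTime G.edges.card := by
  have I' := I.graph.deleteHyperedge he
  rw [← hE, ← hT] at I'
  have hc : (G.deleteHyperedge e).edges.card ≤ G.edges.card + 1 :=
    (Finset.card_le_card (Finset.erase_subset _ _)).trans (Nat.le_succ _)
  have T := I.graph.tables_of_card s K (Nat.le_succ G.edges.card)
  have T' := I'.tables_of_card s K hc
  have hM : ∀ t : Tree, t.Balanced → t.toList.length ≤ entryBound r s G.edges.card →
      t.ht < logTime G.edges.card * heightFactor r s K := fun t ht hl => ht_lt ht hl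
  obtain ⟨ball, -, hcs⟩ := mem_candidates (s := s) I.graph e
  obtain ⟨hZ, -, -, hZr, -, hZ3⟩ := le_sizeBound r s
  have hu := (computes_upd T T T' rfl hM hZ s₁ k (e := num e) rfl (ω := ω) (by
    intro A hA hin
    obtain ⟨C, -, hC, rfl⟩ := (hcs A).1 hA
    exact oracle_time_le I' hω hc hC hin) I.sets_of_card).1
  rw [← hP] at hu
  rw [timeFactor_mul]
  have hf := computes_values (ω := ω) (Z := sizeBound r s) (n := 1) I.graph.balE T.htE
    (by omega) (g := num e) rfl
  have hi := computes_del' (ω := ω) (k := pair (num e) (num 0))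
    I.graph.balE T.htE T.hZ (by simp [Val.size]; omega)
  have hv : (TE.values 1 (num e)) = [ofVals (nums (X e))] := I.graph.values_edge he
  rw [hv] at hf
  have ha := computes_delInc (ω := ω) hZ3 T.hU hM (ofVals (nums (X e))) (e := num e) rfl
    (by simp [Val.size]) I.graph.balV I.graph.sortV (I.graph.length_le (Nat.le_succ _)).2
  rw [toVals_ofVals, ← hT] at ha
  rw [← hE] at hi
  have ha' : ((nums (X e)).length + 1) * (700 * cost (sizeBound r s)
      (logTime G.edges.card * heightFactor r s K) 1) ≤
      1400 * cost (sizeBound r s) (logTime G.edges.card * heightFactor r s K) 2 :=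
    loop_le T.hZ (by have := I.graph.X_len e; simp; omega)
  generalize logTime G.edges.card * heightFactor r s K = U at *
  have c0 : 1 ≤ cost (sizeBound r s) U 1 := T.hZ.trans (le_cost_one T.hU)
  have c1 : cost (sizeBound r s) U 1 ≤ cost (sizeBound r s) U 6 := cost_mono T.hZ (by norm_num)
  have c2 : cost (sizeBound r s) U 2 ≤ cost (sizeBound r s) U 6 := cost_mono T.hZ (by norm_num)
  refine runs_of_wp ?_
  simp [searchStructure, DataStructure.updateCode, Update.input, deleteHyperedgeC, encState]
  refine ⟨_, _, hi, _, _, hf, _, _, ha, _, _, hu, ?_⟩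
  simp [Returns]
  simp at ha'
  omega

/-- Correctness of the stored value. -/
def Stores (r s₁ s k : ℕ) (O : Oracle) (G : Hypergraph) (σ : Val) : Prop :=
  ∃ X log TE TV TF TW, Inv r s₁ s k O G X log TE TV TF TW ∧ σ = encState s₁ s k log TE TV TF TW

theorem Stores.update {G' : Hypergraph} {σ : Val} {o : Update} (h : Stores r s₁ s k O G σ)
    (hs : s₁ ≤ s) (ho : UpdateStep r G o G') (hω : OracleBehaviour O s K G' ω) :
    ∃ σ' t, searchStructure.RunsUpdate ω σ o σ' t ∧ t ≤ updateTime 100 (timeFactor r s K) G o ∧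
      Stores r s₁ s k O G' σ' := by
  obtain ⟨X, log, TE, TV, TF, TW, I, rfl⟩ := h
  cases ho with
  | addVertex v hv =>
    obtain ⟨t, h1, h2⟩ := runs_addVertex (ω := ω) (s₁ := s₁) (s := s) (k := k) (log := log)
      (TE := TE) (TV := TV) (TF := TF) (TW := TW) v
    exact ⟨_, t, h1, h2, _, _, _, _, _, _, I.addVertex v, rfl⟩
  | deleteVertex v hv hi =>
    obtain ⟨t, h1, h2⟩ := runs_deleteVertex (ω := ω) (s₁ := s₁) (s := s) (k := k) (log := log)
      (TE := TE) (TV := TV) (TF := TF) (TW := TW) v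
    exact ⟨_, t, h1, h2, _, _, _, _, _, _, I.deleteVertex v hi, rfl⟩
  | addHyperedge e l he hl hr hV =>
    obtain ⟨t, h1, h2⟩ := I.runs_addHyperedge he hr hV hω rfl rfl rfl
    exact ⟨_, t, h1, h2, _, _, _, _, _, _, I.addHyperedge hs he hr hV hω rfl rfl rfl, rfl⟩
  | deleteHyperedge e he =>
    obtain ⟨t, h1, h2⟩ := I.runs_deleteHyperedge he hω rfl rfl rfl
    exact ⟨_, t, h1, h2, _, _, _, _, _, _, I.deleteHyperedge hs he hω rfl rfl rfl, rfl⟩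

/-- Evaluation is deterministic, so the run behind a reachable state coincides with the run
constructed in `runs_start` or `Stores.update` and inherits its invariant. -/
theorem stores_of_reachable {σ : Val} (hs : s₁ ≤ s)
    (h : searchStructure.Reachable r s₁ s k O K G σ) : Stores r s₁ s k O G σ := by
  induction h with
  | start h =>
    obtain ⟨t, h', -⟩ := runs_start (r := r) (s₁ := s₁) (s := s) (k := k)
    exact ⟨_, _, _, _, _, _, inv_empty, (Runs.det h h').1⟩
  | update _ ho hω h ih =>
    obtain ⟨σ', t, h1, -, h2⟩ := ih.update hs ho hω
    rw [(Runs.det h h1).1]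
    exact h2

end Operations

end DynLocalSearch

namespace DynLocalSearch
open Val

/-! ### Computability of the time bounds -/

theorem primrec_pow : Primrec₂ ((· ^ ·) : ℕ → ℕ → ℕ) := Primrec₂.unpaired'.1 Nat.Primrec.pow

theorem primrec_sizeBound : Primrec₂ sizeBound := by
  have hr : Primrec fun p : ℕ × ℕ => p.1 := Primrec.fst
  have hs : Primrec fun p : ℕ × ℕ => p.2 := Primrec.snd
  have c : ∀ n : ℕ, Primrec fun _ : ℕ × ℕ => n := Primrec.const
  have hadd := @Primrec.nat_add
  have hmul := @Primrec.nat_mul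
  have h1 : Primrec fun p : ℕ × ℕ => p.2 + 1 := hadd.comp hs (c 1)
  have h2 : Primrec fun p : ℕ × ℕ => 2 ^ ((1 + p.1 * (p.2 + 1)) ^ p.2 + 1) :=
    primrec_pow.comp (c 2) (hadd.comp (primrec_pow.comp (hadd.comp (c 1) (hmul.comp hr h1)) hs) (c 1))
  have h3 : Primrec fun p : ℕ × ℕ => 2 * (p.2 * p.1) + 2 * p.2 + 3 :=
    hadd.comp (hadd.comp (hmul.comp (c 2) (hmul.comp hs hr)) (hmul.comp (c 2) hs)) (c 3)
  exact hadd.comp (hadd.comp (hadd.comp (hadd.comp h2 h3) (primrec_pow.comp (c 2) h1)) hr)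
    (hadd.comp hs (c 2))

theorem primrec_timeFactor : Primrec fun p : (ℕ × ℕ) × ℕ => timeFactor p.1.1 p.1.2 p.2 := by
  have hr : Primrec fun p : (ℕ × ℕ) × ℕ => p.1.1 := Primrec.fst.comp Primrec.fst
  have hs : Primrec fun p : (ℕ × ℕ) × ℕ => p.1.2 := Primrec.snd.comp Primrec.fst
  have hK : Primrec fun p : (ℕ × ℕ) × ℕ => p.2 := Primrec.snd
  have c : ∀ n : ℕ, Primrec fun _ : (ℕ × ℕ) × ℕ => n := Primrec.const
  have hadd := @Primrec.nat_add
  have hmul := @Primrec.nat_mul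
  have hZ : Primrec fun p : (ℕ × ℕ) × ℕ => sizeBound p.1.1 p.1.2 := primrec_sizeBound.comp hr hs
  have hH : Primrec fun p : (ℕ × ℕ) × ℕ => heightFactor p.1.1 p.1.2 p.2 :=
    hadd.comp (hadd.comp (hadd.comp (hmul.comp (c 4) (hadd.comp (hadd.comp hs hr) (c 1)))
      (hmul.comp (c 4) hZ)) (c 6)) (hmul.comp (c 2) hK)
  exact hmul.comp (c 80000) (hmul.comp (primrec_pow.comp hZ (c 6)) hH)

theorem computable_timeFactor {a : ℕ × ℕ → ℕ} (ha : Computable a) :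
    Computable fun p : ℕ × ℕ × ℕ => timeFactor p.1 p.2.1 (a (p.1, p.2.1)) := by
  have h : Computable fun p : ℕ × ℕ × ℕ => (p.1, p.2.1) :=
    Computable.fst.pair (Computable.fst.comp Computable.snd)
  have h' : Computable fun p : ℕ × ℕ × ℕ => ((p.1, p.2.1), a (p.1, p.2.1)) := h.pair (ha.comp h)
  have h2 := primrec_timeFactor.to_comp
  generalize timeFactor = F at h2 ⊢
  exact Computable.comp (f := fun p : (ℕ × ℕ) × ℕ => F p.1.1 p.1.2 p.2) h2 h'

theorem le_timeFactor (r s K : ℕ) : 100 ≤ timeFactor r s K := by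
  have h1 : 1 ≤ sizeBound r s ^ 6 := Nat.one_le_pow _ _ (by have := le_sizeBound r s; omega)
  have h2 : 1 ≤ heightFactor r s K := by unfold heightFactor; omega
  have := Nat.mul_le_mul h1 h2
  unfold timeFactor
  omega

end DynLocalSearch
-- The theorem
open DynLocalSearch in
theorem mainTheorem6 :
    ∃ (D : DataStructure) (c : ℕ) (decode : Val → Finset ℕ × Finset (ℕ × Finset ℕ)),
      ∀ a : ℕ × ℕ → ℕ, Computable a →
      ∃ f : ℕ × ℕ × ℕ → ℕ, Computable f ∧
      ∀ r s₁ s₂ k : ℕ, s₁ ≤ s₂ → ∀ O : Oracle,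
        -- initialization
        (∃ σ t, D.RunsStart r s₁ s₂ k σ t ∧ t ≤ c) ∧
        ∀ (G : Hypergraph) (σ : Val), D.Reachable r s₁ s₂ k O (a (r, s₂)) G σ →
          -- the stored value represents `G`
          decode σ = (G.verts, G.labelled G.edges) ∧
          -- updates
          (∀ (o : Update) (G' : Hypergraph), UpdateStep r G o G' →
            ∀ ω, OracleBehaviour O s₂ (a (r, s₂)) G' ω →
              ∃ σ' t, D.RunsUpdate ω σ o σ' t ∧ t ≤ updateTime c (f (r, s₂, k)) G o) ∧
          -- queries
          (∀ ω, OracleBehaviour O s₂ (a (r, s₂)) G ω →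
            ∃ out t, D.RunsQuery ω σ out t ∧ t ≤ f (r, s₂, k) ∧
              QueryCorrect G O s₁ s₂ k out) := by
  -- The bound does not involve `k`: this parameter only decides which candidates are kept, not how
  -- many are examined.
  refine ⟨searchStructure, 100, decodeState, fun a ha =>
    ⟨fun p => timeFactor p.1 p.2.1 (a (p.1, p.2.1)), computable_timeFactor ha, ?_⟩⟩
  intro r s₁ s₂ k hs O
  refine ⟨⟨_, runs_start⟩, fun G σ hG => ?_⟩
  have hσ := stores_of_reachable hs hG
  refine ⟨?_, fun o G' ho ω hω => ?_, fun ω _ => ?_⟩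
  · obtain ⟨X, log, TE, TV, TF, TW, I, rfl⟩ := hσ
    exact Prod.ext I.log I.graph.treeLabels_eq
  · obtain ⟨σ', t, h1, h2, -⟩ := hσ.update hs ho hω
    exact ⟨σ', t, h1, h2⟩
  · obtain ⟨X, log, TE, TV, TF, TW, I, rfl⟩ := hσ
    obtain ⟨t, h1, h2⟩ := runs_query (ω := ω) (s₁ := s₁) (s := s₂) (k := k) (log := log)
      (TE := TE) (TV := TV) (TF := TF) (TW := TW)
    exact ⟨_, t, h1, h2.trans (le_timeFactor r s₂ _), I.queryCorrect hs⟩
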